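/- Let $M$ be a smooth manifold of dimension $n=p+q\ge 3$ with a conformal structure $c$ of signature $(p,q)$, i.e. a full class of smooth pseudo-Riemannian metrics of signature $(p,q)$ that differ by smooth positive factors, and let $r\le\min\{p,q\}$. Let $\gamma$ be a smooth parametrized curve in $M$, defined on an open interval $I$, with derived vectors $U^{(0)}=U=\dot\gamma$, $U^{(i+1)}=\nabla_U U^{(i)}$ ($\nabla$ the Levi-Civita connection of a metric of $c$). Suppose that $\gamma$ is $r$-null: for some $g\in c$, the vectors $U,\dots,U^{(r-1)}$ are linearly independent and null, and $U^{(r)}$ is not null, at every time. In the scale $g\in c$, a standard tractor is a triple $(\sigma,\mu,\rho)\in\mathbb R\oplus TM\oplus\mathbb R$ (densities being trivialized by $g$); the tractor metric is $\langle(\sigma,\mu,\rho),(\tau,\nu,\pi)\rangle=g(\mu,\nu)+\sigma\pi+\rho\tau$. When $g$ is replaced by $\Omega^2g$, with $\Omega>0$ and $\Upsilon=\Omega^{-1}d\Omega$, a tractor is represented by $$\bigl(\Omega\sigma,\ \Omega^{-1}(\mu+\sigma\Upsilon^\sharp),\ \Omega^{-1}(\rho-\Upsilon(\mu)-\tfrac12|\Upsilon|^2\sigma)\bigr).$$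 With the Schouten tensor $\mathsf P=\frac1{n-2}\bigl(\mathrm{Ric}-\frac{\mathrm{Sc}}{2(n-1)}g\bigr)$, the tractor connection along $\gamma$ is $$\tfrac{d}{dt}(\sigma,\mu,\rho)=\bigl(\dot\sigma-g(U,\mu),\ \nabla_U\mu+\rho U+\sigma\mathsf P(U,\cdot)^\sharp,\ \dot\rho-\mathsf P(U,\mu)\bigr).$$ Put $u=\sqrt{|g(U^{(r)},U^{(r)})|}$, $\mathbf T=(0,0,u^{-1})$, $\mathbf U^{(i)}=\frac{d^{i+1}}{dt^{i+1}}\mathbf T$, and $\alpha=\langle\mathbf U^{(r+1)},\mathbf U^{(r+1)}\rangle$. Then: 1. (Conformal invariance.) $\gamma$ is $r$-null in every scale of $c$; $\mathbf T$ and all its derivatives along $\gamma$ are standard tractors, i.e. their expressions in different scales are related by the above change; and $\alpha$ is the same in all scales. 2. (Transformation law.) There is a constant $\epsilon=\pm1$ such that $\langle\mathbf U^{(r)},\mathbf U^{(r)}\rangle=\epsilon$ in every scale. Let $J\subseteq I$ be an open subinterval and $\tilde t=s(t)$ a smooth change of parameter on $J$ with $s'\ne0$ everywhere. Then the reparametrized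 curve is $r$-null, and the function $\tilde\alpha$ of the reparametrized curve satisfies $$\tilde\alpha(s(t))=s'(t)^{-2}\bigl(\alpha(t)-2\epsilon B_{r+1}\,\mathcal S(s)(t)\bigr),\qquad \mathcal S(s)=\frac{s'''}{s'}-\frac32\Bigl(\frac{s''}{s'}\Bigr)^2,$$ where $A_0=r+1$, $B_0=0$, $A_{k+1}=A_k+r-k$, $B_{k+1}=B_k+A_k$; explicitly, $B_{r+1}=\frac16(r+1)(r+2)(2r+3)$. 3. (Projective parameters.) Call a parameter $\tilde t=s(t)$ on $J$ (smooth, $s'\neq0$) projective if $\tilde\alpha$ vanishes identically. Every $t_0\in I$ lies in an open subinterval $J\subseteq I$ on which a projective parameter exists. 4. (Freedom.) If $s$ is a projective parameter on an open subinterval $J\subseteq I$, then a function $\tilde s$ on $J$ is a projective parameter if and only if there are real $a,b,d,e$ with $ae-bd\ne0$ such that, on $J$, $ds+e\ne0$ everywhere and $\tilde s=(as+b)/(ds+e)$. So the freedom is the projective group of the line. -/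

import Mathlib

open Set Manifold
open scoped ContDiff Manifold

noncomputable section

namespace ConfCurve

/-- The model space `ℝⁿ`. -/
abbrev E (n : ℕ) : Type := EuclideanSpace ℝ (Fin n)

section Metric

variable {n : ℕ} {M : Type*} [TopologicalSpace M] [ChartedSpace (E n) M]

/-- The tangent space of the `n`-manifold `M` at `x`. It is the model space, a vector being
identified with its components in the preferred chart at `x`. -/
abbrev Tan (n : ℕ) {M : Type*} [TopologicalSpace M] [ChartedSpace (E n) M] (x : M) : Type :=
  TangentSpace (𝓡 n) x

/-- The component matrix, as a bilinear form on `ℝⁿ`, of a field `h` of bilinear forms on the tangent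
spaces, in the chart around `x₀`, at the point with coordinates `y`. -/
def chartForm [IsManifold (𝓡 n) 1 M] (h : ∀ x : M, Tan n x →L[ℝ] Tan n x →L[ℝ] ℝ) (x₀ : M)
    (y : E n) : E n →L[ℝ] E n →L[ℝ] ℝ :=
  let x : M := (extChartAt (𝓡 n) x₀).symm y
  let A : E n →L[ℝ] E n := tangentCoordChange (𝓡 n) x₀ x x
  ContinuousLinearMap.bilinearComp (h x : E n →L[ℝ] E n →L[ℝ] ℝ) A A

/-- Smooth pseudo-Riemannian metrics of signature `(p, q)` on `M`. -/
structure PseudoMetric (n p q : ℕ) (M : Type*) [TopologicalSpace M] [ChartedSpace (E n) M]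
    [IsManifold (𝓡 n) 1 M] where
  /-- the metric at each point -/
  val : ∀ x : M, Tan n x →L[ℝ] Tan n x →L[ℝ] ℝ
  symm : ∀ (x : M) (v w : Tan n x), val x v w = val x w v
  signature : ∀ x : M, ∃ b : Module.Basis (Fin p ⊕ Fin q) ℝ (Tan n x), ∀ i j,
    val x (b i) (b j) = if i = j then Sum.elim (fun _ => (1 : ℝ)) (fun _ => -1) i else 0
  smooth : ∀ x₀ : M, ContDiffOn ℝ ∞ (chartForm val x₀) (extChartAt (𝓡 n) x₀).target

variable {p q : ℕ} [IsManifold (𝓡 n) 1 M]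

/-- `g' = Ω² g` with a smooth everywhere positive function `Ω`. -/
structure IsRescaling (g g' : PseudoMetric n p q M) (Ω : M → ℝ) : Prop where
  smooth : ContMDiff (𝓡 n) 𝓘(ℝ, ℝ) ∞ Ω
  pos : ∀ x, 0 < Ω x
  eq : ∀ (x : M) (v w : Tan n x), g'.val x v w = Ω x ^ 2 * g.val x v w

/-- A conformal structure of signature `(p, q)`: a full class of metrics that differ by a
positive smooth function. -/
structure ConformalStructure (n p q : ℕ) (M : Type*) [TopologicalSpace M] [ChartedSpace (E n) M]
    [IsManifold (𝓡 n) 1 M] where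
  /-- the metrics of the class -/
  metrics : Set (PseudoMetric n p q M)
  nonempty : metrics.Nonempty
  mem_iff : ∀ g ∈ metrics, ∀ g' : PseudoMetric n p q M,
    g' ∈ metrics ↔ ∃ Ω : M → ℝ, IsRescaling g g' Ω

/-! ### Levi-Civita connection and curvature in charts -/

/-- The components of `g` in the chart around `x₀`. -/
def coordMetric (g : PseudoMetric n p q M) (x₀ : M) : E n → E n →L[ℝ] E n →L[ℝ] ℝ :=
  chartForm g.val x₀

/-- The inverse metric `(ℝⁿ)* → ℝⁿ` in the chart around `x₀`. -/
def coordSharp (g : PseudoMetric n p q M) (x₀ : M) (y : E n) : (E n →L[ℝ] ℝ) →L[ℝ] E n :=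
  (coordMetric g x₀ y).inverse

/-- The Christoffel symbols `Γ(v, w)`, that is
`g (Γ(v, w), z) = ½ ((∂_v g)(w, z) + (∂_w g)(v, z) - (∂_z g)(v, w))` for all `z`. -/
def christoffel (g : PseudoMetric n p q M) (x₀ : M) (y v w : E n) : E n :=
  let dg : E n →L[ℝ] E n →L[ℝ] E n →L[ℝ] ℝ := fderiv ℝ (coordMetric g x₀) y
  coordSharp g x₀ y ((1 / 2 : ℝ) • (dg v w + dg w v - (dg.flip v).flip w))

/-- The `i`-th coordinate vector. -/
def stdVec (i : Fin n) : E n := EuclideanSpace.single i (1 : ℝ)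

/-- The `i`-th coordinate function. -/
def stdCovec (i : Fin n) : E n →L[ℝ] ℝ := EuclideanSpace.proj i

/-- The curvature `R(u, v) w = ∇_u ∇_v w - ∇_v ∇_u w` for constant `u, v, w` in the chart. -/
def riem (g : PseudoMetric n p q M) (x₀ : M) (y u v w : E n) : E n :=
  fderiv ℝ (fun z => christoffel g x₀ z v w) y u - fderiv ℝ (fun z => christoffel g x₀ z u w) y v
    + christoffel g x₀ y u (christoffel g x₀ y v w)
    - christoffel g x₀ y v (christoffel g x₀ y u w)

/-- The Ricci curvature, the trace of `u ↦ R(u, v) w` (positive on round spheres). -/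
def ricci (g : PseudoMetric n p q M) (x₀ : M) (y v w : E n) : ℝ :=
  ∑ i, riem g x₀ y (stdVec i) v w i

/-- The scalar curvature `g^{ij} Ric_{ij}`. -/
def scalarCurv (g : PseudoMetric n p q M) (x₀ : M) (y : E n) : ℝ :=
  ∑ i, ∑ j, coordSharp g x₀ y (stdCovec i) j * ricci g x₀ y (stdVec i) (stdVec j)

/-- The Schouten tensor `P = (Ric - Sc / (2 (n - 1)) g) / (n - 2)` at the point `x`. -/
def schouten (g : PseudoMetric n p q M) (x : M) (v w : Tan n x) : ℝ :=
  let y : E n := extChartAt (𝓡 n) x x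
  ((n : ℝ) - 2)⁻¹ *
    (ricci g x y v w - scalarCurv g x y / (2 * ((n : ℝ) - 1)) * g.val x v w)

/-- The inverse metric (raising of an index) at the point `x`. -/
def sharp (g : PseudoMetric n p q M) (x : M) (ξ : E n →L[ℝ] ℝ) : Tan n x :=
  ContinuousLinearMap.inverse (g.val x : E n →L[ℝ] E n →L[ℝ] ℝ) ξ

/-- The vector `P(v, ·)^♯`, that is `v^c P_c^a`. -/
def schoutenSharp (g : PseudoMetric n p q M) (x : M) (v : Tan n x) : Tan n x :=
  sharp g x (∑ j, schouten g x v (stdVec j : E n) • stdCovec j)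

/-! ### Curves and derived vectors -/

/-- The tangent vector `U` of a parametrized curve. -/
def velocity (n : ℕ) {M : Type*} [TopologicalSpace M] [ChartedSpace (E n) M] (γ : ℝ → M) (t : ℝ) :
    Tan n (γ t) :=
  (mfderiv 𝓘(ℝ, ℝ) (𝓡 n) γ t : ℝ →L[ℝ] E n) 1

/-- The Levi-Civita derivative along `γ` of a vector field along `γ`, computed at time `t` in the
chart around `γ t`: `dV^k/dt + Γ^k_{ij} U^i V^j`. -/
def covDeriv (g : PseudoMetric n p q M) (γ : ℝ → M) (V : ∀ t, Tan n (γ t)) (t : ℝ) : Tan n (γ t) :=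
  let x₀ : M := γ t
  let coords : ℝ → E n := fun s => tangentCoordChange (𝓡 n) (γ s) x₀ (γ s) (V s)
  (deriv coords t + christoffel g x₀ (extChartAt (𝓡 n) x₀ x₀) (velocity n γ t) (V t) : E n)

/-- The derived vectors `U^{(i)}`, with `U^{(0)} = U`. -/
def derivedVec (g : PseudoMetric n p q M) (γ : ℝ → M) : ℕ → ∀ t, Tan n (γ t)
  | 0 => velocity n γ
  | i + 1 => covDeriv g γ (derivedVec g γ i)

/-- In the scale `g`, the curve `γ` is `r`-null on `I`: the vectors `U, …, U^{(r-1)}` are linearly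
independent and null, and `U^{(r)}` is not null. -/
def IsRNullIn (g : PseudoMetric n p q M) (r : ℕ) (γ : ℝ → M) (I : Set ℝ) : Prop :=
  ∀ t ∈ I, LinearIndependent ℝ (fun i : Fin r => derivedVec g γ i t) ∧
    (∀ i < r, g.val (γ t) (derivedVec g γ i t) (derivedVec g γ i t) = 0) ∧
    g.val (γ t) (derivedVec g γ r t) (derivedVec g γ r t) ≠ 0

/-- Smooth curves `γ` on `I` that are `r`-null for some scale of the conformal structure `c`. -/
def IsRNullCurve (c : ConformalStructure n p q M) (r : ℕ) (γ : ℝ → M) (I : Set ℝ) : Prop :=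
  ContMDiffOn 𝓘(ℝ, ℝ) (𝓡 n) ∞ γ I ∧ ∃ g ∈ c.metrics, IsRNullIn g r γ I

/-! ### Standard tractors in a scale -/

/-- The standard tractor fibre at `x` in a scale, `(σ, μ, ρ) ∈ ℝ ⊕ T_x M ⊕ ℝ`; all densities are
trivialized by the scale. -/
@[ext]
structure Tractor (n : ℕ) {M : Type*} [TopologicalSpace M] [ChartedSpace (E n) M] (x : M) where
  /-- the top (projecting) slot -/
  top : ℝ
  /-- the middle slot -/
  mid : Tan n x
  /-- the bottom slot -/
  bot : ℝ

/-- The standard tractor metric. -/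
def pairing (g : PseudoMetric n p q M) (x : M) (S S' : Tractor n x) : ℝ :=
  g.val x S.mid S'.mid + S.top * S'.bot + S.bot * S'.top

/-- The one-form `Υ = Ω⁻¹ dΩ`. -/
def upsilon (n : ℕ) {M : Type*} [TopologicalSpace M] [ChartedSpace (E n) M] (Ω : M → ℝ) (x : M) :
    E n →L[ℝ] ℝ :=
  (Ω x)⁻¹ • (mfderiv (𝓡 n) 𝓘(ℝ, ℝ) Ω x : E n →L[ℝ] ℝ)

/-- Change of the splitting of a standard tractor when `g` is replaced by `Ω² g`. The slots have
conformal weights `1`, `-1`, `-1`; this is the source of the factors `Ω`, `Ω⁻¹`, `Ω⁻¹`. -/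
def rescaleTractor (g : PseudoMetric n p q M) (Ω : M → ℝ) (x : M) (S : Tractor n x) : Tractor n x :=
  let Υ : E n →L[ℝ] ℝ := upsilon n Ω x
  let Υs : Tan n x := sharp g x Υ
  { top := Ω x * S.top
    mid := (Ω x)⁻¹ • (S.mid + S.top • Υs)
    bot := (Ω x)⁻¹ * (S.bot - Υ S.mid - 1 / 2 * Υ Υs * S.top) }

/-- A triple given in every scale of `c` is an element of the standard tractor bundle of the
conformal manifold if its representatives are related by the change of splitting. -/
def IsStandardTractor (c : ConformalStructure n p q M) (x : M)
    (S : PseudoMetric n p q M → Tractor n x) : Prop :=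
  ∀ g ∈ c.metrics, ∀ g' ∈ c.metrics, ∀ Ω : M → ℝ, IsRescaling g g' Ω →
    S g' = rescaleTractor g Ω x (S g)

/-- The standard tractor connection along a curve `γ`, in the scale `g`. -/
def tractorDeriv (g : PseudoMetric n p q M) (γ : ℝ → M) (S : ∀ t, Tractor n (γ t)) (t : ℝ) :
    Tractor n (γ t) :=
  let U : Tan n (γ t) := velocity n γ t
  { top := deriv (fun s => (S s).top) t - g.val (γ t) U (S t).mid
    mid := covDeriv g γ (fun s => (S s).mid) t + (S t).bot • U
      + (S t).top • schoutenSharp g (γ t) U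
    bot := deriv (fun s => (S s).bot) t - schouten g (γ t) U (S t).mid }

/-- The density `u = √|⟨U^{(r)}, U^{(r)}⟩|` in the scale `g`. -/
def speed (g : PseudoMetric n p q M) (r : ℕ) (γ : ℝ → M) (t : ℝ) : ℝ :=
  √|g.val (γ t) (derivedVec g γ r t) (derivedVec g γ r t)|

/-- The `k`-th derivative along `γ` of the canonical lift `T = (0, 0, u⁻¹)`. -/
def derivedT (g : PseudoMetric n p q M) (r : ℕ) (γ : ℝ → M) : ℕ → ∀ t, Tractor n (γ t)
  | 0 => fun t => { top := 0, mid := 0, bot := (speed g r γ t)⁻¹ }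
  | k + 1 => tractorDeriv g γ (derivedT g r γ k)

/-- The derived tractors `U^{(i)}`, with `U^{(0)} = U = dT/dt`. -/
def derivedU (g : PseudoMetric n p q M) (r : ℕ) (γ : ℝ → M) (i : ℕ) : ∀ t, Tractor n (γ t) :=
  derivedT g r γ (i + 1)

/-- `α = ⟨U^{(r+1)}, U^{(r+1)}⟩`. -/
def alpha (g : PseudoMetric n p q M) (r : ℕ) (γ : ℝ → M) (t : ℝ) : ℝ :=
  pairing g (γ t) (derivedU g r γ (r + 1) t) (derivedU g r γ (r + 1) t)

end Metric

/-! ### Parameters -/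

/-- Regular smooth changes of parameter on `J`. -/
def IsParameter (J : Set ℝ) (s : ℝ → ℝ) : Prop :=
  ContDiffOn ℝ ∞ s J ∧ ∀ t ∈ J, deriv s t ≠ 0

/-- The curve `γ` on `J`, parametrized by the new parameter `s` (so that its value at `s t` is
`γ t` for `t ∈ J`). -/
def reparam {M : Type*} (γ : ℝ → M) (J : Set ℝ) (s : ℝ → ℝ) : ℝ → M :=
  fun τ => γ (Function.invFunOn s J τ)

/-- The Schwarzian derivative. -/
def schwarzian (s : ℝ → ℝ) (t : ℝ) : ℝ :=
  iteratedDeriv 3 s t / deriv s t - 3 / 2 * (iteratedDeriv 2 s t / deriv s t) ^ 2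

/-- The coefficients `A_k` with `A_0 = r + 1`, `A_{k+1} = A_k + r - k`. -/
def coeffA (r : ℕ) : ℕ → ℝ
  | 0 => (r : ℝ) + 1
  | k + 1 => coeffA r k + r - k

/-- The coefficients `B_k` with `B_0 = 0`, `B_{k+1} = B_k + A_k`. -/
def coeffB (r : ℕ) : ℕ → ℝ
  | 0 => 0
  | k + 1 => coeffB r k + coeffA r k

/-- `s` is a projective parameter on `J` of the `r`-null curve `γ`: a regular parameter for which
`α` vanishes identically, for every scale. -/
def IsProjectiveParameter {n p q : ℕ} {M : Type*} [TopologicalSpace M] [ChartedSpace (E n) M]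
    [IsManifold (𝓡 n) 1 M] (c : ConformalStructure n p q M) (r : ℕ) (γ : ℝ → M) (J : Set ℝ)
    (s : ℝ → ℝ) : Prop :=
  IsParameter J s ∧ ∀ g ∈ c.metrics, ∀ τ ∈ s '' J, alpha g r (reparam γ J s) τ = 0

end ConfCurve

end

/-! ### Levi-Civita connection, curvature and Schouten tensor of a metric on an open set -/

noncomputable section

namespace ConfCurve

/-! ### Metrics on open subsets of a vector space -/

section Flat

set_option maxSynthPendingDepth 3

variable {F : Type*} [NormedAddCommGroup F] [NormedSpace ℝ F]

/-! The algebraic core concerns a field X_0 along γ and its successive derivatives X_1, X_2, … for a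
connection that preserves a symmetric pairing. If X_0, …, X_{m-1} are null, differentiating
vanishing Gram entries shows that ⟨X_i, X_j⟩ = 0 for i + j < 2m, and that the entries with i + j =
2m alternate in sign (`gram_eq_zero`, `gram_antidiagonal`). This is used for the derived vectors
(Levi-Civita connection, m = r) and for T and its derivatives (tractor connection, m = r + 1),
whence the common notion `DerivModule`.

Conformal invariance. A change of scale alters U^{(k)}, k ≤ r, only by a combination of the earlier
derived vectors, since the term -g(U, V)Υ♯ in the change of ∇_U V vanishes on them (`derV_rescale`).
So r-nullity persists, u is multiplied by Ω, and T is a tractor. Its derivatives are tractors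
because the tractor connection is invariant (`tder_resc`), which rests on the transformation of the
Schouten tensor.

Transformation law. Put f = s' and w = f'/f, and let T_k be the k-th derivative of T. Under the
change of parameter T is multiplied by |f|^{r+1} and d/dt by 1/f. Keeping three leading terms, the
new U^{(r+1)} is ±f⁻¹(T_{r+2} + A w T_{r+1} + (B w' + C w²) T_r + …), the rest lying in the span of
T_0, …, T_{r-1} (`lead₃_reparam`). The Gram relations give its square as f⁻²(α - 2ε(B w' + C w²) + ε
A² w²), and A² - 2C = B (`coeff_identity`) turns the bracket into α - 2εB(w' - w²/2), where w' -
w²/2 is the Schwarzian.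

Projective parameters. As B > 0, a parameter is projective exactly if its Schwarzian is Q = α/(2εB).
Local existence is Picard–Lindelöf (`exists_isParameter`). Every parameter with Schwarzian Q is a
quotient of two independent solutions of y'' = -Qy/2, so two such parameters differ by a Möbius map
(`exists_moebius`).

The statement computes every tensor in the preferred chart of the point at hand. To differentiate
along γ a fixed chart is needed, so the connection and the curvature are first treated on open sets
of a vector space and shown to be natural under local diffeomorphisms. -/

/-- A smooth nondegenerate symmetric form on an open set `W`. -/
structure FlatMetric (h : F → F →L[ℝ] F →L[ℝ] ℝ) (W : Set F) : Prop where
  isOpen : IsOpen W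
  smooth : ∀ y ∈ W, ContDiffAt ℝ ∞ h y
  symm : ∀ y ∈ W, ∀ v w, h y v w = h y w v
  inv : ∀ y ∈ W, (h y).IsInvertible

/-- The trilinear form `(u, v, w) ↦ D(w, u, v)`. -/
def rotate (D : F →L[ℝ] F →L[ℝ] F →L[ℝ] ℝ) : F →L[ℝ] F →L[ℝ] F →L[ℝ] ℝ :=
  (ContinuousLinearMap.flipₗᵢ ℝ F F ℝ).toContinuousLinearEquiv.toContinuousLinearMap ∘L D.flip

/-- The Christoffel symbols as a bilinear map. -/
def flatGam (h : F → F →L[ℝ] F →L[ℝ] ℝ) (y : F) : F →L[ℝ] F →L[ℝ] F :=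
  (ContinuousLinearMap.compL ℝ F (F →L[ℝ] ℝ) F (h y).inverse) ∘L
    ((1 / 2 : ℝ) • (fderiv ℝ h y + (fderiv ℝ h y).flip - rotate (fderiv ℝ h y)))

lemma flatGam_apply (h : F → F →L[ℝ] F →L[ℝ] ℝ) (y v w : F) :
    flatGam h y v w = (h y).inverse ((1 / 2 : ℝ) • (fderiv ℝ h y v w + fderiv ℝ h y w v
      - ((fderiv ℝ h y).flip v).flip w)) := rfl

/-- The curvature endomorphism `u ↦ R(u, v) w`. -/
def flatRiem (h : F → F →L[ℝ] F →L[ℝ] ℝ) (y v w : F) : F →L[ℝ] F :=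
  ((fderiv ℝ (flatGam h) y).flip v).flip w - (fderiv ℝ (flatGam h) y v).flip w
    + (flatGam h y).flip (flatGam h y v w) - flatGam h y v ∘L (flatGam h y).flip w

lemma flatRiem_apply (h : F → F →L[ℝ] F →L[ℝ] ℝ) (y u v w : F) :
    flatRiem h y v w u = fderiv ℝ (flatGam h) y u v w - fderiv ℝ (flatGam h) y v u w
      + flatGam h y u (flatGam h y v w) - flatGam h y v (flatGam h y u w) := rfl

lemma flatRiem_add_left (h : F → F →L[ℝ] F →L[ℝ] ℝ) (y v v' w : F) :
    flatRiem h y (v + v') w = flatRiem h y v w + flatRiem h y v' w := by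
  ext u; simp only [flatRiem_apply, map_add, add_apply]; abel

lemma flatRiem_smul_left (h : F → F →L[ℝ] F →L[ℝ] ℝ) (y : F) (c : ℝ) (v w : F) :
    flatRiem h y (c • v) w = c • flatRiem h y v w := by
  ext u; simp only [flatRiem_apply, map_smul, smul_apply]; module

lemma flatRiem_add_right (h : F → F →L[ℝ] F →L[ℝ] ℝ) (y v w w' : F) :
    flatRiem h y v (w + w') = flatRiem h y v w + flatRiem h y v w' := by
  ext u; simp only [flatRiem_apply, map_add, add_apply]; abel

lemma flatRiem_smul_right (h : F → F →L[ℝ] F →L[ℝ] ℝ) (y : F) (c : ℝ) (v w : F) :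
    flatRiem h y v (c • w) = c • flatRiem h y v w := by
  ext u; simp only [flatRiem_apply, map_smul, smul_apply]; module

/-- The trace of an endomorphism. -/
def tr : (F →L[ℝ] F) →ₗ[ℝ] ℝ := LinearMap.trace ℝ F ∘ₗ ContinuousLinearMap.coeLM ℝ

/-- The Ricci form as a bilinear map. -/
def flatRic (h : F → F →L[ℝ] F →L[ℝ] ℝ) (y : F) : F →ₗ[ℝ] F →ₗ[ℝ] ℝ :=
  LinearMap.mk₂ ℝ (fun v w => tr (flatRiem h y v w))
    (fun v v' w => by rw [flatRiem_add_left, map_add])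
    (fun c v w => by rw [flatRiem_smul_left, map_smul])
    (fun v w w' => by rw [flatRiem_add_right, map_add])
    (fun c v w => by rw [flatRiem_smul_right, map_smul])

lemma flatRic_apply (h : F → F →L[ℝ] F →L[ℝ] ℝ) (y v w : F) :
    flatRic h y v w = tr (flatRiem h y v w) := rfl

variable [FiniteDimensional ℝ F]

lemma tr_smulRight (f : F →L[ℝ] ℝ) (a : F) : tr (f.smulRight a) = f a :=
  LinearMap.trace_smulRight (f : F →ₗ[ℝ] ℝ) a

lemma tr_id : tr (ContinuousLinearMap.id ℝ F) = Module.finrank ℝ F := LinearMap.trace_id ℝ F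

omit [FiniteDimensional ℝ F] in
lemma tr_eq_of_conj {F' : Type*} [NormedAddCommGroup F'] [NormedSpace ℝ F'] (A : F ≃L[ℝ] F')
    (L : F →L[ℝ] F) (L' : F' →L[ℝ] F') (hA : ∀ v, A (L v) = L' (A v)) : tr L = tr L' := by
  have : (L' : F' →ₗ[ℝ] F') = A.toLinearEquiv.conj (L : F →ₗ[ℝ] F) := by
    ext v
    simp [LinearEquiv.conj_apply, hA]
  change LinearMap.trace ℝ F _ = LinearMap.trace ℝ F' (L' : F' →ₗ[ℝ] F')
  rw [this, LinearMap.trace_conj']; rfl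

/-- Raising an index of a bilinear form, as an endomorphism. -/
def raise (h : F →L[ℝ] F →L[ℝ] ℝ) (B : F →ₗ[ℝ] F →ₗ[ℝ] ℝ) : F →L[ℝ] F :=
  h.inverse ∘L LinearMap.toContinuousLinearMap
    ((LinearMap.toContinuousLinearMap : (F →ₗ[ℝ] ℝ) ≃ₗ[ℝ] _).toLinearMap ∘ₗ B)

lemma raise_apply (h : F →L[ℝ] F →L[ℝ] ℝ) (B : F →ₗ[ℝ] F →ₗ[ℝ] ℝ) (v : F) :
    raise h B v = h.inverse (LinearMap.toContinuousLinearMap (B v)) := rfl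

lemma raise_spec {h : F →L[ℝ] F →L[ℝ] ℝ} (hh : h.IsInvertible) (B : F →ₗ[ℝ] F →ₗ[ℝ] ℝ)
    (v w : F) : h (raise h B v) w = B v w := by
  rw [raise_apply, hh.self_apply_inverse]; rfl

omit [FiniteDimensional ℝ F] in
lemma form_ext {h : F →L[ℝ] F →L[ℝ] ℝ} (hh : h.IsInvertible) {v w : F}
    (H : ∀ z, h v z = h w z) : v = w :=
  hh.injective (ContinuousLinearMap.ext H)

/-- The scalar curvature. -/
def flatScal (h : F → F →L[ℝ] F →L[ℝ] ℝ) (y : F) : ℝ := tr (raise (h y) (flatRic h y))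

/-- The Schouten form. -/
def flatSchouten (h : F → F →L[ℝ] F →L[ℝ] ℝ) (y : F) : F →ₗ[ℝ] F →ₗ[ℝ] ℝ :=
  ((Module.finrank ℝ F : ℝ) - 2)⁻¹ • (flatRic h y
    - (flatScal h y / (2 * ((Module.finrank ℝ F : ℝ) - 1))) •
      ((ContinuousLinearMap.coeLM ℝ : (F →L[ℝ] ℝ) →ₗ[ℝ] _) ∘ₗ (h y : F →ₗ[ℝ] F →L[ℝ] ℝ)))

lemma flatSchouten_apply (h : F → F →L[ℝ] F →L[ℝ] ℝ) (y v w : F) :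
    flatSchouten h y v w = ((Module.finrank ℝ F : ℝ) - 2)⁻¹ * (flatRic h y v w
    - (flatScal h y / (2 * ((Module.finrank ℝ F : ℝ) - 1))) * h y v w) := rfl

/-! ### Metric compatibility and smoothness -/

namespace FlatMetric

variable {h : F → F →L[ℝ] F →L[ℝ] ℝ} {W : Set F} (H : FlatMetric h W) {y : F} (hy : y ∈ W)

include H hy

omit [FiniteDimensional ℝ F] in
-- Symmetry of `h` holds on the whole open set, so it can be differentiated.
lemma dform_symm (u v w : F) : fderiv ℝ h y u v w = fderiv ℝ h y u w v := by
  have h1 := (H.smooth y hy).differentiableAt (by simp)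
  have e1 : HasFDerivAt (fun z => h z v w) (((fderiv ℝ h y).flip v).flip w) y := by
    have := ((h1.hasFDerivAt.clm_apply (hasFDerivAt_const v y)).clm_apply (hasFDerivAt_const w y))
    refine this.congr_fderiv ?_
    ext u; simp
  have e2 : HasFDerivAt (fun z => h z w v) (((fderiv ℝ h y).flip w).flip v) y := by
    have := ((h1.hasFDerivAt.clm_apply (hasFDerivAt_const w y)).clm_apply (hasFDerivAt_const v y))
    refine this.congr_fderiv ?_
    ext u; simp
  have e3 : (fun z => h z v w) =ᶠ[nhds y] fun z => h z w v := by
    filter_upwards [H.isOpen.mem_nhds hy] with z hz using H.symm z hz v w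
  have := e1.unique (e2.congr_of_eventuallyEq e3)
  simpa using congrArg (fun L => L u) this

omit [FiniteDimensional ℝ F] in
lemma gam_spec (v w z : F) : h y (flatGam h y v w) z =
    (1 / 2 : ℝ) * (fderiv ℝ h y v w z + fderiv ℝ h y w v z - fderiv ℝ h y z v w) := by
  rw [flatGam_apply, (H.inv y hy).self_apply_inverse]; simp

omit [FiniteDimensional ℝ F] in
lemma gam_symm (v w : F) : flatGam h y v w = flatGam h y w v := by
  refine form_ext (H.inv y hy) fun z => ?_
  rw [H.gam_spec hy, H.gam_spec hy, H.dform_symm hy z v w]; ring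

omit [FiniteDimensional ℝ F] in
lemma compat (u v w : F) :
    fderiv ℝ h y u v w = h y (flatGam h y u v) w + h y v (flatGam h y u w) := by
  rw [H.symm y hy v, H.gam_spec hy, H.gam_spec hy, H.dform_symm hy u w v]
  ring

omit [FiniteDimensional ℝ F] in
/-- The Levi-Civita connection is the unique symmetric connection compatible with the metric. -/
lemma gam_unique (C : F → F → F) (hs : ∀ v w, C v w = C w v)
    (hc : ∀ u v w, fderiv ℝ h y u v w = h y (C u v) w + h y v (C u w)) (v w : F) :
    flatGam h y v w = C v w := by
  refine form_ext (H.inv y hy) fun z => ?_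
  rw [H.gam_spec hy, hc, hc, hc, hs w v, hs z v, hs z w, H.symm y hy w (C v z),
    H.symm y hy v (C w z)]
  ring

lemma inverse_smooth : ContDiffAt ℝ ∞ (fun z => (h z).inverse) y :=
  haveI := FiniteDimensional.complete ℝ F
  ContDiffAt.comp y (H.inv y hy).contDiffAt_map_inverse (H.smooth y hy)

lemma gam_smooth : ContDiffAt ℝ ∞ (flatGam h) y := by
  have h1 : ContDiffAt ℝ ∞ (fderiv ℝ h) y := (H.smooth y hy).fderiv_right (by simp)
  have h2 := H.inverse_smooth hy
  have hf : ContDiffAt ℝ ∞ (fun z => (fderiv ℝ h z).flip) y :=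
    ((ContinuousLinearMap.flipₗᵢ ℝ F F (F →L[ℝ] ℝ)).toContinuousLinearEquiv.contDiff.contDiffAt).comp
      y h1
  have hr : ContDiffAt ℝ ∞ (fun z => rotate (fderiv ℝ h z)) y := contDiffAt_const.clm_comp hf
  exact (((ContinuousLinearMap.compL ℝ F (F →L[ℝ] ℝ) F).contDiff.contDiffAt).comp y h2).clm_comp
    (((h1.add hf).sub hr).const_smul (1 / 2 : ℝ))

lemma dgam_smooth : ContDiffAt ℝ ∞ (fderiv ℝ (flatGam h)) y :=
  (H.gam_smooth hy).fderiv_right (by simp)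

end FlatMetric

end Flat
end ConfCurve
end

/-! ### Smooth dependence of the curvature on the point, and first-order conformal change -/

noncomputable section

namespace ConfCurve

section FlatSmooth

set_option maxSynthPendingDepth 3
set_option linter.unusedSectionVars false

variable {F : Type*} [NormedAddCommGroup F] [NormedSpace ℝ F] [FiniteDimensional ℝ F]

/-- A basis of `F` identifies operators on `F` with finite tuples in `G`. The bilinear forms built
from curvature are purely algebraic, so their smoothness is tested on vectors. -/
lemma contDiffAt_of_forall_apply {X G : Type*} [NormedAddCommGroup X] [NormedSpace ℝ X]
    [NormedAddCommGroup G] [NormedSpace ℝ G] {f : X → F →L[ℝ] G} {x : X}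
    (hf : ∀ v, ContDiffAt ℝ ∞ (fun z => f z v) x) : ContDiffAt ℝ ∞ f x := by
  rw [← contDiffWithinAt_univ]
  have := fun v => (contDiffWithinAt_univ (x := x) (f := fun z => f z v) (n := ∞) (𝕜 := ℝ)).2 (hf v)
  let d := Module.finrank ℝ F
  have hd : d = Module.finrank ℝ (Fin d → ℝ) := (Module.finrank_fin_fun ℝ).symm
  let e₁ := ContinuousLinearEquiv.ofFinrankEq hd
  let e₂ := (e₁.arrowCongr (1 : G ≃L[ℝ] G)).trans (ContinuousLinearEquiv.piRing (Fin d))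
  rw [← e₂.comp_contDiffWithinAt_iff, contDiffWithinAt_pi]
  intro i
  exact this _

namespace FlatMetric

variable {h : F → F →L[ℝ] F →L[ℝ] ℝ} {W : Set F} (H : FlatMetric h W) {y : F} (hy : y ∈ W)

include H hy

lemma riem_smooth (v w : F) : ContDiffAt ℝ ∞ (fun z => flatRiem h z v w) y := by
  refine contDiffAt_of_forall_apply fun u => ?_
  have h1 := H.gam_smooth hy
  have h2 := H.dgam_smooth hy
  simp only [flatRiem_apply]
  have hc : ∀ a : F, ContDiffAt ℝ ∞ (fun _ : F => a) y := fun a => contDiffAt_const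
  exact (((((h2.clm_apply (hc u)).clm_apply (hc v)).clm_apply (hc w)).sub
    (((h2.clm_apply (hc v)).clm_apply (hc u)).clm_apply (hc w))).add
    ((h1.clm_apply (hc u)).clm_apply ((h1.clm_apply (hc v)).clm_apply (hc w)))).sub
    ((h1.clm_apply (hc v)).clm_apply ((h1.clm_apply (hc u)).clm_apply (hc w)))

omit H hy in
lemma tr_smooth {L : F → F →L[ℝ] F} (hL : ContDiffAt ℝ ∞ L y) :
    ContDiffAt ℝ ∞ (fun z => tr (L z)) y :=
  (LinearMap.toContinuousLinearMap (tr (F := F))).contDiff.contDiffAt.comp y hL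

lemma ric_smooth (v w : F) : ContDiffAt ℝ ∞ (fun z => flatRic h z v w) y :=
  tr_smooth (H.riem_smooth hy v w)

lemma raise_smooth {B : F → F →ₗ[ℝ] F →ₗ[ℝ] ℝ}
    (hB : ∀ v w, ContDiffAt ℝ ∞ (fun z => B z v w) y) :
    ContDiffAt ℝ ∞ (fun z => raise (h z) (B z)) y := by
  refine contDiffAt_of_forall_apply fun v => ?_
  simp only [raise_apply]
  exact (H.inverse_smooth hy).clm_apply (contDiffAt_of_forall_apply fun w => hB v w)

lemma scal_smooth : ContDiffAt ℝ ∞ (flatScal h) y :=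
  tr_smooth (H.raise_smooth hy (H.ric_smooth hy))

lemma form_smooth (v w : F) : ContDiffAt ℝ ∞ (fun z => h z v w) y :=
  ((H.smooth y hy).clm_apply contDiffAt_const).clm_apply contDiffAt_const

lemma schouten_smooth (v w : F) : ContDiffAt ℝ ∞ (fun z => flatSchouten h z v w) y := by
  simp only [flatSchouten_apply]
  exact contDiffAt_const.mul ((H.ric_smooth hy v w).sub
    (((H.scal_smooth hy).div_const _).mul (H.form_smooth hy v w)))

end FlatMetric

end FlatSmooth

/-! ### Conformal change -/

section FlatConformal

set_option maxSynthPendingDepth 3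
set_option linter.unusedSectionVars false

variable {F : Type*} [NormedAddCommGroup F] [NormedSpace ℝ F] [FiniteDimensional ℝ F]

/-- The one-form `Υ = f⁻¹ df`. -/
def flatUps (f : F → ℝ) (y : F) : F →L[ℝ] ℝ := (f y)⁻¹ • fderiv ℝ f y

/-- The change of the Christoffel symbols under a conformal change with one-form `a`. -/
def confS (h : F →L[ℝ] F →L[ℝ] ℝ) (a : F →L[ℝ] ℝ) (v w : F) : F :=
  a v • w + a w • v - h v w • h.inverse a

variable {h h' : F → F →L[ℝ] F →L[ℝ] ℝ} {W : Set F} {f : F → ℝ}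

/-- The covariant derivative of `Υ`. -/
def hessUps (h : F → F →L[ℝ] F →L[ℝ] ℝ) (f : F → ℝ) (y : F) : F →ₗ[ℝ] F →ₗ[ℝ] ℝ :=
  LinearMap.mk₂ ℝ (fun u v => fderiv ℝ (flatUps f) y u v - flatUps f y (flatGam h y u v))
    (fun _ _ _ => by simp only [map_add, add_apply]; ring)
    (fun _ _ _ => by simp only [map_smul, smul_apply, smul_eq_mul]; ring)
    (fun _ _ _ => by simp only [map_add]; ring)
    (fun _ _ _ => by simp only [map_smul, smul_eq_mul]; ring)

lemma hessUps_apply (h : F → F →L[ℝ] F →L[ℝ] ℝ) (f : F → ℝ) (y u v : F) :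
    hessUps h f y u v = fderiv ℝ (flatUps f) y u v - flatUps f y (flatGam h y u v) := rfl

/-- `h' = f² h` on `W`. -/
structure FlatRescaling (h h' : F → F →L[ℝ] F →L[ℝ] ℝ) (f : F → ℝ) (W : Set F) : Prop where
  left : FlatMetric h W
  right : FlatMetric h' W
  smooth : ∀ y ∈ W, ContDiffAt ℝ ∞ f y
  pos : ∀ y ∈ W, 0 < f y
  eq : ∀ y ∈ W, ∀ v w, h' y v w = f y ^ 2 * h y v w

namespace FlatRescaling

variable (R : FlatRescaling h h' f W) {y : F} (hy : y ∈ W)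

include R hy

lemma ups_smooth : ContDiffAt ℝ ∞ (flatUps f) y :=
  ((R.smooth y hy).inv (R.pos y hy).ne').smul ((R.smooth y hy).fderiv_right (by simp))

lemma dform (u v w : F) : fderiv ℝ h' y u v w =
    2 * f y ^ 2 * flatUps f y u * h y v w + f y ^ 2 * fderiv ℝ h y u v w := by
  have hd := ((R.left.smooth y hy).differentiableAt (by simp)).hasFDerivAt
  have hd' := ((R.right.smooth y hy).differentiableAt (by simp)).hasFDerivAt
  have ho := ((R.smooth y hy).differentiableAt (by simp)).hasFDerivAt
  have e1 := (hd'.clm_apply (hasFDerivAt_const v y)).clm_apply (hasFDerivAt_const w y)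
  have e2 := (ho.pow 2).mul ((hd.clm_apply (hasFDerivAt_const v y)).clm_apply (hasFDerivAt_const w y))
  have e3 : (fun z => h' z v w) =ᶠ[nhds y] fun z => f z ^ 2 * h z v w := by
    filter_upwards [R.left.isOpen.mem_nhds hy] with z hz using R.eq z hz v w
  have := congrArg (fun L => L u) (e1.unique (e2.congr_of_eventuallyEq e3))
  have hp := (R.pos y hy).ne'
  simp [flatUps] at this ⊢
  rw [this]
  field_simp
  ring

/-- The right-hand side is symmetric in `v`, `w` and preserves f²h, so uniqueness of the Levi-Civita
connection applies. -/
lemma gam_eq (v w : F) :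
    flatGam h' y v w = flatGam h y v w + confS (h y) (flatUps f y) v w := by
  refine R.right.gam_unique hy (fun v w => flatGam h y v w + confS (h y) (flatUps f y) v w)
    (fun v w => ?_) (fun u v w => ?_) v w
  · rw [R.left.gam_symm hy v w, confS, confS, R.left.symm y hy v w]; abel
  · have hs := R.left.symm y hy
    have hi := (R.left.inv y hy).self_apply_inverse (flatUps f y)
    rw [R.dform hy, R.eq y hy, R.eq y hy, R.left.compat hy]
    simp only [confS, map_add, map_sub, map_smul, add_apply, sub_apply, smul_apply, smul_eq_mul]
    rw [hs v ((h y).inverse _), hi, hs v u]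
    ring

/-- Υ = d log f is closed, and the Christoffel symbols are symmetric. -/
lemma hess_symm (u v : F) : hessUps h f y u v = hessUps h f y v u := by
  have ho := (R.smooth y hy)
  have hsym := ho.isSymmSndFDerivAt (by simpa using ENat.LEInfty.out) u v
  have hd : HasFDerivAt (flatUps f) _ y :=
    (((ho.inv (R.pos y hy).ne').differentiableAt (by simp)).hasFDerivAt).smul
    (((ho.fderiv_right (m := ∞) (by simp)).differentiableAt (by simp)).hasFDerivAt)
  have hi : fderiv ℝ (fun z => (f z)⁻¹) y = -(f y ^ 2)⁻¹ • fderiv ℝ f y := by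
    have := ((hasDerivAt_inv (R.pos y hy).ne').comp_hasFDerivAt y
      (ho.differentiableAt (by simp)).hasFDerivAt).fderiv
    exact this
  rw [hessUps_apply, hessUps_apply, hd.fderiv, R.left.gam_symm hy u v, 
    show fderiv ℝ (f⁻¹) y = _ from hi]
  simp [hsym]
  ring

/-- The derivative of `Υ♯`. -/
lemma hasFDerivAt_sharp : HasFDerivAt (fun z => (h z).inverse (flatUps f z))
    (raise (h y) (hessUps h f y) - (flatGam h y).flip ((h y).inverse (flatUps f y))) y := by
  have h1 := (((R.left.inverse_smooth hy).clm_apply (R.ups_smooth hy)).differentiableAt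
    (by simp)).hasFDerivAt
  convert h1 using 1
  set D := fderiv ℝ (fun z => (h z).inverse (flatUps f z)) y
  ext1 u
  refine form_ext (R.left.inv y hy) fun z => ?_
  have hd := ((R.left.smooth y hy).differentiableAt (by simp)).hasFDerivAt
  have e1 := (hd.clm_apply h1).clm_apply (hasFDerivAt_const z y)
  have e2 := ((R.ups_smooth hy).differentiableAt (by simp)).hasFDerivAt.clm_apply
    (hasFDerivAt_const z y)
  have e3 : (fun x => h x ((h x).inverse (flatUps f x)) z) =ᶠ[nhds y]
      fun x => flatUps f x z := by
    filter_upwards [R.left.isOpen.mem_nhds hy] with x hx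
    rw [(R.left.inv x hx).self_apply_inverse]
  have := congrArg (fun L => L u) (e2.unique (e1.congr_of_eventuallyEq e3.symm))
  simp [R.left.compat hy] at this
  simp only [sub_apply, map_sub, raise_spec (R.left.inv y hy), hessUps_apply, this,
    ContinuousLinearMap.flip_apply]
  rw [R.left.symm y hy _ (flatGam h y u z), ← R.left.symm y hy _ (flatGam h y u z),
    (R.left.inv y hy).self_apply_inverse]
  ring

end FlatRescaling

end FlatConformal
end ConfCurve
end

/-! ### Conformal change of the curvature -/

noncomputable section

namespace ConfCurve

section FlatConformalCurvature

set_option maxSynthPendingDepth 3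
set_option linter.unusedSectionVars false

variable {F : Type*} [NormedAddCommGroup F] [NormedSpace ℝ F] [FiniteDimensional ℝ F]
variable {h h' : F → F →L[ℝ] F →L[ℝ] ℝ} {W : Set F} {f : F → ℝ}

lemma hasFDerivAt_apply₂ {G : Type*} [NormedAddCommGroup G] [NormedSpace ℝ G]
    {B : F → F →L[ℝ] F →L[ℝ] G} {B' : F →L[ℝ] F →L[ℝ] F →L[ℝ] G} {y : F}
    (hB : HasFDerivAt B B' y) (v w : F) :
    HasFDerivAt (fun z => B z v w) ((B'.flip v).flip w) y := by
  refine ((hB.clm_apply (hasFDerivAt_const v y)).clm_apply (hasFDerivAt_const w y)).congr_fderiv ?_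
  ext u; simp

namespace FlatRescaling

variable (R : FlatRescaling h h' f W) {y : F} (hy : y ∈ W)

include R hy

/-- The derivative of the Christoffel symbols under a conformal change. -/
lemma dgam_eq (u v w : F) :
    fderiv ℝ (flatGam h') y u v w = fderiv ℝ (flatGam h) y u v w
      + fderiv ℝ (flatUps f) y u v • w + fderiv ℝ (flatUps f) y u w • v
      - fderiv ℝ h y u v w • (h y).inverse (flatUps f y)
      - h y v w • (raise (h y) (hessUps h f y) u
        - flatGam h y u ((h y).inverse (flatUps f y))) := by
  have hg := hasFDerivAt_apply₂
    ((R.left.gam_smooth hy).differentiableAt (by simp)).hasFDerivAt v w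
  have hg' := hasFDerivAt_apply₂
    ((R.right.gam_smooth hy).differentiableAt (by simp)).hasFDerivAt v w
  have hh := hasFDerivAt_apply₂
    ((R.left.smooth y hy).differentiableAt (by simp)).hasFDerivAt v w
  have hu := ((R.ups_smooth hy).differentiableAt (by simp)).hasFDerivAt
  have huv := hu.clm_apply (hasFDerivAt_const v y)
  have huw := hu.clm_apply (hasFDerivAt_const w y)
  have hs := R.hasFDerivAt_sharp hy
  have e1 := hg.add (((huv.smul_const w).add (huw.smul_const v)).sub (hh.smul hs))
  have e2 : (fun z => flatGam h' z v w) =ᶠ[nhds y]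
      fun z => flatGam h z v w + confS (h z) (flatUps f z) v w := by
    filter_upwards [R.left.isOpen.mem_nhds hy] with z hz using R.gam_eq hz v w
  have := congrArg (fun L => L u) (hg'.unique (e1.congr_of_eventuallyEq e2))
  simp at this
  rw [this]
  module

/-- The change of the curvature under a conformal change. -/
lemma riem_eq (v w : F) :
    flatRiem h' y v w = flatRiem h y v w
      + ((LinearMap.toContinuousLinearMap ((hessUps h f y).flip w)).smulRight v
        - h y v w • raise (h y) (hessUps h f y) - hessUps h f y v w • ContinuousLinearMap.id ℝ F
        + ((h y).flip w).smulRight (raise (h y) (hessUps h f y) v))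
      + ((flatUps f y v * flatUps f y w
          - flatUps f y ((h y).inverse (flatUps f y)) * h y v w) • ContinuousLinearMap.id ℝ F
        - flatUps f y w • (flatUps f y).smulRight v
        + flatUps f y ((h y).inverse (flatUps f y)) • ((h y).flip w).smulRight v
        + h y v w • (flatUps f y).smulRight ((h y).inverse (flatUps f y))
        - flatUps f y v • ((h y).flip w).smulRight ((h y).inverse (flatUps f y))) := by
  ext1 u
  have hs := R.left.symm y hy
  have hi : ∀ z, h y z ((h y).inverse (flatUps f y)) = flatUps f y z := fun z => by
    rw [hs, (R.left.inv y hy).self_apply_inverse]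
  -- Antisymmetrizing in `u`, `v` leaves the multiples (∇Υ)(u, v) w and (∇Υ)(v, u) w, which cancel
  -- by this symmetry. Writing ∂Υ through ∇Υ below lets the loose Christoffel terms cancel.
  have hH := R.hess_symm hy v u
  have hH' : ∀ a b, fderiv ℝ (flatUps f) y a b =
    hessUps h f y a b + flatUps f y (flatGam h y a b) := fun a b => by rw [hessUps_apply]; ring
  rw [flatRiem_apply, R.dgam_eq hy, R.dgam_eq hy, R.gam_eq hy, R.gam_eq hy, R.gam_eq hy,
    R.gam_eq hy, R.left.compat hy, R.left.compat hy, hH', hH', hH', hH', hH]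
  simp only [flatRiem_apply, add_apply, sub_apply, smul_apply,
    ContinuousLinearMap.smulRight_apply, ContinuousLinearMap.flip_apply, confS,
    LinearMap.coe_toContinuousLinearMap', LinearMap.flip_apply, ContinuousLinearMap.coe_id', id_eq,
    map_add, map_sub, map_smul, smul_eq_mul, hi, R.left.gam_symm hy u ((h y).inverse _),
    R.left.gam_symm hy v ((h y).inverse _), hs v u,
    R.left.gam_symm hy v u]
  rw [hs (flatGam h y u v) w, hs w (flatGam h y u v)]
  module

/-- Trace of the curvature formula in `u`: a rank-one map f ⊗ a contributes f(a), and the identity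
contributes the dimension, which is the source of the factors n - 2. -/
lemma ric_eq (v w : F) :
    flatRic h' y v w = flatRic h y v w
      - ((Module.finrank ℝ F : ℝ) - 2) * (hessUps h f y v w - flatUps f y v * flatUps f y w)
      - (tr (raise (h y) (hessUps h f y)) + ((Module.finrank ℝ F : ℝ) - 2)
          * flatUps f y ((h y).inverse (flatUps f y))) * h y v w := by
  have hi : h y ((h y).inverse (flatUps f y)) w = flatUps f y w := by
    rw [(R.left.inv y hy).self_apply_inverse]
  simp only [flatRic_apply, R.riem_eq hy, map_add, map_sub, map_smul, tr_smulRight, tr_id,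
    smul_eq_mul, ContinuousLinearMap.flip_apply, LinearMap.coe_toContinuousLinearMap',
    LinearMap.flip_apply, raise_spec (R.left.inv y hy), hi]
  ring

/-- A second trace, now with the inverse of f²h; this accounts for the overall factor f⁻². -/
lemma scal_eq : flatScal h' y = (f y ^ 2)⁻¹ * (flatScal h y
    - 2 * ((Module.finrank ℝ F : ℝ) - 1) * tr (raise (h y) (hessUps h f y))
    - ((Module.finrank ℝ F : ℝ) - 1) * ((Module.finrank ℝ F : ℝ) - 2)
          * flatUps f y ((h y).inverse (flatUps f y))) := by
  have hs := R.left.symm y hy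
  have e : raise (h' y) (flatRic h' y) = (f y ^ 2)⁻¹ • (raise (h y) (flatRic h y)
      - ((Module.finrank ℝ F : ℝ) - 2) • (raise (h y) (hessUps h f y)
        - (flatUps f y).smulRight ((h y).inverse (flatUps f y)))
      - (tr (raise (h y) (hessUps h f y)) + ((Module.finrank ℝ F : ℝ) - 2)
          * flatUps f y ((h y).inverse (flatUps f y))) • ContinuousLinearMap.id ℝ F) := by
    ext1 v
    refine form_ext (R.right.inv y hy) fun w => ?_
    have hp := (R.pos y hy).ne'
    rw [raise_spec (R.right.inv y hy), R.eq y hy, R.ric_eq hy]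
    simp only [smul_apply, sub_apply, map_sub, map_smul, raise_spec (R.left.inv y hy),
      ContinuousLinearMap.smulRight_apply, (R.left.inv y hy).self_apply_inverse, smul_eq_mul,
      ContinuousLinearMap.coe_id', id_eq]
    field_simp
  rw [flatScal, e]
  simp only [map_sub, map_smul, tr_smulRight, tr_id, smul_eq_mul, flatScal]
  ring

/-- The change of the Schouten tensor under a conformal change. -/
lemma schouten_eq (hF : 3 ≤ Module.finrank ℝ F) (v w : F) :
    flatSchouten h' y v w = flatSchouten h y v w - hessUps h f y v w + flatUps f y v * flatUps f y w
      - 1 / 2 * flatUps f y ((h y).inverse (flatUps f y)) * h y v w := by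
  -- The dimension bound serves to make both denominators n - 1 and n - 2 of the Schouten tensor
  -- nonzero.
  have h3 : (3 : ℝ) ≤ Module.finrank ℝ F := by exact_mod_cast hF
  have h1 : (Module.finrank ℝ F : ℝ) - 1 ≠ 0 := by linarith
  have h2 : (Module.finrank ℝ F : ℝ) - 2 ≠ 0 := by linarith
  have hp := (R.pos y hy).ne'
  rw [flatSchouten_apply, flatSchouten_apply, R.ric_eq hy, R.scal_eq hy, R.eq y hy]
  field_simp
  ring

end FlatRescaling

end FlatConformalCurvature
end ConfCurve
end

/-! ### Naturality of connection and curvature under local isometries -/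

noncomputable section

namespace ConfCurve

section FlatPullback

set_option maxSynthPendingDepth 3
set_option linter.unusedSectionVars false

variable {F : Type*} [NormedAddCommGroup F] [NormedSpace ℝ F] [FiniteDimensional ℝ F]
variable {h h' : F → F →L[ℝ] F →L[ℝ] ℝ} {W W' : Set F} {φ : F → F}

/-- `h = φ^* h'` for a local diffeomorphism `φ : W → W'`. -/
structure FlatPullback (h h' : F → F →L[ℝ] F →L[ℝ] ℝ) (φ : F → F) (W W' : Set F) : Prop where
  left : FlatMetric h W
  right : FlatMetric h' W'
  mapsTo : ∀ y ∈ W, φ y ∈ W'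
  smooth : ∀ y ∈ W, ContDiffAt ℝ ∞ φ y
  inv : ∀ y ∈ W, (fderiv ℝ φ y).IsInvertible
  eq : ∀ y ∈ W, ∀ v w, h y v w = h' (φ y) (fderiv ℝ φ y v) (fderiv ℝ φ y w)

namespace FlatPullback

variable (R : FlatPullback h h' φ W W') {y : F} (hy : y ∈ W)

include R hy

lemma hasFDerivAt : HasFDerivAt φ (fderiv ℝ φ y) y :=
  ((R.smooth y hy).differentiableAt (by simp)).hasFDerivAt

lemma hasFDerivAt_fderiv : HasFDerivAt (fderiv ℝ φ) (fderiv ℝ (fderiv ℝ φ) y) y :=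
  (((R.smooth y hy).fderiv_right (m := ∞) (by simp)).differentiableAt (by simp)).hasFDerivAt

lemma hasFDerivAt_fderiv_fderiv : HasFDerivAt (fderiv ℝ (fderiv ℝ φ))
    (fderiv ℝ (fderiv ℝ (fderiv ℝ φ)) y) y :=
  ((((R.smooth y hy).fderiv_right (m := ∞) (by simp)).fderiv_right (m := ∞)
    (by simp)).differentiableAt (by simp)).hasFDerivAt

lemma second_symm (u v : F) : fderiv ℝ (fderiv ℝ φ) y u v = fderiv ℝ (fderiv ℝ φ) y v u :=
  (R.smooth y hy).isSymmSndFDerivAt (by simpa using ENat.LEInfty.out) u v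

lemma third_symm (u v w : F) : fderiv ℝ (fderiv ℝ (fderiv ℝ φ)) y u v w =
    fderiv ℝ (fderiv ℝ (fderiv ℝ φ)) y v u w := by
  have := ((R.smooth y hy).fderiv_right (m := ∞) (by simp)).isSymmSndFDerivAt
    (by simpa using ENat.LEInfty.out) u v
  exact congrArg (fun L => L w) this

/-- The pulled-back connection is symmetric because second derivatives of φ commute, and it
preserves `h` because the original preserves `h'`. Uniqueness identifies it with the Levi-Civita
connection of `h`. -/
lemma gam_eq (v w : F) : fderiv ℝ φ y (flatGam h y v w) =
    flatGam h' (φ y) (fderiv ℝ φ y v) (fderiv ℝ φ y w) + fderiv ℝ (fderiv ℝ φ) y v w := by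
  have hA := (R.inv y hy).self_apply_inverse
  have hy' := R.mapsTo y hy
  have := R.left.gam_unique hy (fun v w => (fderiv ℝ φ y).inverse
    (flatGam h' (φ y) (fderiv ℝ φ y v) (fderiv ℝ φ y w) + fderiv ℝ (fderiv ℝ φ) y v w))
    (fun v w => ?_) (fun u v w => ?_) v w
  · rw [this, hA]
  · simp only [R.second_symm hy v w, R.right.gam_symm hy' (fderiv ℝ φ y v)]
  · have e1 := hasFDerivAt_apply₂ ((R.left.smooth y hy).differentiableAt (by simp)).hasFDerivAt v w
    have hh' := ((R.right.smooth _ hy').differentiableAt (by simp)).hasFDerivAt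
    have hd := R.hasFDerivAt_fderiv hy
    have e2 := ((hh'.comp y (R.hasFDerivAt hy)).clm_apply (hd.clm_apply (hasFDerivAt_const v y))).clm_apply
      (hd.clm_apply (hasFDerivAt_const w y))
    have e3 : (fun z => h z v w) =ᶠ[nhds y]
        fun z => h' (φ z) (fderiv ℝ φ z v) (fderiv ℝ φ z w) := by
      filter_upwards [R.left.isOpen.mem_nhds hy] with z hz using R.eq z hz v w
    have := congrArg (fun L => L u) (e1.unique (e2.congr_of_eventuallyEq e3))
    simp [R.right.compat hy'] at this
    rw [this, R.eq y hy, R.eq y hy, hA, hA]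
    simp only [map_add, add_apply]
    ring

/-- The derivative of `gam_eq`. The third derivative of φ that appears is symmetric in `u`, `v` and
so drops out of the curvature. -/
lemma dgam_eq (u v w : F) :
    fderiv ℝ (fderiv ℝ φ) y u (flatGam h y v w) + fderiv ℝ φ y (fderiv ℝ (flatGam h) y u v w) =
      fderiv ℝ (flatGam h') (φ y) (fderiv ℝ φ y u) (fderiv ℝ φ y v) (fderiv ℝ φ y w)
      + flatGam h' (φ y) (fderiv ℝ (fderiv ℝ φ) y u v) (fderiv ℝ φ y w)
      + flatGam h' (φ y) (fderiv ℝ φ y v) (fderiv ℝ (fderiv ℝ φ) y u w)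
      + fderiv ℝ (fderiv ℝ (fderiv ℝ φ)) y u v w := by
  have hy' := R.mapsTo y hy
  have hg := hasFDerivAt_apply₂
    ((R.left.gam_smooth hy).differentiableAt (by simp)).hasFDerivAt v w
  have hg' := ((R.right.gam_smooth hy').differentiableAt (by simp)).hasFDerivAt
  have hd := R.hasFDerivAt_fderiv hy
  have e1 := hd.clm_apply hg
  have e2 := (((hg'.comp y (R.hasFDerivAt hy)).clm_apply
      (hd.clm_apply (hasFDerivAt_const v y))).clm_apply
      (hd.clm_apply (hasFDerivAt_const w y))).add
      (hasFDerivAt_apply₂ (R.hasFDerivAt_fderiv_fderiv hy) v w)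
  have e3 : (fun z => fderiv ℝ φ z (flatGam h z v w)) =ᶠ[nhds y] fun z =>
      flatGam h' (φ z) (fderiv ℝ φ z v) (fderiv ℝ φ z w) + fderiv ℝ (fderiv ℝ φ) z v w := by
    filter_upwards [R.left.isOpen.mem_nhds hy] with z hz using R.gam_eq hz v w
  have := congrArg (fun L => L u) (e1.unique (e2.congr_of_eventuallyEq e3))
  simp at this
  rw [add_comm, this]
  abel

/-- The curvature is a tensor. -/
lemma riem_eq (u v w : F) : fderiv ℝ φ y (flatRiem h y v w u) =
    flatRiem h' (φ y) (fderiv ℝ φ y v) (fderiv ℝ φ y w) (fderiv ℝ φ y u) := by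
  have hy' := R.mapsTo y hy
  have a1 := eq_sub_of_add_eq' (R.dgam_eq hy u v w)
  have a2 := eq_sub_of_add_eq' (R.dgam_eq hy v u w)
  rw [flatRiem_apply, flatRiem_apply, map_sub, map_add, map_sub, a1, a2, R.gam_eq hy,
    R.gam_eq hy, R.gam_eq hy, R.gam_eq hy, R.third_symm hy v u, R.second_symm hy v u]
  simp only [map_add]
  abel

lemma ric_eq (v w : F) :
    flatRic h y v w = flatRic h' (φ y) (fderiv ℝ φ y v) (fderiv ℝ φ y w) := by
  obtain ⟨A, hA⟩ := R.inv y hy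
  rw [flatRic_apply, flatRic_apply]
  refine tr_eq_of_conj A _ _ fun u => ?_
  have := R.riem_eq hy u v w
  rw [← hA] at this ⊢
  exact this

lemma raise_eq {B B' : F →ₗ[ℝ] F →ₗ[ℝ] ℝ}
    (hB : ∀ v w, B v w = B' (fderiv ℝ φ y v) (fderiv ℝ φ y w)) (v : F) :
    fderiv ℝ φ y (raise (h y) B v) = raise (h' (φ y)) B' (fderiv ℝ φ y v) := by
  have hy' := R.mapsTo y hy
  refine form_ext (R.right.inv _ hy') fun z => ?_
  obtain ⟨w, rfl⟩ := (R.inv y hy).surjective z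
  rw [← R.eq y hy, raise_spec (R.left.inv y hy), raise_spec (R.right.inv _ hy'), hB]

lemma scal_eq : flatScal h y = flatScal h' (φ y) := by
  have H := R.raise_eq hy (R.ric_eq hy)
  obtain ⟨A, hA⟩ := R.inv y hy
  refine tr_eq_of_conj A _ _ fun u => ?_
  have := H u
  rw [← hA] at this
  exact this

lemma schouten_eq (v w : F) :
    flatSchouten h y v w = flatSchouten h' (φ y) (fderiv ℝ φ y v) (fderiv ℝ φ y w) := by
  rw [flatSchouten_apply, flatSchouten_apply, R.ric_eq hy, R.scal_eq hy, R.eq y hy]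

end FlatPullback

end FlatPullback
end ConfCurve
end

/-! ### From the manifold to its charts -/

noncomputable section

namespace ConfCurve

section Charts

set_option maxSynthPendingDepth 3
set_option linter.unusedSectionVars false

variable {n p q : ℕ} {M : Type*} [TopologicalSpace M] [ChartedSpace (E n) M]

/-- The transition map between the charts around `x₀` and `x₁`. -/
def trans (n : ℕ) {M : Type*} [TopologicalSpace M] [ChartedSpace (E n) M] (x₀ x₁ : M) :
    E n → E n :=
  extChartAt (𝓡 n) x₁ ∘ (extChartAt (𝓡 n) x₀).symm

/-- The domain of the transition map. -/
def transDom (n : ℕ) {M : Type*} [TopologicalSpace M] [ChartedSpace (E n) M] (x₀ x₁ : M) :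
    Set (E n) :=
  ((extChartAt (𝓡 n) x₀).symm.trans (extChartAt (𝓡 n) x₁)).source

lemma mem_transDom {x₀ x₁ : M} {y : E n} : y ∈ transDom n x₀ x₁ ↔
    y ∈ (extChartAt (𝓡 n) x₀).target ∧
      (extChartAt (𝓡 n) x₀).symm y ∈ (extChartAt (𝓡 n) x₁).source := Iff.rfl

lemma mem_transDom_of_mem {x₀ x₁ x : M} (h₀ : x ∈ (extChartAt (𝓡 n) x₀).source)
    (h₁ : x ∈ (extChartAt (𝓡 n) x₁).source) : extChartAt (𝓡 n) x₀ x ∈ transDom n x₀ x₁ := by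
  rw [mem_transDom]
  refine ⟨(extChartAt (𝓡 n) x₀).map_source h₀, ?_⟩
  rwa [(extChartAt (𝓡 n) x₀).left_inv h₀]

lemma isOpen_transDom (x₀ x₁ : M) : IsOpen (transDom n x₀ x₁) := by
  have : transDom n x₀ x₁ = (extChartAt (𝓡 n) x₀).target ∩
      (extChartAt (𝓡 n) x₀).symm ⁻¹' (extChartAt (𝓡 n) x₁).source := by
    ext y; exact mem_transDom
  rw [this]
  exact (continuousOn_extChartAt_symm x₀).isOpen_inter_preimage
    (isOpen_extChartAt_target x₀) (isOpen_extChartAt_source x₁)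

lemma trans_smooth [IsManifold (𝓡 n) ∞ M] (x₀ x₁ : M) {y : E n} (hy : y ∈ transDom n x₀ x₁) :
    ContDiffAt ℝ ∞ (trans n x₀ x₁) y :=
  (contDiffOn_ext_coord_change x₁ x₀).contDiffAt ((isOpen_transDom x₀ x₁).mem_nhds hy)

variable [IsManifold (𝓡 n) 1 M]

lemma tangentCoordChange_eq (x₀ x₁ x : M) :
    tangentCoordChange (𝓡 n) x₀ x₁ x = fderiv ℝ (trans n x₀ x₁) (extChartAt (𝓡 n) x₀ x) := by
  rw [tangentCoordChange_def]
  simp [trans, fderivWithin_univ]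

lemma tangentCoordChange_isInvertible {x₀ x₁ x : M} (h₀ : x ∈ (extChartAt (𝓡 n) x₀).source)
    (h₁ : x ∈ (extChartAt (𝓡 n) x₁).source) :
    (tangentCoordChange (𝓡 n) x₀ x₁ x).IsInvertible := by
  refine ContinuousLinearMap.IsInvertible.of_inverse (g := tangentCoordChange (𝓡 n) x₁ x₀ x)
    ?_ ?_ <;> ext1 v <;> simp only [ContinuousLinearMap.comp_apply, ContinuousLinearMap.id_apply]
  · rw [tangentCoordChange_comp ⟨⟨h₁, h₀⟩, h₁⟩, tangentCoordChange_self h₁]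
  · rw [tangentCoordChange_comp ⟨⟨h₀, h₁⟩, h₀⟩, tangentCoordChange_self h₀]

/-- The metric at a point as a form on the model space. -/
def PseudoMetric.form (g : PseudoMetric n p q M) (x : M) : E n →L[ℝ] E n →L[ℝ] ℝ := g.val x

lemma PseudoMetric.form_symm (g : PseudoMetric n p q M) (x : M) (v w : E n) :
    g.form x v w = g.form x w v := g.symm x v w

lemma isInvertible_of_nondegenerate {F : Type*} [NormedAddCommGroup F] [NormedSpace ℝ F]
    [FiniteDimensional ℝ F] (h : F →L[ℝ] F →L[ℝ] ℝ) (hh : ∀ v, h v = 0 → v = 0) :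
    h.IsInvertible := by
  have hi : Function.Injective (h : F →ₗ[ℝ] F →L[ℝ] ℝ) := by
    rw [← LinearMap.ker_eq_bot, LinearMap.ker_eq_bot']; exact hh
  have hd : Module.finrank ℝ F = Module.finrank ℝ (F →L[ℝ] ℝ) := by
    rw [← (LinearMap.toContinuousLinearMap : (F →ₗ[ℝ] ℝ) ≃ₗ[ℝ] _).finrank_eq]
    exact (Subspace.dual_finrank_eq).symm
  exact ⟨(LinearMap.linearEquivOfInjective _ hi hd).toContinuousLinearEquiv, by ext; rfl⟩

lemma PseudoMetric.form_isInvertible (g : PseudoMetric n p q M) (x : M) :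
    (g.form x).IsInvertible := by
  refine isInvertible_of_nondegenerate _ fun v hv => ?_
  obtain ⟨b, hb⟩ := g.signature x
  let v' : Tan n x := v
  change v' = 0
  have hv' : g.val x v' = 0 := hv
  rw [← b.sum_repr v'] at hv'
  refine b.ext_elem fun j => ?_
  have := congrArg (fun L => L (b j)) hv'
  simp only [map_sum, map_smul, sum_apply, smul_apply, hb, smul_eq_mul,
    mul_ite, mul_zero, Finset.sum_ite_eq', Finset.mem_univ, if_true, zero_apply] at this
  rcases mul_eq_zero.1 this with h | h
  · simpa using h
  -- The remaining factor is a diagonal entry ±1 of the metric in the orthonormal basis, hence not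
  -- zero.
  · rcases j with j | j <;> simp at h

lemma coordMetric_apply (g : PseudoMetric n p q M) {x₀ x : M}
    (hx : x ∈ (extChartAt (𝓡 n) x₀).source) (v w : E n) :
    coordMetric g x₀ (extChartAt (𝓡 n) x₀ x) v w =
      g.form x (tangentCoordChange (𝓡 n) x₀ x x v) (tangentCoordChange (𝓡 n) x₀ x x w) := by
  have : coordMetric g x₀ (extChartAt (𝓡 n) x₀ x) v w =
    g.form ((extChartAt (𝓡 n) x₀).symm (extChartAt (𝓡 n) x₀ x))
      (tangentCoordChange (𝓡 n) x₀ ((extChartAt (𝓡 n) x₀).symm (extChartAt (𝓡 n) x₀ x))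
        ((extChartAt (𝓡 n) x₀).symm (extChartAt (𝓡 n) x₀ x)) v)
      (tangentCoordChange (𝓡 n) x₀ ((extChartAt (𝓡 n) x₀).symm (extChartAt (𝓡 n) x₀ x))
        ((extChartAt (𝓡 n) x₀).symm (extChartAt (𝓡 n) x₀ x)) w) := rfl
  rw [this, (extChartAt (𝓡 n) x₀).left_inv hx]

lemma coordMetric_self (g : PseudoMetric n p q M) (x : M) :
    coordMetric g x (extChartAt (𝓡 n) x x) = g.form x := by
  ext v w
  rw [coordMetric_apply g (mem_extChartAt_source x), tangentCoordChange_self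
    (mem_extChartAt_source x), tangentCoordChange_self (mem_extChartAt_source x)]

lemma form_eq_coordMetric (g : PseudoMetric n p q M) {x₀ x : M}
    (hx : x ∈ (extChartAt (𝓡 n) x₀).source) (v w : E n) :
    g.form x v w = coordMetric g x₀ (extChartAt (𝓡 n) x₀ x)
      (tangentCoordChange (𝓡 n) x x₀ x v) (tangentCoordChange (𝓡 n) x x₀ x w) := by
  have hs := mem_extChartAt_source (I := 𝓡 n) x
  rw [coordMetric_apply g hx, tangentCoordChange_comp ⟨⟨hs, hx⟩, hs⟩,
    tangentCoordChange_comp ⟨⟨hs, hx⟩, hs⟩, tangentCoordChange_self hs, tangentCoordChange_self hs]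

lemma coordMetric_flat (g : PseudoMetric n p q M) (x₀ : M) :
    FlatMetric (coordMetric g x₀) (extChartAt (𝓡 n) x₀).target where
  isOpen := isOpen_extChartAt_target x₀
  smooth y hy := (g.smooth x₀).contDiffAt ((isOpen_extChartAt_target x₀).mem_nhds hy)
  symm y hy v w := g.form_symm _ _ _
  inv y hy := by
    obtain ⟨x, hx, rfl⟩ : ∃ x, x ∈ (extChartAt (𝓡 n) x₀).source ∧ extChartAt (𝓡 n) x₀ x = y :=
      ⟨_, (extChartAt (𝓡 n) x₀).map_target hy, (extChartAt (𝓡 n) x₀).right_inv hy⟩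
    refine isInvertible_of_nondegenerate _ fun v hv => ?_
    have hA := tangentCoordChange_isInvertible hx (mem_extChartAt_source (I := 𝓡 n) x)
    have : tangentCoordChange (𝓡 n) x₀ x x v = 0 := by
      refine form_ext (g.form_isInvertible x) fun z => ?_
      obtain ⟨w, rfl⟩ := hA.surjective z
      rw [← coordMetric_apply g hx, hv]; simp
    exact hA.injective (by rw [this, map_zero])

lemma tr_eq_sum (L : E n →L[ℝ] E n) : tr L = ∑ i, L (stdVec i) i := by
  change LinearMap.trace ℝ (E n) L = _
  rw [LinearMap.trace_eq_sum_inner _ (EuclideanSpace.basisFun (Fin n) ℝ)]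
  simp [stdVec, EuclideanSpace.inner_single_left]

/-- Connects the coordinate sum over differentiated components with the basis-free trace;
differentiability of the Christoffel symbols as a bilinear map lets evaluation on constant vectors
commute with the derivative. -/
lemma ricci_eq (g : PseudoMetric n p q M) (x₀ : M) {y : E n}
    (hy : y ∈ (extChartAt (𝓡 n) x₀).target) (v w : E n) :
    ricci g x₀ y v w = flatRic (coordMetric g x₀) y v w := by
  have hd := (((coordMetric_flat g x₀).gam_smooth hy).differentiableAt (by simp)).hasFDerivAt
  have h : ∀ a b, fderiv ℝ (fun z => christoffel g x₀ z a b) y =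
      ((fderiv ℝ (flatGam (coordMetric g x₀)) y).flip a).flip b := fun a b =>
    (hasFDerivAt_apply₂ hd a b).fderiv
  rw [flatRic_apply, tr_eq_sum]
  refine Finset.sum_congr rfl fun i _ => ?_
  rw [riem, h, h]; rfl

lemma raise_stdVec {h : E n →L[ℝ] E n →L[ℝ] ℝ} (hh : h.IsInvertible) (hs : ∀ v w, h v w = h w v)
    (B : E n →ₗ[ℝ] E n →ₗ[ℝ] ℝ) (v : E n) (i : Fin n) :
    raise h B v i = B v (h.inverse (stdCovec i)) := by
  rw [← raise_spec hh B v, hs, hh.self_apply_inverse]; rfl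

lemma sum_stdVec (v : E n) : ∑ j, v j • (stdVec j : E n) = v := by
  simpa [stdVec] using (EuclideanSpace.basisFun (Fin n) ℝ).sum_repr v

lemma scalarCurv_eq (g : PseudoMetric n p q M) (x₀ : M) {y : E n}
    (hy : y ∈ (extChartAt (𝓡 n) x₀).target) :
    scalarCurv g x₀ y = flatScal (coordMetric g x₀) y := by
  have H := coordMetric_flat g x₀
  rw [flatScal, tr_eq_sum]
  refine Finset.sum_congr rfl fun i _ => ?_
  rw [raise_stdVec (H.inv y hy) (H.symm y hy)]
  conv_rhs => rw [← sum_stdVec ((coordMetric g x₀ y).inverse (stdCovec i)), map_sum]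
  refine Finset.sum_congr rfl fun j _ => ?_
  rw [map_smul, ricci_eq g x₀ hy]; rfl

lemma finrank_E : Module.finrank ℝ (E n) = n := by simp

lemma schouten_eq_flat (g : PseudoMetric n p q M) (x : M) (v w : E n) :
    schouten g x v w = flatSchouten (coordMetric g x) (extChartAt (𝓡 n) x x) v w := by
  have hy := mem_extChartAt_target (I := 𝓡 n) x
  rw [flatSchouten_apply, finrank_E, coordMetric_self, ← ricci_eq g x hy, ← scalarCurv_eq g x hy]
  rfl

/-- The vector `P(v, ·)♯`, on the model space. -/
def schS (g : PseudoMetric n p q M) (x : M) (v : E n) : E n := schoutenSharp g x v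

lemma schS_eq (g : PseudoMetric n p q M) (x : M) (v : E n) :
    schS g x v = raise (coordMetric g x (extChartAt (𝓡 n) x x))
      (flatSchouten (coordMetric g x) (extChartAt (𝓡 n) x x)) v := by
  change (g.form x).inverse (∑ j, schouten g x v (stdVec j : E n) • stdCovec j) = _
  rw [coordMetric_self, raise_apply]
  congr 1
  ext1 w
  simp only [sum_apply, smul_apply, LinearMap.coe_toContinuousLinearMap']
  conv_rhs => rw [← sum_stdVec w, map_sum]
  refine Finset.sum_congr rfl fun j _ => ?_
  rw [map_smul, schouten_eq_flat, smul_eq_mul, smul_eq_mul, mul_comm]; rfl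

lemma form_schS (g : PseudoMetric n p q M) (x : M) (v w : E n) :
    g.form x (schS g x v) w = schouten g x v w := by
  rw [schS_eq, schouten_eq_flat, ← coordMetric_self, raise_spec]
  exact (coordMetric_flat g x).inv _ (mem_extChartAt_target x)

/-- Coordinate expressions of one metric in two charts are pullbacks of each other; through this
every naturality statement above applies to chart changes. -/
lemma trans_pullback [IsManifold (𝓡 n) ∞ M] (g : PseudoMetric n p q M) (x₀ x₁ : M) :
    FlatPullback (coordMetric g x₀) (coordMetric g x₁) (trans n x₀ x₁) (transDom n x₀ x₁)
      (extChartAt (𝓡 n) x₁).target := by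
  have H := coordMetric_flat g x₀
  have key : ∀ y ∈ transDom n x₀ x₁, ∃ x, x ∈ (extChartAt (𝓡 n) x₀).source ∧
      x ∈ (extChartAt (𝓡 n) x₁).source ∧ extChartAt (𝓡 n) x₀ x = y ∧
      trans n x₀ x₁ y = extChartAt (𝓡 n) x₁ x := fun y hy =>
    ⟨_, (extChartAt (𝓡 n) x₀).map_target (mem_transDom.1 hy).1, (mem_transDom.1 hy).2,
      (extChartAt (𝓡 n) x₀).right_inv (mem_transDom.1 hy).1, rfl⟩
  refine ⟨⟨isOpen_transDom x₀ x₁, fun y hy => H.smooth y hy.1, fun y hy => H.symm y hy.1,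
    fun y hy => H.inv y hy.1⟩, coordMetric_flat g x₁, fun y hy => ?_, fun y hy =>
    trans_smooth x₀ x₁ hy, fun y hy => ?_, fun y hy v w => ?_⟩
  · exact (extChartAt (𝓡 n) x₁).map_source hy.2
  · obtain ⟨x, h₀, h₁, rfl, -⟩ := key y hy
    rw [← tangentCoordChange_eq]
    exact tangentCoordChange_isInvertible h₀ h₁
  · obtain ⟨x, h₀, h₁, rfl, he⟩ := key y hy
    have hx := mem_extChartAt_source (I := 𝓡 n) x
    rw [he, ← tangentCoordChange_eq, coordMetric_apply g h₁, coordMetric_apply g h₀,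
      tangentCoordChange_comp ⟨⟨h₀, h₁⟩, hx⟩, tangentCoordChange_comp ⟨⟨h₀, h₁⟩, hx⟩]

end Charts

end ConfCurve
end

/-! ### Vector fields along a curve and their covariant derivative -/

noncomputable section

namespace ConfCurve

section Curves

set_option maxSynthPendingDepth 3
set_option linter.unusedSectionVars false

variable {n p q : ℕ} {M : Type*} [TopologicalSpace M] [ChartedSpace (E n) M]
  [IsManifold (𝓡 n) 1 M]

lemma contDiffAt_deriv {G : Type*} [NormedAddCommGroup G] [NormedSpace ℝ G] {c : ℝ → G} {t : ℝ}
    (hc : ContDiffAt ℝ ∞ c t) : ContDiffAt ℝ ∞ (deriv c) t := by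
  have : deriv c = fun s => fderiv ℝ c s 1 := by ext; simp
  rw [this]
  exact (hc.fderiv_right (by simp)).clm_apply contDiffAt_const

/-- A smooth curve on an open set of parameters. -/
structure SmoothCurve (n : ℕ) {M : Type*} [TopologicalSpace M] [ChartedSpace (E n) M]
    (γ : ℝ → M) (I : Set ℝ) : Prop where
  isOpen : IsOpen I
  smooth : ContMDiffOn 𝓘(ℝ, ℝ) (𝓡 n) ∞ γ I

/-- The components in the chart around `x₀` of a vector field along `γ`. -/
def comps (γ : ℝ → M) (x₀ : M) (V : ℝ → E n) (s : ℝ) : E n :=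
  tangentCoordChange (𝓡 n) (γ s) x₀ (γ s) (V s)

omit [IsManifold (𝓡 n) 1 M] in
/-- The coordinates of the curve in the chart around `x₀`. -/
def coordCurve (n : ℕ) {M : Type*} [TopologicalSpace M] [ChartedSpace (E n) M]
    (γ : ℝ → M) (x₀ : M) (s : ℝ) : E n := extChartAt (𝓡 n) x₀ (γ s)

/-- Smooth vector fields along `γ`. -/
def VSmooth (γ : ℝ → M) (I : Set ℝ) (V : ℝ → E n) : Prop :=
  ∀ t ∈ I, ContDiffAt ℝ ∞ (comps γ (γ t) V) t

/-- The velocity, as a function into the model space. -/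
def vel (n : ℕ) {M : Type*} [TopologicalSpace M] [ChartedSpace (E n) M]
    (γ : ℝ → M) (t : ℝ) : E n := velocity n γ t

/-- The covariant derivative along `γ`, on functions into the model space. -/
def cov (g : PseudoMetric n p q M) (γ : ℝ → M) (V : ℝ → E n) (t : ℝ) : E n := covDeriv g γ V t

lemma comps_self (γ : ℝ → M) (V : ℝ → E n) (t : ℝ) : comps γ (γ t) V t = V t :=
  tangentCoordChange_self (mem_extChartAt_source _)

lemma cov_eq (g : PseudoMetric n p q M) (γ : ℝ → M) (V : ℝ → E n) (t : ℝ) :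
    cov g γ V t = deriv (comps γ (γ t) V) t +
      flatGam (coordMetric g (γ t)) (coordCurve n γ (γ t) t) (vel n γ t) (V t) := rfl

lemma comps_change (γ : ℝ → M) {x₀ x₁ : M} (V : ℝ → E n) {s : ℝ}
    (h₀ : γ s ∈ (extChartAt (𝓡 n) x₀).source) (h₁ : γ s ∈ (extChartAt (𝓡 n) x₁).source) :
    comps γ x₁ V s = fderiv ℝ (trans n x₀ x₁) (coordCurve n γ x₀ s) (comps γ x₀ V s) := by
  rw [comps, comps, coordCurve, ← tangentCoordChange_eq,
    tangentCoordChange_comp ⟨⟨mem_extChartAt_source _, h₀⟩, h₁⟩]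

lemma coordCurve_change (γ : ℝ → M) {x₀ : M} (x₁ : M) {s : ℝ}
    (h₀ : γ s ∈ (extChartAt (𝓡 n) x₀).source) :
    coordCurve n γ x₁ s = trans n x₀ x₁ (coordCurve n γ x₀ s) := by
  simp only [coordCurve, trans, Function.comp]
  rw [(extChartAt (𝓡 n) x₀).left_inv h₀]

namespace SmoothCurve

variable {γ : ℝ → M} {I : Set ℝ} (hγ : SmoothCurve n γ I)

include hγ

lemma contMDiffAt {t : ℝ} (ht : t ∈ I) : ContMDiffAt 𝓘(ℝ, ℝ) (𝓡 n) ∞ γ t :=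
  hγ.smooth.contMDiffAt (hγ.isOpen.mem_nhds ht)

lemma eventually_mem {t : ℝ} (ht : t ∈ I) {x₀ : M} (hx : γ t ∈ (extChartAt (𝓡 n) x₀).source) :
    ∀ᶠ s in nhds t, s ∈ I ∧ γ s ∈ (extChartAt (𝓡 n) x₀).source :=
  (hγ.isOpen.eventually_mem ht).and ((hγ.contMDiffAt ht).continuousAt.eventually_mem
    ((isOpen_extChartAt_source x₀).mem_nhds hx))

variable [IsManifold (𝓡 n) ∞ M]

lemma coordCurve_smooth {t : ℝ} (ht : t ∈ I) {x₀ : M}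
    (hx : γ t ∈ (extChartAt (𝓡 n) x₀).source) : ContDiffAt ℝ ∞ (coordCurve n γ x₀) t := by
  rw [← contMDiffAt_iff_contDiffAt]
  exact (contMDiffAt_extChartAt' (by simpa using hx)).comp t (hγ.contMDiffAt ht)

lemma vel_eq_deriv {t : ℝ} (ht : t ∈ I) : vel n γ t = deriv (coordCurve n γ (γ t)) t := by
  have hd : MDifferentiableAt 𝓘(ℝ, ℝ) (𝓡 n) γ t := (hγ.contMDiffAt ht).mdifferentiableAt (by simp)
  refine (congrArg (fun L : ℝ →L[ℝ] E n => L 1) hd.mfderiv).trans ?_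
  rw [← fderiv_apply_one_eq_deriv]
  simp [writtenInExtChartAt, fderivWithin_univ, Function.comp_def]
  rfl

lemma deriv_coordCurve_change {t : ℝ} (ht : t ∈ I) {x₀ x₁ : M}
    (h₀ : γ t ∈ (extChartAt (𝓡 n) x₀).source) (h₁ : γ t ∈ (extChartAt (𝓡 n) x₁).source) :
    deriv (coordCurve n γ x₁) t =
      fderiv ℝ (trans n x₀ x₁) (coordCurve n γ x₀ t) (deriv (coordCurve n γ x₀) t) := by
  have h : coordCurve n γ x₁ =ᶠ[nhds t] trans n x₀ x₁ ∘ coordCurve n γ x₀ := by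
    filter_upwards [hγ.eventually_mem ht h₀] with s hs using coordCurve_change γ x₁ hs.2
  rw [h.deriv_eq]
  exact (fderiv_comp_deriv t ((trans_smooth x₀ x₁ (mem_transDom_of_mem h₀ h₁)).differentiableAt
    (by simp)) ((hγ.coordCurve_smooth ht h₀).differentiableAt (by simp)))

lemma comps_vel {t : ℝ} (ht : t ∈ I) {x₀ : M} (h₀ : γ t ∈ (extChartAt (𝓡 n) x₀).source) :
    comps γ x₀ (vel n γ) t = deriv (coordCurve n γ x₀) t := by
  rw [hγ.deriv_coordCurve_change ht (mem_extChartAt_source (γ t)) h₀, ← hγ.vel_eq_deriv ht,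
    comps_change γ _ (mem_extChartAt_source (γ t)) h₀, comps_self]

lemma comps_smooth_change {t : ℝ} (ht : t ∈ I) {x₀ x₁ : M} {V : ℝ → E n}
    (h₀ : γ t ∈ (extChartAt (𝓡 n) x₀).source) (h₁ : γ t ∈ (extChartAt (𝓡 n) x₁).source)
    (hV : ContDiffAt ℝ ∞ (comps γ x₀ V) t) : ContDiffAt ℝ ∞ (comps γ x₁ V) t := by
  have h : comps γ x₁ V =ᶠ[nhds t]
      fun s => fderiv ℝ (trans n x₀ x₁) (coordCurve n γ x₀ s) (comps γ x₀ V s) := by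
    filter_upwards [hγ.eventually_mem ht h₀, hγ.eventually_mem ht h₁] with s hs hs' using
      comps_change γ V hs.2 hs'.2
  refine ContDiffAt.congr_of_eventuallyEq ?_ h
  have hf : ContDiffAt ℝ ∞ (fderiv ℝ (trans n x₀ x₁)) (coordCurve n γ x₀ t) :=
    (trans_smooth x₀ x₁ (mem_transDom_of_mem h₀ h₁)).fderiv_right (by simp)
  exact (hf.comp t (hγ.coordCurve_smooth ht h₀)).clm_apply hV

lemma comps_smooth {V : ℝ → E n} (hV : VSmooth γ I V) {t : ℝ} (ht : t ∈ I) {x₀ : M}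
    (h₀ : γ t ∈ (extChartAt (𝓡 n) x₀).source) : ContDiffAt ℝ ∞ (comps γ x₀ V) t :=
  hγ.comps_smooth_change ht (mem_extChartAt_source (γ t)) h₀ (hV t ht)

/-- `vel` at a time `s` refers to the preferred chart of γ(s), which may vary wildly with `s`. In
the fixed chart of γ(t) its components are an ordinary derivative, by `comps_vel`. -/
lemma vel_smooth : VSmooth γ I (vel n γ) := fun t ht => by
  have h₀ := mem_extChartAt_source (I := 𝓡 n) (γ t)
  have h : comps γ (γ t) (vel n γ) =ᶠ[nhds t] deriv (coordCurve n γ (γ t)) := by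
    filter_upwards [hγ.eventually_mem ht h₀] with s hs using hγ.comps_vel hs.1 hs.2
  exact (contDiffAt_deriv (hγ.coordCurve_smooth ht h₀)).congr_of_eventuallyEq h

/-- The covariant derivative has the usual expression in every chart. -/
lemma comps_cov (g : PseudoMetric n p q M) {V : ℝ → E n} (hV : VSmooth γ I V) {t : ℝ} (ht : t ∈ I)
    {x₀ : M} (h₀ : γ t ∈ (extChartAt (𝓡 n) x₀).source) :
    comps γ x₀ (cov g γ V) t = deriv (comps γ x₀ V) t +
      flatGam (coordMetric g x₀) (coordCurve n γ x₀ t) (deriv (coordCurve n γ x₀) t)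
        (comps γ x₀ V t) := by
  have h₁ := mem_extChartAt_source (I := 𝓡 n) (γ t)
  have hm : coordCurve n γ x₀ t ∈ transDom n x₀ (γ t) := mem_transDom_of_mem h₀ h₁
  have R := trans_pullback g x₀ (γ t)
  -- The product rule produces the second derivative of the transition map; it is exactly the
  -- inhomogeneous term in the transformation of the Christoffel symbols, so the two cancel.
  have hd : HasDerivAt (comps γ (γ t) V)
      (fderiv ℝ (fderiv ℝ (trans n x₀ (γ t))) (coordCurve n γ x₀ t) (deriv (coordCurve n γ x₀) t)
        (comps γ x₀ V t) + fderiv ℝ (trans n x₀ (γ t)) (coordCurve n γ x₀ t)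
          (deriv (comps γ x₀ V) t)) t := by
    have h : comps γ (γ t) V =ᶠ[nhds t]
        fun s => fderiv ℝ (trans n x₀ (γ t)) (coordCurve n γ x₀ s) (comps γ x₀ V s) := by
      filter_upwards [hγ.eventually_mem ht h₀, hγ.eventually_mem ht h₁] with s hs hs' using
        comps_change γ V hs.2 hs'.2
    refine HasDerivAt.congr_of_eventuallyEq ?_ h
    have hA : HasDerivAt (fun s => fderiv ℝ (trans n x₀ (γ t)) (coordCurve n γ x₀ s)) _ t :=
      (R.hasFDerivAt_fderiv hm).comp_hasDerivAt t
      ((hγ.coordCurve_smooth ht h₀).differentiableAt (by simp)).hasDerivAt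
    exact hA.clm_apply ((hγ.comps_smooth hV ht h₀).differentiableAt (by simp)).hasDerivAt
  have hg := R.gam_eq hm (deriv (coordCurve n γ x₀) t) (comps γ x₀ V t)
  have key : comps γ (γ t) (cov g γ V) t = fderiv ℝ (trans n x₀ (γ t)) (coordCurve n γ x₀ t)
      (deriv (comps γ x₀ V) t +
      flatGam (coordMetric g x₀) (coordCurve n γ x₀ t) (deriv (coordCurve n γ x₀) t)
        (comps γ x₀ V t)) := by
    rw [comps_self, cov_eq, hd.deriv, hγ.vel_eq_deriv ht, hγ.deriv_coordCurve_change ht h₀ h₁,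
      ← comps_self γ V t, comps_change γ V h₀ h₁, map_add]
    rw [hg, coordCurve_change γ (γ t) h₀]
    abel
  rw [comps_change γ _ h₀ h₁] at key
  exact (R.inv _ hm).injective key

lemma cov_smooth (g : PseudoMetric n p q M) {V : ℝ → E n} (hV : VSmooth γ I V) :
    VSmooth γ I (cov g γ V) := fun t ht => by
  have h₀ := mem_extChartAt_source (I := 𝓡 n) (γ t)
  have h : comps γ (γ t) (cov g γ V) =ᶠ[nhds t] fun s => deriv (comps γ (γ t) V) s +
      flatGam (coordMetric g (γ t)) (coordCurve n γ (γ t) s) (deriv (coordCurve n γ (γ t)) s)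
        (comps γ (γ t) V s) := by
    filter_upwards [hγ.eventually_mem ht h₀] with s hs using hγ.comps_cov g hV hs.1 hs.2
  refine ContDiffAt.congr_of_eventuallyEq ?_ h
  have hy := hγ.coordCurve_smooth ht h₀
  have hG := ((coordMetric_flat g (γ t)).gam_smooth
    (mem_extChartAt_target (I := 𝓡 n) (γ t))).comp t (f := coordCurve n γ (γ t)) hy
  exact (contDiffAt_deriv (hV t ht)).add
    ((hG.clm_apply (contDiffAt_deriv hy)).clm_apply (hV t ht))

/-- The metric along the curve in a chart. -/
lemma form_eventuallyEq (g : PseudoMetric n p q M) (V W : ℝ → E n) {t : ℝ} (ht : t ∈ I) :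
    (fun s => g.form (γ s) (V s) (W s)) =ᶠ[nhds t] fun s =>
      coordMetric g (γ t) (coordCurve n γ (γ t) s) (comps γ (γ t) V s) (comps γ (γ t) W s) := by
  have h₀ := mem_extChartAt_source (I := 𝓡 n) (γ t)
  filter_upwards [hγ.eventually_mem ht h₀] with s hs
  rw [form_eq_coordMetric g hs.2]; rfl

lemma form_smooth (g : PseudoMetric n p q M) {V W : ℝ → E n} (hV : VSmooth γ I V)
    (hW : VSmooth γ I W) {t : ℝ} (ht : t ∈ I) :
    ContDiffAt ℝ ∞ (fun s => g.form (γ s) (V s) (W s)) t := by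
  have h₀ := mem_extChartAt_source (I := 𝓡 n) (γ t)
  refine ContDiffAt.congr_of_eventuallyEq ?_ (hγ.form_eventuallyEq g V W ht)
  exact ((((coordMetric_flat g (γ t)).smooth _
    (mem_extChartAt_target (I := 𝓡 n) (γ t))).comp t (f := coordCurve n γ (γ t))
    (hγ.coordCurve_smooth ht h₀)).clm_apply (hV t ht)).clm_apply (hW t ht)

lemma hasDerivAt_form (g : PseudoMetric n p q M) {V W : ℝ → E n} (hV : VSmooth γ I V)
    (hW : VSmooth γ I W) {t : ℝ} (ht : t ∈ I) :
    HasDerivAt (fun s => g.form (γ s) (V s) (W s))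
      (g.form (γ t) (cov g γ V t) (W t) + g.form (γ t) (V t) (cov g γ W t)) t := by
  have h₀ := mem_extChartAt_source (I := 𝓡 n) (γ t)
  refine HasDerivAt.congr_of_eventuallyEq ?_ (hγ.form_eventuallyEq g V W ht)
  have H := coordMetric_flat g (γ t)
  have hy := mem_extChartAt_target (I := 𝓡 n) (γ t)
  have hh : HasFDerivAt (coordMetric g (γ t)) _ (coordCurve n γ (γ t) t) :=
    ((H.smooth _ hy).differentiableAt (by simp)).hasFDerivAt
  have h1 := ((hh.comp_hasDerivAt t
      ((hγ.coordCurve_smooth ht h₀).differentiableAt (by simp)).hasDerivAt).clm_apply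
    ((hV t ht).differentiableAt (by simp)).hasDerivAt).clm_apply
    ((hW t ht).differentiableAt (by simp)).hasDerivAt
  refine h1.congr_deriv ?_
  rw [cov_eq, cov_eq, hγ.vel_eq_deriv ht, ← coordMetric_self]
  simp only [Function.comp, map_add, add_apply, comps_self]
  -- Metric compatibility replaces the derivative of the metric components by two Christoffel terms,
  -- which complete the two covariant derivatives.
  have hc := H.compat hy (deriv (coordCurve n γ (γ t)) t) (V t) (W t)
  change fderiv ℝ (coordMetric g (γ t)) (extChartAt (𝓡 n) (γ t) (γ t)) _ _ _ + _ + _ = _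
  rw [hc]
  simp only [coordCurve]
  ring

end SmoothCurve

end Curves

end ConfCurve
end

/-! ### Reparametrization, Schouten tensor and conformal change along a curve -/

noncomputable section

namespace ConfCurve

section CurveFields

set_option maxSynthPendingDepth 3
set_option linter.unusedSectionVars false

variable {n p q : ℕ} {M : Type*} [TopologicalSpace M] [ChartedSpace (E n) M]
  [IsManifold (𝓡 n) 1 M] {γ : ℝ → M} {I : Set ℝ}

/-- Functions that are smooth at all points of `I`. -/
def RSmooth (I : Set ℝ) (f : ℝ → ℝ) : Prop := ∀ t ∈ I, ContDiffAt ℝ ∞ f t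

lemma RSmooth.hasDerivAt {f : ℝ → ℝ} (hf : RSmooth I f) {t : ℝ} (ht : t ∈ I) :
    HasDerivAt f (deriv f t) t := ((hf t ht).differentiableAt (by simp)).hasDerivAt

lemma comps_add (x₀ : M) (V W : ℝ → E n) : comps γ x₀ (V + W) = comps γ x₀ V + comps γ x₀ W := by
  ext1 s; simp only [comps, Pi.add_apply, map_add]

lemma comps_smul (x₀ : M) (f : ℝ → ℝ) (V : ℝ → E n) :
    comps γ x₀ (f • V) = f • comps γ x₀ V := by
  ext1 s; simp only [comps, Pi.smul_apply', map_smul]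

lemma comps_congr (x₀ : M) {V W : ℝ → E n} {t : ℝ} (h : V =ᶠ[nhds t] W) :
    comps γ x₀ V =ᶠ[nhds t] comps γ x₀ W := by
  filter_upwards [h] with s hs; simp only [comps, hs]

lemma VSmooth.add {V W : ℝ → E n} (hV : VSmooth γ I V) (hW : VSmooth γ I W) :
    VSmooth γ I (V + W) := fun t ht => by
  rw [comps_add]; exact (hV t ht).add (hW t ht)

lemma VSmooth.smul {f : ℝ → ℝ} {V : ℝ → E n} (hf : RSmooth I f) (hV : VSmooth γ I V) :
    VSmooth γ I (f • V) := fun t ht => by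
  rw [comps_smul]; exact (hf t ht).smul (hV t ht)

lemma VSmooth.zero : VSmooth γ I (0 : ℝ → E n) := fun t _ => by
  have : comps γ (γ t) (0 : ℝ → E n) = fun _ => 0 := by ext1 s; simp [comps]
  rw [this]; exact contDiffAt_const

lemma VSmooth.congr (hI : IsOpen I) {V W : ℝ → E n} (hV : VSmooth γ I V) (h : EqOn W V I) :
    VSmooth γ I W := fun t ht =>
  (hV t ht).congr_of_eventuallyEq (comps_congr _ (h.eventuallyEq_of_mem (hI.mem_nhds ht)))

lemma cov_congr (g : PseudoMetric n p q M) {V W : ℝ → E n} {t : ℝ} (h : V =ᶠ[nhds t] W) :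
    cov g γ V t = cov g γ W t := by
  rw [cov_eq, cov_eq, (comps_congr _ h).deriv_eq, h.eq_of_nhds]

lemma cov_add (g : PseudoMetric n p q M) {V W : ℝ → E n} (hV : VSmooth γ I V) (hW : VSmooth γ I W)
    {t : ℝ} (ht : t ∈ I) : cov g γ (V + W) t = cov g γ V t + cov g γ W t := by
  rw [cov_eq, cov_eq, cov_eq, comps_add, deriv_add ((hV t ht).differentiableAt (by simp))
    ((hW t ht).differentiableAt (by simp)), Pi.add_apply, map_add]
  abel

lemma cov_smul (g : PseudoMetric n p q M) {f : ℝ → ℝ} {V : ℝ → E n} (hf : RSmooth I f)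
    (hV : VSmooth γ I V) {t : ℝ} (ht : t ∈ I) :
    cov g γ (f • V) t = deriv f t • V t + f t • cov g γ V t := by
  rw [cov_eq, cov_eq, comps_smul, deriv_smul ((hf t ht).differentiableAt (by simp))
    ((hV t ht).differentiableAt (by simp)), Pi.smul_apply', map_smul, comps_self, smul_add]
  abel

lemma cov_zero (g : PseudoMetric n p q M) (t : ℝ) : cov g γ 0 t = 0 := by
  have : comps γ (γ t) (0 : ℝ → E n) = fun _ => 0 := by ext1 s; simp [comps]
  rw [cov_eq, this]; simp

variable [IsManifold (𝓡 n) ∞ M]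

/-! ### Reparametrization -/

section Reparam

variable {φ : ℝ → ℝ} {J : Set ℝ}

lemma vel_comp (hγ : SmoothCurve n γ I) (hγφ : SmoothCurve n (γ ∘ φ) J) {τ : ℝ} (hτ : τ ∈ J)
    (hφ : DifferentiableAt ℝ φ τ) (ht : φ τ ∈ I) :
    vel n (γ ∘ φ) τ = deriv φ τ • vel n γ (φ τ) := by
  rw [hγφ.vel_eq_deriv hτ, hγ.vel_eq_deriv ht]
  exact (((hγ.coordCurve_smooth ht (mem_extChartAt_source _)).differentiableAt
    (by simp)).hasDerivAt.scomp τ hφ.hasDerivAt).deriv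

lemma cov_comp (g : PseudoMetric n p q M) (hγ : SmoothCurve n γ I)
    (hγφ : SmoothCurve n (γ ∘ φ) J) {V : ℝ → E n} (hV : VSmooth γ I V) {τ : ℝ} (hτ : τ ∈ J)
    (hφ : DifferentiableAt ℝ φ τ) (ht : φ τ ∈ I) :
    cov g (γ ∘ φ) (V ∘ φ) τ = deriv φ τ • cov g γ V (φ τ) := by
  have hd : deriv (comps (γ ∘ φ) ((γ ∘ φ) τ) (V ∘ φ)) τ =
      deriv φ τ • deriv (comps γ (γ (φ τ)) V) (φ τ) :=
    (((hV _ ht).differentiableAt (by simp)).hasDerivAt.scomp τ hφ.hasDerivAt).deriv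
  rw [cov_eq, cov_eq, hd, vel_comp hγ hγφ hτ hφ ht, map_smul, smul_add]
  rfl

end Reparam

/-! ### The Schouten tensor along a curve -/

/-- Naturality under the transition map trades the chart centred at `x` for a fixed one, as
smoothness along a curve requires. -/
lemma schouten_chart (g : PseudoMetric n p q M) {x x₀ : M}
    (hx : x ∈ (extChartAt (𝓡 n) x₀).source) (v w : E n) :
    schouten g x v w = flatSchouten (coordMetric g x₀) (extChartAt (𝓡 n) x₀ x)
      (tangentCoordChange (𝓡 n) x x₀ x v) (tangentCoordChange (𝓡 n) x x₀ x w) := by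
  have h := mem_extChartAt_source (I := 𝓡 n) x
  rw [schouten_eq_flat, (trans_pullback g x x₀).schouten_eq (mem_transDom_of_mem h hx),
    tangentCoordChange_eq]
  congr 2
  simp only [trans, Function.comp]
  rw [(extChartAt (𝓡 n) x).left_inv h]

lemma schS_chart (g : PseudoMetric n p q M) {x x₀ : M}
    (hx : x ∈ (extChartAt (𝓡 n) x₀).source) (v : E n) :
    tangentCoordChange (𝓡 n) x x₀ x (schS g x v) =
      raise (coordMetric g x₀ (extChartAt (𝓡 n) x₀ x))
        (flatSchouten (coordMetric g x₀) (extChartAt (𝓡 n) x₀ x))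
        (tangentCoordChange (𝓡 n) x x₀ x v) := by
  have hy := (extChartAt (𝓡 n) x₀).map_source hx
  have H := coordMetric_flat g x₀
  have hA := tangentCoordChange_isInvertible (mem_extChartAt_source (I := 𝓡 n) x) hx
  refine form_ext (H.inv _ hy) fun z => ?_
  obtain ⟨w, rfl⟩ := hA.surjective z
  rw [raise_spec (H.inv _ hy), ← schouten_chart g hx, ← form_eq_coordMetric g hx,
    form_schS]

/-- The field `P(V, ·)♯` along the curve. -/
def schoutenField (g : PseudoMetric n p q M) (γ : ℝ → M) (V : ℝ → E n) (t : ℝ) : E n :=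
  schS g (γ t) (V t)

lemma schoutenField_smooth (g : PseudoMetric n p q M) (hγ : SmoothCurve n γ I) {V : ℝ → E n}
    (hV : VSmooth γ I V) : VSmooth γ I (schoutenField g γ V) := fun t ht => by
  have h₀ := mem_extChartAt_source (I := 𝓡 n) (γ t)
  have H := coordMetric_flat g (γ t)
  have hy := mem_extChartAt_target (I := 𝓡 n) (γ t)
  have h : comps γ (γ t) (schoutenField g γ V) =ᶠ[nhds t] fun s =>
      raise (coordMetric g (γ t) (coordCurve n γ (γ t) s))
        (flatSchouten (coordMetric g (γ t)) (coordCurve n γ (γ t) s)) (comps γ (γ t) V s) := by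
    filter_upwards [hγ.eventually_mem ht h₀] with s hs using schS_chart g hs.2 _
  refine ContDiffAt.congr_of_eventuallyEq ?_ h
  have := (H.raise_smooth hy (H.schouten_smooth hy)).comp t (f := coordCurve n γ (γ t))
    (hγ.coordCurve_smooth ht h₀)
  exact this.clm_apply (hV t ht)

lemma schS_smul (g : PseudoMetric n p q M) (x : M) (c : ℝ) (v : E n) :
    schS g x (c • v) = c • schS g x v := by
  rw [schS_eq, schS_eq, map_smul]

/-! ### Conformal change along a curve -/

section Conformal

variable {g g' : PseudoMetric n p q M} {Ω : M → ℝ} (R : IsRescaling g g' Ω)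

/-- The conformal factor in the chart around `x₀`. -/
def chartFactor (n : ℕ) {M : Type*} [TopologicalSpace M] [ChartedSpace (E n) M] (Ω : M → ℝ)
    (x₀ : M) : E n → ℝ := Ω ∘ (extChartAt (𝓡 n) x₀).symm

lemma chartFactor_apply {x x₀ : M} (Ω : M → ℝ) (hx : x ∈ (extChartAt (𝓡 n) x₀).source) :
    chartFactor n Ω x₀ (extChartAt (𝓡 n) x₀ x) = Ω x := by
  simp only [chartFactor, Function.comp]
  rw [(extChartAt (𝓡 n) x₀).left_inv hx]

include R

lemma rescaling_flat (x₀ : M) : FlatRescaling (coordMetric g x₀) (coordMetric g' x₀)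
    (chartFactor n Ω x₀) (extChartAt (𝓡 n) x₀).target where
  left := coordMetric_flat g x₀
  right := coordMetric_flat g' x₀
  smooth y hy := by
    rw [← contMDiffAt_iff_contDiffAt]
    exact (R.smooth _).comp y ((contMDiffOn_extChartAt_symm x₀).contMDiffAt
      ((isOpen_extChartAt_target x₀).mem_nhds hy))
  pos y _ := R.pos _
  eq y _ v w := R.eq _ _ _

lemma upsilon_chart {x x₀ : M} (hx : x ∈ (extChartAt (𝓡 n) x₀).source) (v : E n) :
    upsilon n Ω x v = flatUps (chartFactor n Ω x₀) (extChartAt (𝓡 n) x₀ x)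
      (tangentCoordChange (𝓡 n) x x₀ x v) := by
  have h := mem_extChartAt_source (I := 𝓡 n) x
  have hd : MDifferentiableAt (𝓡 n) 𝓘(ℝ, ℝ) Ω x := (R.smooth x).mdifferentiableAt (by simp)
  have e : (mfderiv (𝓡 n) 𝓘(ℝ, ℝ) Ω x : E n →L[ℝ] ℝ) =
      fderiv ℝ (chartFactor n Ω x) (extChartAt (𝓡 n) x x) := by
    refine hd.mfderiv.trans ?_
    simp [writtenInExtChartAt, fderivWithin_univ, chartFactor]
    rfl
  have hm := mem_transDom_of_mem h hx
  have e2 : chartFactor n Ω x =ᶠ[nhds (extChartAt (𝓡 n) x x)]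
      chartFactor n Ω x₀ ∘ trans n x x₀ := by
    filter_upwards [(isOpen_transDom x x₀).mem_nhds hm] with y hy
    simp only [chartFactor, Function.comp, trans]
    rw [(extChartAt (𝓡 n) x₀).left_inv (mem_transDom.1 hy).2]
  have e3 : trans n x x₀ (extChartAt (𝓡 n) x x) = extChartAt (𝓡 n) x₀ x := by
    simp only [trans, Function.comp]
    rw [(extChartAt (𝓡 n) x).left_inv h]
  have hs := (rescaling_flat R x₀).smooth _ ((extChartAt (𝓡 n) x₀).map_source hx)
  rw [upsilon, e, e2.fderiv_eq, fderiv_comp _ (by rw [e3]; exact hs.differentiableAt (by simp))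
    ((trans_smooth x x₀ hm).differentiableAt (by simp)), e3, ← tangentCoordChange_eq, flatUps,
    chartFactor_apply Ω hx]
  rfl

/-- The field `Υ♯` along the curve. -/
lemma sharp_upsilon_chart {x x₀ : M} (hx : x ∈ (extChartAt (𝓡 n) x₀).source) :
    tangentCoordChange (𝓡 n) x x₀ x ((g.form x).inverse (upsilon n Ω x)) =
      (coordMetric g x₀ (extChartAt (𝓡 n) x₀ x)).inverse
        (flatUps (chartFactor n Ω x₀) (extChartAt (𝓡 n) x₀ x)) := by
  have hy := (extChartAt (𝓡 n) x₀).map_source hx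
  have H := coordMetric_flat g x₀
  have hA := tangentCoordChange_isInvertible (mem_extChartAt_source (I := 𝓡 n) x) hx
  refine form_ext (H.inv _ hy) fun z => ?_
  obtain ⟨w, rfl⟩ := hA.surjective z
  rw [(H.inv _ hy).self_apply_inverse, ← form_eq_coordMetric g hx,
    (g.form_isInvertible x).self_apply_inverse, upsilon_chart R hx]

omit R in
/-- The field `Υ♯` along the curve. -/
def upsField (g : PseudoMetric n p q M) (Ω : M → ℝ) (γ : ℝ → M) (t : ℝ) : E n :=
  (g.form (γ t)).inverse (upsilon n Ω (γ t))

omit R in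
lemma form_upsField (t : ℝ) (v : E n) :
    g.form (γ t) (upsField g Ω γ t) v = upsilon n Ω (γ t) v := by
  rw [upsField, (g.form_isInvertible _).self_apply_inverse]

variable (hγ : SmoothCurve n γ I)

include hγ

lemma upsField_comps {t : ℝ} (ht : t ∈ I) : comps γ (γ t) (upsField g Ω γ) =ᶠ[nhds t]
    fun s => (coordMetric g (γ t) (coordCurve n γ (γ t) s)).inverse
        (flatUps (chartFactor n Ω (γ t)) (coordCurve n γ (γ t) s)) := by
  filter_upwards [hγ.eventually_mem ht (mem_extChartAt_source (γ t))] with s hs using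
    sharp_upsilon_chart R hs.2

lemma upsField_smooth : VSmooth γ I (upsField g Ω γ) := fun t ht => by
  refine ContDiffAt.congr_of_eventuallyEq ?_ (upsField_comps R hγ ht)
  have hy := mem_extChartAt_target (I := 𝓡 n) (γ t)
  exact (((coordMetric_flat g (γ t)).inverse_smooth hy).clm_apply
    ((rescaling_flat R (γ t)).ups_smooth hy)).comp t (f := coordCurve n γ (γ t))
    (hγ.coordCurve_smooth ht (mem_extChartAt_source (γ t)))

omit R in
lemma upsilon_self (R : IsRescaling g g' Ω) (x : M) :
    upsilon n Ω x = flatUps (chartFactor n Ω x) (extChartAt (𝓡 n) x x) := by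
  ext1 v
  rw [upsilon_chart R (mem_extChartAt_source x), tangentCoordChange_self (mem_extChartAt_source x)]

/-- The derivative of Υ♯ in a chart is the raised Hessian minus a Christoffel term, and the
Christoffel term of the covariant derivative cancels the latter. In this form the Hessian in the
Schouten change matches the one from differentiating the middle slot of a tractor. -/
lemma cov_upsField {t : ℝ} (ht : t ∈ I) : cov g γ (upsField g Ω γ) t =
    raise (coordMetric g (γ t) (coordCurve n γ (γ t) t)) (hessUps (coordMetric g (γ t))
      (chartFactor n Ω (γ t)) (coordCurve n γ (γ t) t)) (vel n γ t) := by
  have hy : coordCurve n γ (γ t) t ∈ (extChartAt (𝓡 n) (γ t)).target :=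
    mem_extChartAt_target (I := 𝓡 n) (γ t)
  have h1 : HasDerivAt (fun s => (coordMetric g (γ t) (coordCurve n γ (γ t) s)).inverse
      (flatUps (chartFactor n Ω (γ t)) (coordCurve n γ (γ t) s))) _ t :=
    ((rescaling_flat R (γ t)).hasFDerivAt_sharp hy).comp_hasDerivAt t
    ((hγ.coordCurve_smooth ht (mem_extChartAt_source (γ t))).differentiableAt (by simp)).hasDerivAt
  rw [cov_eq, (upsField_comps R hγ ht).deriv_eq]
  rw [h1.deriv, ← comps_self γ (upsField g Ω γ), (upsField_comps R hγ ht).eq_of_nhds,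
    hγ.vel_eq_deriv ht]
  simp

/-- Only the Christoffel term depends on the scale; the derivative of the components is common to
both sides, so no regularity of `V` is needed. -/
lemma cov_conformal {V : ℝ → E n} {t : ℝ} (ht : t ∈ I) : cov g' γ V t =
    cov g γ V t + upsilon n Ω (γ t) (vel n γ t) • V t + upsilon n Ω (γ t) (V t) • vel n γ t
      - g.form (γ t) (vel n γ t) (V t) • upsField g Ω γ t := by
  have hy := mem_extChartAt_target (I := 𝓡 n) (γ t)
  rw [cov_eq, cov_eq, coordCurve, (rescaling_flat R (γ t)).gam_eq hy, confS,
    ← upsilon_self hγ R, coordMetric_self, upsField]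
  abel

lemma schouten_conformal (hn : 3 ≤ n) {t : ℝ} (ht : t ∈ I) (w : E n) :
    schouten g' (γ t) (vel n γ t) w = schouten g (γ t) (vel n γ t) w
      - g.form (γ t) (cov g γ (upsField g Ω γ) t) w
      + upsilon n Ω (γ t) (vel n γ t) * upsilon n Ω (γ t) w
      - 1 / 2 * upsilon n Ω (γ t) (upsField g Ω γ t) * g.form (γ t) (vel n γ t) w := by
  have hy := mem_extChartAt_target (I := 𝓡 n) (γ t)
  rw [schouten_eq_flat, (rescaling_flat R (γ t)).schouten_eq hy (by rwa [finrank_E]),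
    ← schouten_eq_flat, ← upsilon_self hγ R, coordMetric_self, cov_upsField R hγ ht, coordCurve,
    ← coordMetric_self, raise_spec ((coordMetric_flat g (γ t)).inv _ hy), coordMetric_self, upsField]

/-- The factor Ω⁻² comes from raising the index with the rescaled metric. -/
lemma schoutenField_conformal (hn : 3 ≤ n) {t : ℝ} (ht : t ∈ I) :
    schoutenField g' γ (vel n γ) t = (Ω (γ t) ^ 2)⁻¹ • (schoutenField g γ (vel n γ) t
      - cov g γ (upsField g Ω γ) t
      + upsilon n Ω (γ t) (vel n γ t) • upsField g Ω γ t
      - (1 / 2 * upsilon n Ω (γ t) (upsField g Ω γ t)) • vel n γ t) := by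
  refine form_ext (g'.form_isInvertible (γ t)) fun w => ?_
  have hp := (R.pos (γ t)).ne'
  have e : ∀ v w : E n, g'.form (γ t) v w = Ω (γ t) ^ 2 * g.form (γ t) v w := R.eq (γ t)
  rw [schoutenField, form_schS, schouten_conformal R hγ hn ht, e]
  simp only [map_smul, map_add, map_sub, smul_apply, add_apply, sub_apply, smul_eq_mul,
    form_upsField, schoutenField, form_schS]
  field_simp

lemma factor_smooth : RSmooth I (fun t => Ω (γ t)) := fun t ht => by
  rw [← contMDiffAt_iff_contDiffAt]
  exact (R.smooth _).comp t (hγ.contMDiffAt ht)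

lemma factor_deriv {t : ℝ} (ht : t ∈ I) :
    HasDerivAt (fun t => Ω (γ t)) (Ω (γ t) * upsilon n Ω (γ t) (vel n γ t)) t := by
  have hx := mem_extChartAt_source (I := 𝓡 n) (γ t)
  have hy := mem_extChartAt_target (I := 𝓡 n) (γ t)
  have h : (fun t => Ω (γ t)) =ᶠ[nhds t] chartFactor n Ω (γ t) ∘ coordCurve n γ (γ t) := by
    filter_upwards [hγ.eventually_mem ht hx] with s hs using (chartFactor_apply Ω hs.2).symm
  have h1 := (((rescaling_flat R (γ t)).smooth _ hy).differentiableAt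
    (by simp)).hasFDerivAt.comp_hasDerivAt t (f := coordCurve n γ (γ t))
    ((hγ.coordCurve_smooth ht hx).differentiableAt (by simp)).hasDerivAt
  refine (h1.congr_of_eventuallyEq h).congr_deriv ?_
  have hp := (R.pos (γ t)).ne'
  rw [upsilon_self hγ R, hγ.vel_eq_deriv ht, flatUps, chartFactor_apply Ω hx, smul_apply,
    smul_eq_mul, mul_inv_cancel_left₀ hp]

end Conformal

end CurveFields

end ConfCurve
end

/-! ### Chains of derivatives in a module with derivation and pairing -/

noncomputable section

namespace ConfCurve

section DerivModules

variable {I : Set ℝ}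

/-! ### Smooth real functions -/

namespace RSmooth

variable {f h : ℝ → ℝ}

lemma const (c : ℝ) : RSmooth I fun _ => c := fun _ _ => contDiffAt_const

lemma add (hf : RSmooth I f) (hh : RSmooth I h) : RSmooth I (f + h) :=
  fun t ht => (hf t ht).add (hh t ht)

lemma sub (hf : RSmooth I f) (hh : RSmooth I h) : RSmooth I (f - h) :=
  fun t ht => (hf t ht).sub (hh t ht)

lemma mul (hf : RSmooth I f) (hh : RSmooth I h) : RSmooth I (f * h) :=
  fun t ht => (hf t ht).mul (hh t ht)

lemma inv (hf : RSmooth I f) (h0 : ∀ t ∈ I, f t ≠ 0) : RSmooth I f⁻¹ :=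
  fun t ht => (hf t ht).inv (h0 t ht)

lemma deriv (hf : RSmooth I f) : RSmooth I (deriv f) := fun t ht => contDiffAt_deriv (hf t ht)

lemma congr (hI : IsOpen I) (hf : RSmooth I f) (hh : EqOn h f I) : RSmooth I h := fun t ht =>
  (hf t ht).congr_of_eventuallyEq (hh.eventuallyEq_of_mem (hI.mem_nhds ht))

lemma of_contDiffOn (hI : IsOpen I) (hf : ContDiffOn ℝ ∞ f I) : RSmooth I f :=
  fun _ ht => hf.contDiffAt (hI.mem_nhds ht)

end RSmooth

/-! ### Fields with a derivation and a pairing -/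

/-- Smooth fields `ℝ → F` with a derivation over the smooth functions on `I` and a compatible
symmetric pairing. -/
structure DerivModule (I : Set ℝ) (F : Type*) [AddCommGroup F] [Module ℝ F] where
  /-- the smooth fields -/
  Sm : (ℝ → F) → Prop
  /-- the derivation -/
  D : (ℝ → F) → ℝ → F
  /-- the pairing -/
  pair : ℝ → F →ₗ[ℝ] F →ₗ[ℝ] ℝ
  isOpen : IsOpen I
  sm_congr : ∀ {V W}, Sm V → EqOn W V I → Sm W
  sm_zero : Sm 0
  sm_add : ∀ {V W}, Sm V → Sm W → Sm (V + W)
  sm_smul : ∀ {f V}, RSmooth I f → Sm V → Sm (f • V)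
  sm_D : ∀ {V}, Sm V → Sm (D V)
  D_congr : ∀ {V W}, EqOn V W I → EqOn (D V) (D W) I
  D_add : ∀ {V W}, Sm V → Sm W → EqOn (D (V + W)) (D V + D W) I
  D_smul : ∀ {f V}, RSmooth I f → Sm V → EqOn (D (f • V)) (deriv f • V + f • D V) I
  pair_symm : ∀ t v w, pair t v w = pair t w v
  pair_deriv : ∀ {V W}, Sm V → Sm W → ∀ t ∈ I,
    HasDerivAt (fun s => pair s (V s) (W s)) (pair t (D V t) (W t) + pair t (V t) (D W t)) t

namespace DerivModule

variable {F : Type*} [AddCommGroup F] [Module ℝ F] (𝓓 : DerivModule I F)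

/-- A field and its successive derivatives. -/
structure IsChain (X : ℕ → ℝ → F) : Prop where
  zero : 𝓓.Sm (X 0)
  succ : ∀ k, EqOn (X (k + 1)) (𝓓.D (X k)) I

/-- The fields in the span of the first `k` members of `X`, with smooth coefficients. -/
inductive InSpan (X : ℕ → ℝ → F) (k : ℕ) : (ℝ → F) → Prop
  | mem {j : ℕ} : j < k → InSpan X k (X j)
  | zero : InSpan X k 0
  | add {V W : ℝ → F} : InSpan X k V → InSpan X k W → InSpan X k (V + W)
  | smul {f : ℝ → ℝ} {V : ℝ → F} : RSmooth I f → InSpan X k V → InSpan X k (f • V)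
  | congr {V W : ℝ → F} : InSpan X k V → EqOn W V I → InSpan X k W

/-- `Y = a X_k + …` modulo the span of the previous members of `X`. -/
def Lead (X : ℕ → ℝ → F) (k : ℕ) (a : ℝ → ℝ) (Y : ℝ → F) : Prop :=
  RSmooth I a ∧ ∃ Z, InSpan (I := I) X k Z ∧ EqOn Y (a • X k + Z) I

/-- `Y = a X_{k+2} + b X_{k+1} + c X_k + …` modulo the span of the previous members of `X`. -/
def Lead₃ (X : ℕ → ℝ → F) (k : ℕ) (a b c : ℝ → ℝ) (Y : ℝ → F) : Prop :=
  RSmooth I a ∧ RSmooth I b ∧ RSmooth I c ∧ ∃ Z, InSpan (I := I) X k Z ∧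
    EqOn Y (a • X (k + 2) + b • X (k + 1) + c • X k + Z) I

variable {𝓓} {X : ℕ → ℝ → F}

lemma D_zero {t : ℝ} (ht : t ∈ I) : 𝓓.D 0 t = 0 := by
  have := 𝓓.D_smul (f := fun _ => (0 : ℝ)) (RSmooth.const 0) 𝓓.sm_zero ht
  rw [smul_zero] at this
  simpa using this

lemma IsChain.sm (hX : 𝓓.IsChain X) (k : ℕ) : 𝓓.Sm (X k) := by
  induction k with
  | zero => exact hX.zero
  | succ k ih => exact 𝓓.sm_congr (𝓓.sm_D ih) (hX.succ k)

namespace InSpan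

lemma mono {k l : ℕ} (hkl : k ≤ l) {V : ℝ → F} (hV : InSpan (I := I) X k V) :
    InSpan (I := I) X l V := by
  induction hV with
  | mem h => exact .mem (h.trans_le hkl)
  | zero => exact .zero
  | add _ _ h1 h2 => exact .add h1 h2
  | smul hf _ h => exact .smul hf h
  | congr _ he h => exact .congr h he

lemma sm (hX : 𝓓.IsChain X) {k : ℕ} {V : ℝ → F} (hV : InSpan (I := I) X k V) : 𝓓.Sm V := by
  induction hV with
  | mem h => exact hX.sm _
  | zero => exact 𝓓.sm_zero
  | add _ _ h1 h2 => exact 𝓓.sm_add h1 h2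
  | smul hf _ h => exact 𝓓.sm_smul hf h
  | congr _ he h => exact 𝓓.sm_congr h he

lemma D (hX : 𝓓.IsChain X) {k : ℕ} {V : ℝ → F} (hV : InSpan (I := I) X k V) :
    InSpan (I := I) X (k + 1) (𝓓.D V) := by
  induction hV with
  | mem h => exact .congr (.mem (Nat.succ_lt_succ h)) fun t ht => (hX.succ _ ht).symm
  | zero => exact .congr .zero fun t ht => D_zero ht
  | add h1 h2 ih1 ih2 => exact .congr (.add ih1 ih2) (𝓓.D_add (h1.sm hX) (h2.sm hX))
  | smul hf h ih =>
    exact .congr (.add (.smul hf.deriv (h.mono k.le_succ)) (.smul hf ih)) (𝓓.D_smul hf (h.sm hX))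
  | congr _ he ih => exact .congr ih (𝓓.D_congr he)

lemma pair_eq_zero {k : ℕ} {V : ℝ → F} (hV : InSpan (I := I) X k V) {t : ℝ} (ht : t ∈ I) {L : F →ₗ[ℝ] ℝ}
    (hL : ∀ j < k, L (X j t) = 0) : L (V t) = 0 := by
  induction hV with
  | mem h => exact hL _ h
  | zero => exact map_zero L
  | add _ _ h1 h2 => rw [Pi.add_apply, map_add, h1, h2, add_zero]
  | smul _ _ h => rw [Pi.smul_apply', map_smul, h, smul_zero]
  | congr _ he h => rw [he ht, h]

end InSpan

namespace Lead

variable {k : ℕ} {a : ℝ → ℝ} {Y : ℝ → F}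

lemma inSpan (h : Lead (I := I) X k a Y) : InSpan (I := I) X (k + 1) Y := by
  obtain ⟨ha, Z, hZ, he⟩ := h
  exact .congr (.add (.smul ha (.mem k.lt_succ_self)) (hZ.mono k.le_succ)) he

lemma congr {Y' : ℝ → F} (h : Lead (I := I) X k a Y) (hY : EqOn Y' Y I) :
    Lead (I := I) X k a Y' := by
  obtain ⟨ha, Z, hZ, he⟩ := h
  exact ⟨ha, Z, hZ, hY.trans he⟩

lemma add {Z : ℝ → F} (h : Lead (I := I) X k a Y) (hZ : InSpan (I := I) X k Z) :
    Lead (I := I) X k a (Y + Z) := by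
  obtain ⟨ha, Z', hZ', he⟩ := h
  exact ⟨ha, Z' + Z, .add hZ' hZ, fun t ht => by
    rw [Pi.add_apply, he ht]; simp only [Pi.add_apply]; abel⟩

lemma smul {f : ℝ → ℝ} (hf : RSmooth I f) (h : Lead (I := I) X k a Y) :
    Lead (I := I) X k (f * a) (f • Y) := by
  obtain ⟨ha, Z', hZ', he⟩ := h
  exact ⟨hf.mul ha, f • Z', .smul hf hZ', fun t ht => by
    rw [Pi.smul_apply', he ht]; simp [mul_smul]⟩

/-- The Leibniz term a' X_k falls into the lower span, so the leading coefficient itself is not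
differentiated. -/
lemma D (hX : 𝓓.IsChain X) (h : Lead (I := I) X k a Y) :
    Lead (I := I) X (k + 1) a (𝓓.D Y) := by
  obtain ⟨ha, Z, hZ, he⟩ := h
  refine ⟨ha, deriv a • X k + 𝓓.D Z,
    .add (.smul ha.deriv (.mem k.lt_succ_self)) (hZ.D hX), fun t ht => ?_⟩
  rw [𝓓.D_congr he ht, 𝓓.D_add (𝓓.sm_smul ha (hX.sm k)) (hZ.sm hX) ht, Pi.add_apply,
    𝓓.D_smul ha (hX.sm k) ht]
  simp only [Pi.add_apply, Pi.smul_apply', hX.succ k ht]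
  abel

lemma pair_self (hX : ∀ t ∈ I, ∀ j < k, 𝓓.pair t (X k t) (X j t) = 0 )
    (hX' : ∀ t ∈ I, ∀ i < k, ∀ j < k, 𝓓.pair t (X i t) (X j t) = 0)
    (h : Lead (I := I) X k a Y) {t : ℝ} (ht : t ∈ I) :
    𝓓.pair t (Y t) (Y t) = a t ^ 2 * 𝓓.pair t (X k t) (X k t) := by
  obtain ⟨ha, Z, hZ, he⟩ := h
  have h1 : 𝓓.pair t (X k t) (Z t) = 0 := hZ.pair_eq_zero ht (hX t ht)
  have h2 : 𝓓.pair t (Z t) (Z t) = 0 := hZ.pair_eq_zero ht fun j hj => by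
    rw [𝓓.pair_symm]
    exact hZ.pair_eq_zero ht fun i hi => hX' t ht _ hj _ hi
  rw [he ht]
  simp only [Pi.add_apply, Pi.smul_apply', map_add, map_smul, LinearMap.add_apply,
    LinearMap.smul_apply, smul_eq_mul, h1, h2, 𝓓.pair_symm t (Z t) (X k t)]
  ring

end Lead

/-! ### The Gram matrix of a chain -/

section Gram

variable (hX : 𝓓.IsChain X)

include hX

lemma pair_deriv_chain (i j : ℕ) {t : ℝ} (ht : t ∈ I) :
    HasDerivAt (fun s => 𝓓.pair s (X i s) (X j s))
      (𝓓.pair t (X (i + 1) t) (X j t) + 𝓓.pair t (X i t) (X (j + 1) t)) t := by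
  rw [hX.succ i ht, hX.succ j ht]
  exact 𝓓.pair_deriv (hX.sm i) (hX.sm j) t ht

/-- Differentiating a constant Gram entry makes its two neighbours on the next antidiagonal opposite
to each other. -/
lemma pair_shift {i j : ℕ} {c : ℝ} (h : ∀ t ∈ I, 𝓓.pair t (X i t) (X j t) = c) {t : ℝ} (ht : t ∈ I) :
    𝓓.pair t (X (i + 1) t) (X j t) + 𝓓.pair t (X i t) (X (j + 1) t) = 0 := by
  have h1 := pair_deriv_chain hX i j ht
  have h2 : (fun s => 𝓓.pair s (X i s) (X j s)) =ᶠ[nhds t] fun _ => c := by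
    filter_upwards [𝓓.isOpen.mem_nhds ht] with s hs using h s hs
  exact h1.unique ((hasDerivAt_const t c).congr_of_eventuallyEq h2)

variable {m : ℕ}

/-- Induction over the antidiagonals i + j = s + 1. Vanishing of the previous one makes neighbouring
entries opposite, so one zero entry forces all to vanish, and the middle of the antidiagonal
supplies it. -/
lemma gram_eq_zero (hnull : ∀ i < m, ∀ t ∈ I, 𝓓.pair t (X i t) (X i t) = 0) :
    ∀ s < 2 * m, ∀ i j, i + j = s → ∀ t ∈ I, 𝓓.pair t (X i t) (X j t) = 0 := by
  intro s
  induction s with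
  | zero =>
    intro hs i j hij t ht
    obtain ⟨rfl, rfl⟩ : i = 0 ∧ j = 0 := by omega
    exact hnull 0 (by omega) t ht
  | succ s ih =>
    intro hs i j hij t ht
    have hsh : ∀ i ≤ s, 𝓓.pair t (X (i + 1) t) (X (s - i) t)
        + 𝓓.pair t (X i t) (X (s + 1 - i) t) = 0 := fun i hi => by
      have := pair_shift hX (ih (by omega) i (s - i) (by omega)) ht
      rwa [show s - i + 1 = s + 1 - i by omega] at this
    have hup : ∀ d i, i + d ≤ s + 1 → (𝓓.pair t (X i t) (X (s + 1 - i) t) = 0 ↔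
        𝓓.pair t (X (i + d) t) (X (s + 1 - (i + d)) t) = 0) := by
      intro d
      induction d with
      | zero => intro i _; rfl
      | succ d ihd =>
        intro i hi
        rw [ihd i (by omega)]
        have := hsh (i + d) (by omega)
        rw [show s + 1 - (i + (d + 1)) = s - (i + d) by omega, ← add_assoc]
        constructor <;> intro h <;> linarith
    have hall : ∀ k ≤ s + 1, 𝓓.pair t (X k t) (X (s + 1 - k) t) = 0 → 
        ∀ i ≤ s + 1, 𝓓.pair t (X i t) (X (s + 1 - i) t) = 0 := by
      intro k hk h0 i hi
      rcases le_total k i with h | h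
      · obtain ⟨d, rfl⟩ := Nat.exists_eq_add_of_le h
        exact (hup d k (by omega)).1 h0
      · obtain ⟨d, rfl⟩ := Nat.exists_eq_add_of_le h
        exact (hup d i (by omega)).2 h0
    obtain rfl : j = s + 1 - i := by omega
    -- For s + 1 = 2k the middle entry is the square of X_k with k < m, null by assumption. For s +
    -- 1 = 2k + 1 the two middle entries are equal by symmetry and opposite by the shift relation.
    rcases Nat.even_or_odd' (s + 1) with ⟨k, hk | hk⟩
    · refine hall k (by omega) ?_ i (by omega)
      rw [show s + 1 - k = k by omega]
      exact hnull k (by omega) t ht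
    · refine hall k (by omega) ?_ i (by omega)
      have := hsh k (by omega)
      rw [show s - k = k by omega, show s + 1 - k = k + 1 by omega, 𝓓.pair_symm] at this
      rw [show s + 1 - k = k + 1 by omega]
      linarith

lemma gram_antidiagonal (hnull : ∀ i < m, ∀ t ∈ I, 𝓓.pair t (X i t) (X i t) = 0) {t : ℝ}
    (ht : t ∈ I) : ∀ d ≤ m, 𝓓.pair t (X (m - d) t) (X (m + d) t) =
      (-1) ^ d * 𝓓.pair t (X m t) (X m t) := by
  intro d
  induction d with
  | zero => intro _; simp
  | succ d ih =>
    intro hd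
    have h := pair_shift hX (gram_eq_zero hX hnull (2 * m - 1) (by omega) (m - (d + 1)) (m + d)
      (by omega)) ht
    rw [show m - (d + 1) + 1 = m - d by omega, ih (by omega)] at h
    rw [pow_succ, ← add_assoc]
    linarith

/-- The Gram matrix of X_0, …, X_{m-1} against X_{2m}, …, X_{m+1} is triangular, with diagonal
±⟨X_m, X_m⟩. Hence the independence in the definition of r-null curves follows from the other
conditions. -/
lemma linearIndependent_of_null (hnull : ∀ i < m, ∀ t ∈ I, 𝓓.pair t (X i t) (X i t) = 0) {t : ℝ}
    (ht : t ∈ I) (hm : 𝓓.pair t (X m t) (X m t) ≠ 0) :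
    LinearIndependent ℝ fun i : Fin m => X i t := by
  rw [Fintype.linearIndependent_iff]
  intro c hc
  have key : ∀ d : ℕ, ∀ i : Fin m, m - i ≤ d → c i = 0 := by
    intro d
    induction d with
    | zero => intro i hi; omega
    | succ d ih =>
      intro i hi
      -- Pairing with X_{2m-i} kills the terms j < i, whose index sum is below 2m; the terms j > i
      -- have zero coefficient by the induction, which descends from the top index.
      have h := congrArg (fun v => 𝓓.pair t v (X (m + (m - i)) t)) hc
      simp only [map_sum, LinearMap.sum_apply, map_smul, LinearMap.smul_apply, map_zero,
        LinearMap.zero_apply] at h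
      rw [Finset.sum_eq_single i] at h
      · have h2 := gram_antidiagonal hX hnull ht (m - i) (by omega)
        rw [show m - (m - (i : ℕ)) = i by omega] at h2
        rw [h2, smul_eq_mul] at h
        simpa [hm] using h
      · intro j _ hj
        rcases lt_or_gt_of_ne (Fin.val_ne_of_ne hj) with h' | h'
        · rw [gram_eq_zero hX hnull (j + (m + (m - i))) (by omega) _ _ rfl t ht, smul_zero]
        · rw [ih j (by omega), zero_smul]
      · simp
  exact fun i => key m i (by omega)

end Gram

end DerivModule

end DerivModules

end ConfCurve
end

/-! ### Three-term expansions and the effect of a new parameter -/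

noncomputable section

namespace ConfCurve

section Reparametrization

variable {I : Set ℝ} {F : Type*} [AddCommGroup F] [Module ℝ F] {𝓓 : DerivModule I F}
  {X : ℕ → ℝ → F}

namespace DerivModule

namespace Lead₃

variable {k : ℕ} {a b c : ℝ → ℝ} {Y : ℝ → F}

lemma smul {f : ℝ → ℝ} (hf : RSmooth I f) (h : Lead₃ (I := I) X k a b c Y) :
    Lead₃ (I := I) X k (f * a) (f * b) (f * c) (f • Y) := by
  obtain ⟨ha, hb, hc, Z', hZ', he⟩ := h
  exact ⟨hf.mul ha, hf.mul hb, hf.mul hc, f • Z', .smul hf hZ', fun t ht => by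
    rw [Pi.smul_apply', he ht]; simp [mul_smul]⟩

lemma congr {a' b' c' : ℝ → ℝ} {Y' : ℝ → F} (h : Lead₃ (I := I) X k a b c Y) (hI : IsOpen I)
    (ha : EqOn a' a I) (hb : EqOn b' b I) (hc : EqOn c' c I) (hY : EqOn Y' Y I) :
    Lead₃ (I := I) X k a' b' c' Y' := by
  obtain ⟨ha', hb', hc', Z', hZ', he⟩ := h
  refine ⟨ha'.congr hI ha, hb'.congr hI hb, hc'.congr hI hc, Z', hZ', fun t ht => ?_⟩
  rw [hY ht, he ht]
  simp only [Pi.add_apply, Pi.smul_apply', ha ht, hb ht, hc ht]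

lemma D (hX : 𝓓.IsChain X) (h : Lead₃ (I := I) X k a b c Y) :
    Lead₃ (I := I) X (k + 1) a (deriv a + b) (deriv b + c) (𝓓.D Y) := by
  obtain ⟨ha, hb, hc, Z, hZ, he⟩ := h
  refine ⟨ha, ha.deriv.add hb, hb.deriv.add hc, deriv c • X k + 𝓓.D Z,
    .add (.smul hc.deriv (.mem k.lt_succ_self)) (hZ.D hX), fun t ht => ?_⟩
  have s1 := 𝓓.sm_smul ha (hX.sm (k + 2))
  have s2 := 𝓓.sm_smul hb (hX.sm (k + 1))
  have s3 := 𝓓.sm_smul hc (hX.sm k)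
  rw [𝓓.D_congr he ht, 𝓓.D_add (𝓓.sm_add (𝓓.sm_add s1 s2) s3) (hZ.sm hX) ht, Pi.add_apply,
    𝓓.D_add (𝓓.sm_add s1 s2) s3 ht, Pi.add_apply, 𝓓.D_add s1 s2 ht, Pi.add_apply,
    𝓓.D_smul ha (hX.sm _) ht, 𝓓.D_smul hb (hX.sm _) ht, 𝓓.D_smul hc (hX.sm _) ht]
  simp only [Pi.add_apply, Pi.smul_apply', show k + 1 + 2 = k + 2 + 1 from rfl,
    show k + 1 + 1 = k + 2 from rfl, hX.succ (k + 2) ht, hX.succ (k + 1) ht, hX.succ k ht]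
  module

/-- The square of a field with three leading terms, if the first members of the chain are null. -/
lemma pair_self {r : ℕ} {a b c : ℝ → ℝ} {ε : ℝ} (hX : 𝓓.IsChain X)
    (hnull : ∀ i < r + 1, ∀ t ∈ I, 𝓓.pair t (X i t) (X i t) = 0)
    (hε : ∀ t ∈ I, 𝓓.pair t (X (r + 1) t) (X (r + 1) t) = ε)
    (h : Lead₃ (I := I) X r a b c Y) {t : ℝ} (ht : t ∈ I) :
    𝓓.pair t (Y t) (Y t) = a t ^ 2 * 𝓓.pair t (X (r + 2) t) (X (r + 2) t)
      - 2 * a t * c t * ε + b t ^ 2 * ε := by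
  obtain ⟨-, -, -, Z, hZ, he⟩ := h
  -- `Z` involves only X_j with j < r, so the index sums stay at most 2r + 1 < 2(r + 1).
  have hz : ∀ i ≤ r + 2, 𝓓.pair t (X i t) (Z t) = 0 := fun i hi =>
    hZ.pair_eq_zero ht fun j hj => gram_eq_zero hX hnull (i + j) (by omega) i j rfl t ht
  have hzz : 𝓓.pair t (Z t) (Z t) = 0 := hZ.pair_eq_zero ht fun j hj => by
    rw [𝓓.pair_symm]; exact hz j (by omega)
  -- Constancy of ⟨X_{r+1}, X_{r+1}⟩ gives ⟨X_{r+1}, X_{r+2}⟩ = 0; differentiating ⟨X_r, X_{r+1}⟩ =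
  -- 0 next gives ⟨X_r, X_{r+2}⟩ = -ε.
  have h1 := pair_shift hX hε ht
  have h2 := pair_shift hX (gram_eq_zero hX hnull (r + (r + 1)) (by omega) r (r + 1) rfl) ht
  have h3 := gram_eq_zero hX hnull (r + (r + 1)) (by omega) r (r + 1) rfl t ht
  have h4 := hnull r (by omega) t ht
  rw [𝓓.pair_symm] at h1
  have h1' : 𝓓.pair t (X (r + 1) t) (X (r + 2) t) = 0 := by linarith
  rw [hε t ht] at h2
  have h2' : 𝓓.pair t (X r t) (X (r + 2) t) = -ε := by
    change _ + 𝓓.pair t (X r t) (X (r + 2) t) = 0 at h2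
    linarith
  rw [he ht]
  simp only [Pi.add_apply, Pi.smul_apply', map_add, map_smul, LinearMap.add_apply,
    LinearMap.smul_apply, smul_eq_mul, 𝓓.pair_symm t (Z t), hz r (by omega), hz (r + 1) (by omega),
    hz (r + 2) le_rfl, hzz, 𝓓.pair_symm t (X (r + 2) t) (X (r + 1) t),
    𝓓.pair_symm t (X (r + 2) t) (X r t), 𝓓.pair_symm t (X (r + 1) t) (X r t), h1', h2', h3, h4,
    hε t ht]
  ring

end Lead₃

end DerivModule

/-! ### The coefficients -/

lemma coeffA_eq (r k : ℕ) : coeffA r k = r + 1 + k * r - k * (k - 1) / 2 := by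
  induction k with
  | zero => simp [coeffA]
  | succ k ih => rw [coeffA, ih]; push_cast; ring

lemma coeffB_eq (r k : ℕ) :
    coeffB r k = k * (r + 1) + r * (k * (k - 1) / 2) - k * (k - 1) * (k - 2) / 6 := by
  induction k with
  | zero => simp [coeffB]
  | succ k ih => rw [coeffB, ih, coeffA_eq]; push_cast; ring

lemma coeffB_last (r : ℕ) : coeffB r (r + 1) = ((r : ℝ) + 1) * (r + 2) * (2 * r + 3) / 6 := by
  rw [coeffB_eq]; push_cast; ring

lemma coeffB_last_pos (r : ℕ) : 0 < coeffB r (r + 1) := by rw [coeffB_last]; positivity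

/-- The coefficients of the quadratic terms. -/
def coeffC (r : ℕ) : ℕ → ℝ
  | 0 => (r + 1) * r
  | k + 1 => coeffC r k + (r - 1 - k) * coeffA r (k + 1)

/-- The recursions make the left side grow by (r - 1 - k)² from k to k + 1, so it is the sum of (r +
1 - j)² over 0 ≤ j ≤ k + 1; the right side is that sum in closed form. -/
lemma coeffC_eq (r k : ℕ) : coeffA r (k + 1) ^ 2 - 2 * coeffC r k =
    (k + 2) * (r + 1) ^ 2 - (r + 1) * (k + 2) * (k + 1) + (k + 1) * (k + 2) * (2 * k + 3) / 6 := by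
  induction k with
  | zero => simp [coeffC, coeffA]; ring
  | succ k ih =>
    rw [coeffC, coeffA]
    push_cast
    linear_combination ih

/-- At k = r the sum of squares is 1² + … + (r + 1)². This coincidence fixes the ratio of w' and w²
in the law for α to that of the Schwarzian. -/
lemma coeff_identity (r : ℕ) : coeffA r (r + 1) ^ 2 - 2 * coeffC r r = coeffB r (r + 1) := by
  rw [coeffC_eq, coeffB_last]; ring

namespace DerivModule

/-- The expansion of the derivatives with respect to a new parameter with derivative `f`. -/
lemma lead₃_reparam {r : ℕ} {f e : ℝ → ℝ} (hX : 𝓓.IsChain X) (hf : RSmooth I f)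
    (hf0 : ∀ t ∈ I, f t ≠ 0) (he : RSmooth I e)
    (he' : ∀ t ∈ I, deriv e t = (r + 1) * (deriv f t / f t) * e t) {Y : ℕ → ℝ → F}
    (hY0 : EqOn (Y 0) (e • X 0) I) (hY : ∀ k, EqOn (Y (k + 1)) (f⁻¹ • 𝓓.D (Y k)) I) (k : ℕ) :
    Lead₃ (I := I) X k (fun t => e t * (f t)⁻¹ ^ (k + 2))
      (fun t => e t * (f t)⁻¹ ^ (k + 2) * (coeffA r (k + 1) * (deriv f t / f t)))
      (fun t => e t * (f t)⁻¹ ^ (k + 2) * (coeffB r (k + 1) * deriv (fun s => deriv f s / f s) t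
        + coeffC r k * (deriv f t / f t) ^ 2)) (Y (k + 2)) := by
  have hI := 𝓓.isOpen
  set w : ℝ → ℝ := fun t => deriv f t / f t with hw
  have hws : RSmooth I w := fun t ht => (hf.deriv t ht).div (hf t ht) (hf0 t ht)
  have hp : ∀ k, RSmooth I fun t => e t * (f t)⁻¹ ^ k := fun k t ht =>
    (he t ht).mul (((hf.inv hf0) t ht).pow k)
  -- Since e scales like |f|^{r+1}, the factor e f⁻ᵏ has logarithmic derivative (r + 1 - k)w. At
  -- exponent k + 2 this is (r - 1 - k)w, the increment in the recursions for A and C.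
  have hp' : ∀ k : ℕ, ∀ t ∈ I, HasDerivAt (fun t => e t * (f t)⁻¹ ^ k)
      ((r + 1 - k) * w t * (e t * (f t)⁻¹ ^ k)) t := fun k t ht => by
    have h1 := (he.hasDerivAt ht).mul (((hf.hasDerivAt ht).inv (hf0 t ht)).pow k)
    refine h1.congr_deriv ?_
    have h0 := hf0 t ht
    rw [he' t ht]
    rcases k with _ | k
    · simp [hw]
    · simp only [Pi.inv_apply, Pi.pow_apply, Nat.add_sub_cancel, hw]
      push_cast
      ring
  have hf1 := hf.inv hf0
  induction k with
  | zero =>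
    -- The first derivative has only two terms, so the induction on three-term expansions starts
    -- from the second.
    have e1 : EqOn (Y 1) ((fun t => e t * (f t)⁻¹ ^ 1) • X 1
        + (fun t => e t * (f t)⁻¹ ^ 1 * ((r + 1) * w t)) • X 0) I := fun t ht => by
      rw [hY 0 ht, Pi.smul_apply', 𝓓.D_congr hY0 ht, 𝓓.D_smul he hX.zero ht]
      simp only [Pi.add_apply, Pi.smul_apply', Pi.inv_apply, hX.succ 0 ht, he' t ht, pow_one, hw]
      module
    have hs : RSmooth I fun t => e t * (f t)⁻¹ ^ 1 * ((r + 1) * w t) := fun t ht =>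
      (hp 1 t ht).mul (contDiffAt_const.mul (hws t ht))
    refine ⟨hp 2, fun t ht => (hp 2 t ht).mul (contDiffAt_const.mul (hws t ht)), fun t ht =>
      (hp 2 t ht).mul ((contDiffAt_const.mul (hws.deriv t ht)).add
        (contDiffAt_const.mul ((hws t ht).pow 2))), 0, .zero, fun t ht => ?_⟩
    have d1 := (hp' 1 t ht).deriv
    have d2 := ((hp' 1 t ht).mul ((hws.hasDerivAt ht).const_mul ((r : ℝ) + 1))).deriv
    rw [hY 1 ht, Pi.smul_apply', 𝓓.D_congr e1 ht, 𝓓.D_add (𝓓.sm_smul (hp 1) (hX.sm 1))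
      (𝓓.sm_smul hs (hX.sm 0)) ht, Pi.add_apply, 𝓓.D_smul (hp 1) (hX.sm 1) ht,
      𝓓.D_smul hs (hX.sm 0) ht]
    simp only [Pi.add_apply, Pi.smul_apply', Pi.inv_apply]
    rw [← hX.succ 0 ht, ← hX.succ 1 ht, d1]
    change _ • (_ + (deriv ((fun t => e t * (f t)⁻¹ ^ 1) * fun t => ((r : ℝ) + 1) * w t) t • X 0 t
      + _)) = _
    rw [d2]
    simp only [coeffA, coeffB, coeffC, Pi.zero_apply, add_zero]
    push_cast
    module
  | succ k ih =>
    refine ((ih.D hX).smul hf1).congr hI (fun t ht => ?_) (fun t ht => ?_) (fun t ht => ?_)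
      (hY (k + 2))
    · simp only [Pi.mul_apply, Pi.inv_apply]; ring
    · simp only [Pi.mul_apply, Pi.inv_apply, Pi.add_apply, (hp' (k + 2) t ht).deriv, coeffA]
      push_cast
      ring
    · have d2 := ((hp' (k + 2) t ht).mul
        ((hws.hasDerivAt ht).const_mul (coeffA r (k + 1)))).deriv
      simp only [Pi.mul_apply, Pi.inv_apply, Pi.add_apply]
      change _ = (f t)⁻¹ * (deriv ((fun t => e t * (f t)⁻¹ ^ (k + 2)) *
        fun t => coeffA r (k + 1) * w t) t + _)
      rw [d2, coeffC, coeffB]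
      push_cast
      ring

end DerivModule

end Reparametrization

end ConfCurve
end

/-! ### Tractor fields along a curve and invariance of the tractor connection -/

noncomputable section

namespace ConfCurve

section Tractors

set_option maxSynthPendingDepth 3
set_option linter.unusedSectionVars false

variable {n p q : ℕ} {M : Type*} [TopologicalSpace M] [ChartedSpace (E n) M]
  [IsManifold (𝓡 n) 1 M] {γ : ℝ → M} {I : Set ℝ}

/-- The metric at a point as a bilinear map. -/
def formₗ (g : PseudoMetric n p q M) (x : M) : E n →ₗ[ℝ] E n →ₗ[ℝ] ℝ :=
  (ContinuousLinearMap.coeLM ℝ : (E n →L[ℝ] ℝ) →ₗ[ℝ] _) ∘ₗ (g.form x : E n →ₗ[ℝ] E n →L[ℝ] ℝ)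

/-- Tractors in a scale, as triples. -/
abbrev Trip (n : ℕ) : Type := ℝ × E n × ℝ

/-- The tractor metric on triples. -/
def tpair (g : PseudoMetric n p q M) (x : M) : Trip n →ₗ[ℝ] Trip n →ₗ[ℝ] ℝ :=
  LinearMap.mk₂ ℝ (fun S S' => g.form x S.2.1 S'.2.1 + S.1 * S'.2.2 + S.2.2 * S'.1)
    (fun _ _ _ => by simp only [Prod.fst_add, Prod.snd_add, map_add, add_apply]; ring)
    (fun _ _ _ => by
      simp only [Prod.smul_fst, Prod.smul_snd, map_smul, smul_apply, smul_eq_mul]; ring)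
    (fun _ _ _ => by simp only [Prod.fst_add, Prod.snd_add, map_add]; ring)
    (fun _ _ _ => by simp only [Prod.smul_fst, Prod.smul_snd, map_smul, smul_eq_mul]; ring)

lemma tpair_apply (g : PseudoMetric n p q M) (x : M) (S S' : Trip n) :
    tpair g x S S' = g.form x S.2.1 S'.2.1 + S.1 * S'.2.2 + S.2.2 * S'.1 := rfl

/-- Smooth tractor fields along the curve. -/
def TSmooth (γ : ℝ → M) (I : Set ℝ) (S : ℝ → Trip n) : Prop :=
  RSmooth I (fun t => (S t).1) ∧ VSmooth γ I (fun t => (S t).2.1) ∧ RSmooth I (fun t => (S t).2.2)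

/-- The tractor connection along the curve, on triples. -/
def tder (g : PseudoMetric n p q M) (γ : ℝ → M) (S : ℝ → Trip n) (t : ℝ) : Trip n :=
  (deriv (fun s => (S s).1) t - g.form (γ t) (vel n γ t) (S t).2.1,
    cov g γ (fun s => (S s).2.1) t + (S t).2.2 • vel n γ t + (S t).1 • schS g (γ t) (vel n γ t),
    deriv (fun s => (S s).2.2) t - g.form (γ t) (schS g (γ t) (vel n γ t)) (S t).2.1)

variable [IsManifold (𝓡 n) ∞ M]

/-- Vector fields along a curve. -/
def vecModule (g : PseudoMetric n p q M) (hγ : SmoothCurve n γ I) : DerivModule I (E n) where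
  Sm := VSmooth γ I
  D := cov g γ
  pair t := formₗ g (γ t)
  isOpen := hγ.isOpen
  sm_congr hV h := hV.congr hγ.isOpen h
  sm_zero := VSmooth.zero
  sm_add := VSmooth.add
  sm_smul := VSmooth.smul
  sm_D := hγ.cov_smooth g
  D_congr h _ ht := cov_congr g (h.eventuallyEq_of_mem (hγ.isOpen.mem_nhds ht))
  D_add hV hW _ ht := cov_add g hV hW ht
  D_smul hf hV _ ht := cov_smul g hf hV ht
  pair_symm t v w := g.form_symm _ v w
  pair_deriv hV hW _ ht := hγ.hasDerivAt_form g hV hW ht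

/-- Tractor fields along a curve. -/
def tracModule (g : PseudoMetric n p q M) (hγ : SmoothCurve n γ I) : DerivModule I (Trip n) where
  Sm := TSmooth γ I
  D := tder g γ
  pair t := tpair g (γ t)
  isOpen := hγ.isOpen
  sm_congr hV h := ⟨hV.1.congr hγ.isOpen fun t ht => congrArg (fun S => S.1) (h ht),
    hV.2.1.congr hγ.isOpen fun t ht => congrArg (fun S => S.2.1) (h ht),
    hV.2.2.congr hγ.isOpen fun t ht => congrArg (fun S => S.2.2) (h ht)⟩
  sm_zero := ⟨RSmooth.const 0, VSmooth.zero, RSmooth.const 0⟩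
  sm_add hV hW := ⟨hV.1.add hW.1, hV.2.1.add hW.2.1, hV.2.2.add hW.2.2⟩
  sm_smul hf hV := ⟨hf.mul hV.1, hV.2.1.smul hf, hf.mul hV.2.2⟩
  sm_D {V} hV := by
    have hU := hγ.vel_smooth
    have hP := schoutenField_smooth g hγ hU
    exact ⟨hV.1.deriv.sub fun t ht => hγ.form_smooth g hU hV.2.1 ht,
      ((hγ.cov_smooth g hV.2.1).add (hU.smul hV.2.2)).add (hP.smul hV.1),
      hV.2.2.deriv.sub fun t ht => hγ.form_smooth g hP hV.2.1 ht⟩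
  D_congr {V W} h t ht := by
    have h' := h.eventuallyEq_of_mem (hγ.isOpen.mem_nhds ht)
    have h1 : (fun s => (V s).1) =ᶠ[nhds t] fun s => (W s).1 := h'.fun_comp Prod.fst
    have h2 : (fun s => (V s).2.1) =ᶠ[nhds t] fun s => (W s).2.1 := h'.fun_comp fun S => S.2.1
    have h3 : (fun s => (V s).2.2) =ᶠ[nhds t] fun s => (W s).2.2 := h'.fun_comp fun S => S.2.2
    simp only [tder, h1.deriv_eq, h3.deriv_eq, cov_congr g h2, h ht]
  D_add {V W} hV hW t ht := by
    have e1 : deriv (fun s => ((V + W) s).1) t = deriv (fun s => (V s).1) t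
        + deriv (fun s => (W s).1) t := ((hV.1.hasDerivAt ht).add (hW.1.hasDerivAt ht)).deriv
    have e2 : cov g γ (fun s => ((V + W) s).2.1) t = cov g γ (fun s => (V s).2.1) t
        + cov g γ (fun s => (W s).2.1) t := cov_add g hV.2.1 hW.2.1 ht
    have e3 : deriv (fun s => ((V + W) s).2.2) t = deriv (fun s => (V s).2.2) t
        + deriv (fun s => (W s).2.2) t := ((hV.2.2.hasDerivAt ht).add (hW.2.2.hasDerivAt ht)).deriv
    rw [tder, e1, e2, e3]
    refine Prod.ext ?_ (Prod.ext ?_ ?_) <;>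
      simp only [tder, Pi.add_apply, Prod.fst_add, Prod.snd_add, map_add]
    · ring
    · module
    · ring
  D_smul {f V} hf hV t ht := by
    have e1 : deriv (fun s => ((f • V) s).1) t = deriv f t * (V t).1 + f t * deriv (fun s => (V s).1) t :=
      ((hf.hasDerivAt ht).mul (hV.1.hasDerivAt ht)).deriv
    have e2 : cov g γ (fun s => ((f • V) s).2.1) t = deriv f t • (V t).2.1
        + f t • cov g γ (fun s => (V s).2.1) t := cov_smul g hf hV.2.1 ht
    have e3 : deriv (fun s => ((f • V) s).2.2) t = deriv f t * (V t).2.2 + f t * deriv (fun s => (V s).2.2) t :=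
      ((hf.hasDerivAt ht).mul (hV.2.2.hasDerivAt ht)).deriv
    rw [tder, e1, e2, e3]
    refine Prod.ext ?_ (Prod.ext ?_ ?_) <;>
      simp only [tder, Pi.add_apply, Pi.smul_apply', Prod.fst_add, Prod.snd_add, Prod.smul_fst,
        Prod.smul_snd, map_smul, smul_eq_mul]
    · ring
    · module
    · ring
  pair_symm t v w := by rw [tpair_apply, tpair_apply, g.form_symm]; ring
  pair_deriv {V W} hV hW t ht := by
    have h := ((hγ.hasDerivAt_form g hV.2.1 hW.2.1 ht).add
      ((hV.1.hasDerivAt ht).mul (hW.2.2.hasDerivAt ht))).add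
      ((hV.2.2.hasDerivAt ht).mul (hW.1.hasDerivAt ht))
    refine h.congr_deriv ?_
    simp only [tpair_apply, tder, map_add, map_smul, add_apply, smul_apply, smul_eq_mul]
    rw [g.form_symm (γ t) (V t).2.1 (vel n γ t), g.form_symm (γ t) (V t).2.1 (schS g _ _)]
    ring

/-! ### Conformal invariance of the tractor connection -/

section Conformal

variable {g g' : PseudoMetric n p q M} {Ω : M → ℝ}

/-- The change of splitting, on triples. -/
def resc (g : PseudoMetric n p q M) (Ω : M → ℝ) (γ : ℝ → M) (t : ℝ) (S : Trip n) : Trip n :=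
  (Ω (γ t) * S.1, (Ω (γ t))⁻¹ • (S.2.1 + S.1 • upsField g Ω γ t),
    (Ω (γ t))⁻¹ * (S.2.2 - g.form (γ t) (upsField g Ω γ t) S.2.1
      - 1 / 2 * g.form (γ t) (upsField g Ω γ t) (upsField g Ω γ t) * S.1))

lemma tpair_resc (R : IsRescaling g g' Ω) (t : ℝ) (S S' : Trip n) :
    tpair g' (γ t) (resc g Ω γ t S) (resc g Ω γ t S') = tpair g (γ t) S S' := by
  have hp := (R.pos (γ t)).ne'
  have e : ∀ v w : E n, g'.form (γ t) v w = Ω (γ t) ^ 2 * g.form (γ t) v w := R.eq (γ t)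
  simp only [tpair_apply, resc, e, map_add, map_smul, add_apply, smul_apply, smul_eq_mul]
  rw [g.form_symm (γ t) S.2.1 (upsField g Ω γ t)]
  field_simp
  ring

/-- Each slot is expanded by the Leibniz rule. The derivative of Ω cancels against Υ(U), and ∇_UΥ♯,
which arises from differentiating the shifts in the middle and bottom slots, cancels against its
occurrence in the change of the Schouten tensor. -/
lemma tder_resc (hn : 3 ≤ n) (R : IsRescaling g g' Ω) (hγ : SmoothCurve n γ I) {S : ℝ → Trip n}
    (hS : TSmooth γ I S) {t : ℝ} (ht : t ∈ I) :
    tder g' γ (fun s => resc g Ω γ s (S s)) t = resc g Ω γ t (tder g γ S t) := by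
  have hp := (R.pos (γ t)).ne'
  have e : ∀ v w : E n, g'.form (γ t) v w = Ω (γ t) ^ 2 * g.form (γ t) v w := R.eq (γ t)
  have hΩ := factor_smooth R hγ
  have hΩi : RSmooth I (fun t => (Ω (γ t))⁻¹) := hΩ.inv fun t _ => (R.pos (γ t)).ne'
  have dΩ := factor_deriv R hγ ht
  have dΩi := dΩ.fun_inv hp
  have ha := upsField_smooth R hγ
  obtain ⟨hσ, hμ, hρ⟩ := hS
  have e1 : deriv (fun s => (resc g Ω γ s (S s)).1) t = _ := (dΩ.mul (hσ.hasDerivAt ht)).deriv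
  have hmid : VSmooth γ I ((fun s => (S s).2.1) + (fun s => (S s).1) • upsField g Ω γ) :=
    hμ.add (ha.smul hσ)
  have e2 : cov g' γ (fun s => (resc g Ω γ s (S s)).2.1) t = _ := cov_smul g' hΩi hmid ht
  rw [dΩi.deriv, cov_conformal R hγ
    (V := (fun s => (S s).2.1) + (fun s => (S s).1) • upsField g Ω γ) ht, cov_add g hμ (ha.smul hσ) ht, cov_smul g hσ ha ht] at e2
  have e3 : deriv (fun s => (resc g Ω γ s (S s)).2.2) t = _ :=
    (dΩi.mul (((hρ.hasDerivAt ht).sub (hγ.hasDerivAt_form g ha hμ ht)).sub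
      (((hγ.hasDerivAt_form g ha ha ht).const_mul (1 / 2)).mul (hσ.hasDerivAt ht)))).deriv
  have eP := schoutenField_conformal R hγ hn ht
  simp only [schoutenField, ← form_upsField (g := g)] at eP
  simp only [← form_upsField (g := g)] at e1 e2 e3
  have hs := g.form_symm (γ t) (vel n γ t) (upsField g Ω γ t)
  refine Prod.ext ?_ (Prod.ext ?_ ?_)
  · simp only [tder, e1]
    simp only [resc, e, map_smul, map_add, smul_eq_mul, hs]
    field_simp
    ring
  · simp only [tder, e2, eP]
    simp only [resc, Pi.add_apply, Pi.smul_apply', map_add, map_smul, smul_eq_mul, hs]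
    match_scalars <;> field_simp <;> ring
  · simp only [tder, e3, eP]
    simp only [resc, e, Pi.sub_apply, Pi.mul_apply, map_add, map_sub, map_smul, smul_eq_mul,
      add_apply, sub_apply, smul_apply]
    rw [g.form_symm (γ t) (schS g (γ t) (vel n γ t)) (upsField g Ω γ t),
      g.form_symm (γ t) (cov g γ (upsField g Ω γ) t) (upsField g Ω γ t), hs]
    field_simp
    ring

end Conformal

end Tractors

end ConfCurve
end

/-! ### Null curves: the shape of the canonical lift and its conformal invariance -/

noncomputable section

namespace ConfCurve

section NullCurves

set_option maxSynthPendingDepth 3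
set_option linter.unusedSectionVars false

variable {n p q : ℕ} {M : Type*} [TopologicalSpace M] [ChartedSpace (E n) M]
  [IsManifold (𝓡 n) 1 M] {γ : ℝ → M} {I : Set ℝ} {r : ℕ}

/-- The derived vectors, as functions into the model space. -/
def derV (g : PseudoMetric n p q M) (γ : ℝ → M) (i : ℕ) (t : ℝ) : E n := derivedVec g γ i t

/-- The derivatives of the canonical lift, as triples. -/
def derT (g : PseudoMetric n p q M) (r : ℕ) (γ : ℝ → M) (k : ℕ) (t : ℝ) : Trip n :=
  ((derivedT g r γ k t).top, (derivedT g r γ k t).mid, (derivedT g r γ k t).bot)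

lemma derV_zero (g : PseudoMetric n p q M) (γ : ℝ → M) : derV g γ 0 = vel n γ := rfl

lemma derV_succ (g : PseudoMetric n p q M) (γ : ℝ → M) (i : ℕ) :
    derV g γ (i + 1) = cov g γ (derV g γ i) := rfl

lemma derT_zero (g : PseudoMetric n p q M) (γ : ℝ → M) (t : ℝ) :
    derT g r γ 0 t = (0, 0, (speed g r γ t)⁻¹) := rfl

lemma derT_succ (g : PseudoMetric n p q M) (γ : ℝ → M) (k : ℕ) :
    derT g r γ (k + 1) = tder g γ (derT g r γ k) := by
  ext1 t
  refine Prod.ext rfl (Prod.ext rfl ?_)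
  change _ - schouten g (γ t) (vel n γ t) (derT g r γ k t).2.1 = _ - _
  rw [form_schS]; rfl

lemma speed_eq (g : PseudoMetric n p q M) (γ : ℝ → M) (t : ℝ) :
    speed g r γ t = √|g.form (γ t) (derV g γ r t) (derV g γ r t)| := rfl

lemma alpha_eq (g : PseudoMetric n p q M) (γ : ℝ → M) (t : ℝ) :
    alpha g r γ t = tpair g (γ t) (derT g r γ (r + 2) t) (derT g r γ (r + 2) t) := rfl

/-- The metric conditions in the definition of an `r`-null curve. -/
structure NullConditions (g : PseudoMetric n p q M) (r : ℕ) (γ : ℝ → M) (I : Set ℝ) : Prop where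
  null : ∀ i < r, ∀ t ∈ I, g.form (γ t) (derV g γ i t) (derV g γ i t) = 0
  ne : ∀ t ∈ I, g.form (γ t) (derV g γ r t) (derV g γ r t) ≠ 0

lemma IsRNullIn.nullConditions {g : PseudoMetric n p q M} (h : IsRNullIn g r γ I) :
    NullConditions g r γ I :=
  ⟨fun i hi t ht => (h t ht).2.1 i hi, fun t ht => (h t ht).2.2⟩

variable [IsManifold (𝓡 n) ∞ M]

lemma vec_isChain (g : PseudoMetric n p q M) (hγ : SmoothCurve n γ I) :
    (vecModule g hγ).IsChain (derV g γ) :=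
  ⟨hγ.vel_smooth, fun _ _ _ => rfl⟩

namespace NullConditions

open DerivModule

variable {g : PseudoMetric n p q M} (h : NullConditions g r γ I) (hγ : SmoothCurve n γ I)

include h hγ

lemma isRNullIn : IsRNullIn g r γ I := fun t ht =>
  ⟨linearIndependent_of_null (vec_isChain g hγ) h.null ht (h.ne t ht), fun i hi => h.null i hi t ht,
    h.ne t ht⟩

lemma gram {i j : ℕ} (hij : i + j < 2 * r) {t : ℝ} (ht : t ∈ I) :
    g.form (γ t) (derV g γ i t) (derV g γ j t) = 0 :=
  gram_eq_zero (vec_isChain g hγ) h.null (i + j) hij i j rfl t ht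

lemma form_vel_eq_zero {V : ℝ → E n} {k : ℕ} (hk : k ≤ 2 * r)
    (hV : InSpan (I := I) (derV g γ) k V) {t : ℝ} (ht : t ∈ I) :
    g.form (γ t) (vel n γ t) (V t) = 0 :=
  hV.pair_eq_zero ht (L := formₗ g (γ t) (vel n γ t)) fun j hj =>
    h.gram hγ (i := 0) (j := j) (by omega) ht

lemma form_lead {k : ℕ} (hk : k ≤ r) {a : ℝ → ℝ} {Y : ℝ → E n}
    (hY : Lead (I := I) (derV g γ) k a Y) {t : ℝ} (ht : t ∈ I) :
    g.form (γ t) (Y t) (Y t) = a t ^ 2 * g.form (γ t) (derV g γ k t) (derV g γ k t) :=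
  hY.pair_self (𝓓 := vecModule g hγ) (fun t ht j hj => h.gram hγ (by omega) ht)
    (fun t ht i hi j hj => h.gram hγ (by omega) ht) ht

lemma speed_pos {t : ℝ} (ht : t ∈ I) : 0 < speed g r γ t := by
  rw [speed_eq]; exact Real.sqrt_pos.2 (abs_pos.2 (h.ne t ht))

/-- Absolute value and square root are smooth here because U^{(r)} is nowhere null. -/
lemma speed_smooth : RSmooth I (speed g r γ) := fun t ht => by
  have hX := (vec_isChain g hγ).sm r
  have h1 := hγ.form_smooth g hX hX ht
  have h2 : ContDiffAt ℝ ∞ (fun x : ℝ => √|x|) (g.form (γ t) (derV g γ r t) (derV g γ r t)) :=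
    (Real.contDiffAt_sqrt (abs_pos.2 (h.ne t ht)).ne').comp _ (contDiffAt_abs (h.ne t ht))
  exact ContDiffAt.comp (g := fun x : ℝ => √|x|)
    (f := fun s => g.form (γ s) (derV g γ r s) (derV g γ r s)) t h2 h1

lemma tractor_isChain : (tracModule g hγ).IsChain (derT g r γ) := by
  refine ⟨⟨RSmooth.const 0, VSmooth.zero, ?_⟩, fun k t _ => by rw [derT_succ]; rfl⟩
  exact (h.speed_smooth hγ).inv fun t ht => (h.speed_pos hγ ht).ne'

/-- The shape of the first derivatives of the canonical lift. -/
lemma derT_shape (k : ℕ) (hk : k ≤ r) : (∀ t ∈ I, (derT g r γ (k + 1) t).1 = 0) ∧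
    Lead (I := I) (derV g γ) k (speed g r γ)⁻¹ (fun t => (derT g r γ (k + 1) t).2.1) := by
  have hs := (h.speed_smooth hγ).inv fun t ht => (h.speed_pos hγ ht).ne'
  induction k with
  | zero =>
    refine ⟨fun t ht => ?_, hs, 0, .zero, fun t ht => ?_⟩
    · simp [derT_succ, tder, derT_zero]
    · have : cov g γ (fun _ => (0 : E n)) t = 0 := cov_zero g t
      simp [derT_succ, tder, derT_zero, this, derV_zero]
  | succ k ih =>
    obtain ⟨h1, h2⟩ := ih (by omega)
    have hsm := (h.tractor_isChain hγ).sm (k + 1)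
    refine ⟨fun t ht => ?_, ?_⟩
    · rw [derT_succ]
      have hd : deriv (fun s => (derT g r γ (k + 1) s).1) t = 0 := by
        have : (fun s => (derT g r γ (k + 1) s).1) =ᶠ[nhds t] fun _ => 0 := by
          filter_upwards [hγ.isOpen.mem_nhds ht] with s hs using h1 s hs
        rw [this.deriv_eq, deriv_const]
      -- The new top slot is -g(U, μ) with μ in the span of U, …, U^{(k)}, and U is orthogonal to
      -- all U^{(j)} with j < 2r.
      simp only [tder, hd, h.form_vel_eq_zero hγ (by omega) h2.inSpan ht, sub_zero]
    -- In the middle slot the Schouten term is absent since the top slot vanishes, and ρU only adds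
    -- to the lower span.
    · refine ((h2.D (vec_isChain g hγ)).add (.smul hsm.2.2 (.mem (j := 0) k.succ_pos))).congr
        fun t ht => ?_
      simp only [derT_succ g γ (k + 1), tder, h1 t ht, zero_smul, add_zero]
      rfl

lemma tractor_null (i : ℕ) (hi : i < r + 1) {t : ℝ} (ht : t ∈ I) :
    tpair g (γ t) (derT g r γ i t) (derT g r γ i t) = 0 := by
  rcases i with _ | k
  · simp [tpair_apply, derT_zero]
  · obtain ⟨h1, h2⟩ := h.derT_shape hγ k (by omega)
    rw [tpair_apply, h1 t ht, h.form_lead hγ (by omega) h2 ht, h.null k (by omega) t ht]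
    ring

/-- With zero top slot and leading coefficient u⁻¹, only u⁻² g(U^{(r)}, U^{(r)}) survives; the
normalization by u reduces it to a sign. -/
lemma tractor_unit {t : ℝ} (ht : t ∈ I) :
    tpair g (γ t) (derT g r γ (r + 1) t) (derT g r γ (r + 1) t) =
      SignType.sign (g.form (γ t) (derV g γ r t) (derV g γ r t)) := by
  obtain ⟨h1, h2⟩ := h.derT_shape hγ r le_rfl
  rw [tpair_apply, h1 t ht, h.form_lead hγ le_rfl h2 ht, Pi.inv_apply, inv_pow, speed_eq,
    Real.sq_sqrt (abs_nonneg _)]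
  set x := g.form (γ t) (derV g γ r t) (derV g γ r t) with hx
  have hx0 : x ≠ 0 := h.ne t ht
  rcases hx0.lt_or_gt with hx' | hx'
  · simp [abs_of_neg hx', sign_neg hx']; field_simp
  · simp [abs_of_pos hx', sign_pos hx']; field_simp

/-- The sign of `⟨U^{(r)}, U^{(r)}⟩` is constant on intervals. -/
lemma exists_sign (hI : I.OrdConnected) : ∃ ε : ℝ, (ε = 1 ∨ ε = -1) ∧
    ∀ t ∈ I, tpair g (γ t) (derT g r γ (r + 1) t) (derT g r γ (r + 1) t) = ε := by
  have hX := (vec_isChain g hγ).sm r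
  set x : ℝ → ℝ := fun t => g.form (γ t) (derV g γ r t) (derV g γ r t) with hx
  have hc : ContinuousOn x I := fun t ht =>
    (hγ.form_smooth g hX hX ht).continuousAt.continuousWithinAt
  have hpre : IsPreconnected I := hI.isPreconnected
  -- An empty interval falls under the first case. Otherwise a change of sign would force a zero, by
  -- the intermediate value theorem.
  by_cases hpos : ∀ t ∈ I, 0 < x t
  · exact ⟨1, .inl rfl, fun t ht => by
      rw [h.tractor_unit hγ ht, sign_pos (hpos t ht)]; simp⟩
  · push Not at hpos
    obtain ⟨t₀, ht₀, h₀⟩ := hpos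
    refine ⟨-1, .inr rfl, fun t ht => ?_⟩
    have : x t < 0 := by
      by_contra hcon
      obtain ⟨t', ht', h'⟩ := hpre.intermediate_value ht₀ ht hc ⟨h₀, not_lt.1 hcon⟩
      exact h.ne t' ht' h'
    rw [h.tractor_unit hγ ht, sign_neg this]; simp

/-! ### Conformal invariance -/

section Conformal

variable {g' : PseudoMetric n p q M} {Ω : M → ℝ} (R : IsRescaling g g' Ω)

include R

/-- The change of ∇_U V adds multiples of V and U, both of lower order, and a multiple of Υ♯ whose
coefficient g(U, V) vanishes by the Gram relations. -/
lemma derV_rescale (k : ℕ) (hk : k ≤ r) :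
    Lead (I := I) (derV g γ) k (fun _ => 1) (derV g' γ k) := by
  have hX := vec_isChain g hγ
  have ha := upsField_smooth R hγ
  induction k with
  | zero =>
    refine ⟨RSmooth.const 1, 0, .zero, fun t _ => ?_⟩
    simp only [Pi.add_apply, Pi.smul_apply', one_smul, Pi.zero_apply, add_zero]
    rfl
  | succ k ih =>
    have hk' := ih (by omega)
    have s1 : RSmooth I fun t => upsilon n Ω (γ t) (vel n γ t) := fun t ht => by
      simpa only [form_upsField] using hγ.form_smooth g ha hγ.vel_smooth ht
    have s2 : RSmooth I fun t => upsilon n Ω (γ t) (derV g' γ k t) := fun t ht => by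
      simpa only [form_upsField] using hγ.form_smooth g ha (hk'.inSpan.sm hX) ht
    refine ((hk'.D hX).add (.add (.smul s1 hk'.inSpan)
      (.smul s2 (.mem (j := 0) k.succ_pos)))).congr fun t ht => ?_
    have h0 := h.form_vel_eq_zero hγ (by omega) hk'.inSpan ht
    rw [derV_succ, cov_conformal R hγ ht, h0]
    simp only [Pi.add_apply, Pi.smul_apply', derV_zero, zero_smul, sub_zero]
    exact add_assoc _ _ _

lemma form_rescale {k : ℕ} (hk : k ≤ r) {t : ℝ} (ht : t ∈ I) :
    g'.form (γ t) (derV g' γ k t) (derV g' γ k t) =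
      Ω (γ t) ^ 2 * g.form (γ t) (derV g γ k t) (derV g γ k t) := by
  have e : ∀ v w : E n, g'.form (γ t) v w = Ω (γ t) ^ 2 * g.form (γ t) v w := R.eq (γ t)
  rw [e, h.form_lead hγ hk (h.derV_rescale hγ R k hk) ht]
  ring

lemma rescale : NullConditions g' r γ I where
  null i hi t ht := by rw [h.form_rescale hγ R hi.le ht, h.null i hi t ht, mul_zero]
  ne t ht := by
    rw [h.form_rescale hγ R le_rfl ht]
    exact mul_ne_zero (pow_ne_zero _ (R.pos _).ne') (h.ne t ht)

lemma speed_rescale {t : ℝ} (ht : t ∈ I) : speed g' r γ t = Ω (γ t) * speed g r γ t := by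
  rw [speed_eq, speed_eq, h.form_rescale hγ R le_rfl ht, abs_mul, abs_of_nonneg (sq_nonneg _),
    Real.sqrt_mul (sq_nonneg _), Real.sqrt_sq (R.pos _).le]

lemma derT_rescale (hn : 3 ≤ n) (k : ℕ) {t : ℝ} (ht : t ∈ I) :
    derT g' r γ k t = resc g Ω γ t (derT g r γ k t) := by
  induction k generalizing t with
  | zero =>
    rw [derT_zero, derT_zero, h.speed_rescale hγ R ht]
    simp [resc, mul_comm]
  | succ k ih =>
    rw [derT_succ, derT_succ, ← tder_resc hn R hγ ((h.tractor_isChain hγ).sm k) ht]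
    exact (tracModule g' hγ).D_congr (fun t ht => ih ht) ht

end Conformal

end NullConditions

end NullCurves

end ConfCurve
end

/-! ### Reparametrization of null curves -/

noncomputable section

namespace ConfCurve

section ReparamNull

set_option maxSynthPendingDepth 3
set_option linter.unusedSectionVars false

variable {n p q : ℕ} {M : Type*} [TopologicalSpace M] [ChartedSpace (E n) M]
  [IsManifold (𝓡 n) 1 M] [IsManifold (𝓡 n) ∞ M] {γ : ℝ → M} {J K : Set ℝ} {r : ℕ} {f φ : ℝ → ℝ}

/-- A change of parameter `φ : K → J`, whose inverse has the derivative `f`. -/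
structure ParamChange (J K : Set ℝ) (f φ : ℝ → ℝ) : Prop where
  isOpen : IsOpen K
  mapsTo : MapsTo φ K J
  smooth : RSmooth J f
  ne : ∀ t ∈ J, f t ≠ 0
  hasDerivAt : ∀ τ ∈ K, HasDerivAt φ (f (φ τ))⁻¹ τ

/-- The derived vectors for a new parameter with derivative `f`, in terms of the old parameter. -/
def repV (g : PseudoMetric n p q M) (γ : ℝ → M) (f : ℝ → ℝ) : ℕ → ℝ → E n
  | 0 => f⁻¹ • vel n γ
  | k + 1 => f⁻¹ • cov g γ (repV g γ f k)

/-- The derivatives of the canonical lift for a new parameter with derivative `f`, in terms of the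
old parameter. -/
def repT (g : PseudoMetric n p q M) (r : ℕ) (γ : ℝ → M) (f : ℝ → ℝ) : ℕ → ℝ → Trip n
  | 0 => (fun t => |f t| ^ (r + 1)) • derT g r γ 0
  | k + 1 => f⁻¹ • tder g γ (repT g r γ f k)

lemma tder_comp (g : PseudoMetric n p q M) (hγ : SmoothCurve n γ J)
    (hγφ : SmoothCurve n (γ ∘ φ) K) {S : ℝ → Trip n} (hS : TSmooth γ J S) {τ : ℝ} (hτ : τ ∈ K)
    (hφ : DifferentiableAt ℝ φ τ) (ht : φ τ ∈ J) :
    tder g (γ ∘ φ) (S ∘ φ) τ = deriv φ τ • tder g γ S (φ τ) := by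
  have e1 : deriv (fun s => ((S ∘ φ) s).1) τ = deriv (fun s => (S s).1) (φ τ) * deriv φ τ :=
    ((hS.1.hasDerivAt ht).comp τ hφ.hasDerivAt).deriv
  have e2 : cov g (γ ∘ φ) (fun s => ((S ∘ φ) s).2.1) τ = deriv φ τ •
      cov g γ (fun s => (S s).2.1) (φ τ) := cov_comp g hγ hγφ hS.2.1 hτ hφ ht
  have e3 : deriv (fun s => ((S ∘ φ) s).2.2) τ = deriv (fun s => (S s).2.2) (φ τ) * deriv φ τ :=
    ((hS.2.2.hasDerivAt ht).comp τ hφ.hasDerivAt).deriv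
  rw [tder, e1, e2, e3, vel_comp hγ hγφ hτ hφ ht, schS_smul]
  refine Prod.ext ?_ (Prod.ext ?_ ?_) <;>
    simp only [tder, Function.comp, Prod.smul_fst, Prod.smul_snd, map_smul, smul_apply, smul_eq_mul]
  · ring
  · module
  · ring

namespace NullConditions

open DerivModule

variable {g : PseudoMetric n p q M} (h : NullConditions g r γ J) (hγ : SmoothCurve n γ J)
  (hγφ : SmoothCurve n (γ ∘ φ) K) (hφ : ParamChange J K f φ)

section

include hγ hφ

lemma repV_lead (k : ℕ) : Lead (I := J) (derV g γ) k (f⁻¹ ^ (k + 1)) (repV g γ f k) := by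
  have hX := vec_isChain g hγ
  have hf := hφ.smooth.inv hφ.ne
  induction k with
  | zero => 
    refine ⟨by simpa using hf, 0, .zero, fun t _ => ?_⟩
    simp [repV, derV_zero]
  | succ k ih => rw [pow_succ']; exact (ih.D hX).smul hf

include hγφ

lemma derV_comp (k : ℕ) : EqOn (derV g (γ ∘ φ) k) (repV g γ f k ∘ φ) K := by
  induction k with
  | zero =>
    intro τ hτ
    have hd := hφ.hasDerivAt τ hτ
    rw [derV_zero, vel_comp hγ hγφ hτ hd.differentiableAt (hφ.mapsTo hτ), hd.deriv]
    rfl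
  | succ k ih =>
    intro τ hτ
    have hd := hφ.hasDerivAt τ hτ
    rw [derV_succ, cov_congr g (ih.eventuallyEq_of_mem (hφ.isOpen.mem_nhds hτ)),
      cov_comp g hγ hγφ ((repV_lead (g := g) hγ hφ k).inSpan.sm (vec_isChain g hγ)) hτ
        hd.differentiableAt (hφ.mapsTo hτ), hd.deriv]
    rfl

include h

lemma form_comp {k : ℕ} (hk : k ≤ r) {τ : ℝ} (hτ : τ ∈ K) :
    g.form (γ (φ τ)) (derV g (γ ∘ φ) k τ) (derV g (γ ∘ φ) k τ) = ((f (φ τ))⁻¹ ^ (k + 1)) ^ 2 *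
      g.form (γ (φ τ)) (derV g γ k (φ τ)) (derV g γ k (φ τ)) := by
  rw [derV_comp hγ hγφ hφ k hτ]
  exact h.form_lead hγ hk (repV_lead hγ hφ k) (hφ.mapsTo hτ)

lemma comp : NullConditions g r (γ ∘ φ) K where
  null i hi τ hτ := by
    refine (h.form_comp hγ hγφ hφ hi.le hτ).trans ?_
    rw [h.null i hi _ (hφ.mapsTo hτ), mul_zero]
  ne τ hτ := by
    refine (h.form_comp hγ hγφ hφ le_rfl hτ).trans_ne ?_
    exact mul_ne_zero (pow_ne_zero _ (pow_ne_zero _ (inv_ne_zero (hφ.ne _ (hφ.mapsTo hτ)))))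
      (h.ne _ (hφ.mapsTo hτ))

/-- U^{(r)} acquires the factor f^{-(r+1)} modulo lower terms orthogonal to it and to each other.
Thus T is multiplied by |f|^{r+1}, the initial coefficient in `repT`. -/
lemma speed_comp {τ : ℝ} (hτ : τ ∈ K) :
    speed g r (γ ∘ φ) τ = |(f (φ τ))⁻¹| ^ (r + 1) * speed g r γ (φ τ) := by
  rw [speed_eq, speed_eq, Function.comp, h.form_comp hγ hγφ hφ le_rfl hτ, abs_mul,
    Real.sqrt_mul (abs_nonneg _), abs_pow, Real.sqrt_sq (abs_nonneg _), abs_pow]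

end

section

include h hγ hφ

lemma repT_smooth (k : ℕ) : TSmooth γ J (repT g r γ f k) := by
  induction k with
  | zero =>
    refine (tracModule g hγ).sm_smul (fun t ht => ?_) ((h.tractor_isChain hγ).sm 0)
    exact ((contDiffAt_abs (hφ.ne t ht)).comp t (hφ.smooth t ht)).pow _
  | succ k ih => exact (tracModule g hγ).sm_smul (hφ.smooth.inv hφ.ne) ((tracModule g hγ).sm_D ih)

include hγφ

lemma derT_comp (k : ℕ) : EqOn (derT g r (γ ∘ φ) k) (repT g r γ f k ∘ φ) K := by
  induction k with
  | zero =>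
    intro τ hτ
    rw [derT_zero, h.speed_comp hγ hγφ hφ hτ, Function.comp, repT, Pi.smul_apply', derT_zero]
    simp [abs_inv, mul_comm]
  | succ k ih =>
    intro τ hτ
    have hd := hφ.hasDerivAt τ hτ
    rw [derT_succ]
    refine ((tracModule g hγφ).D_congr ih hτ).trans ?_
    refine (tder_comp g hγ hγφ (h.repT_smooth hγ hφ k) hτ hd.differentiableAt
      (hφ.mapsTo hτ)).trans ?_
    rw [hd.deriv]
    rfl

/-- The transformation law of `α`. -/
lemma alpha_comp {ε : ℝ}
    (hε : ∀ t ∈ J, tpair g (γ t) (derT g r γ (r + 1) t) (derT g r γ (r + 1) t) = ε)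
    {τ : ℝ} (hτ : τ ∈ K) :
    alpha g r (γ ∘ φ) τ = (f (φ τ) ^ 2)⁻¹ * (alpha g r γ (φ τ) - 2 * ε * coeffB r (r + 1) *
      (deriv (fun t => deriv f t / f t) (φ τ) - 1 / 2 * (deriv f (φ τ) / f (φ τ)) ^ 2)) := by
  have ht := hφ.mapsTo hτ
  have he : RSmooth J fun t => |f t| ^ (r + 1) := fun t ht =>
    ((contDiffAt_abs (hφ.ne t ht)).comp t (hφ.smooth t ht)).pow _
  -- The logarithmic derivative of |f| is f'/f for either sign of f, so orientation-reversing
  -- parameters need no separate treatment.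
  have he' : ∀ t ∈ J, deriv (fun t => |f t| ^ (r + 1)) t =
      (r + 1) * (deriv f t / f t) * |f t| ^ (r + 1) := fun t ht => by
    have h0 := hφ.ne t ht
    have := ((hasDerivAt_abs h0).comp t (hφ.smooth.hasDerivAt ht)).fun_pow (r + 1)
    refine this.deriv.trans ?_
    rcases h0.lt_or_gt with hneg | hpos
    · simp [abs_of_neg hneg, sign_neg hneg]; field_simp; ring
    · simp [abs_of_pos hpos, sign_pos hpos]; field_simp; ring
  have hL := lead₃_reparam (𝓓 := tracModule g hγ) (h.tractor_isChain hγ) hφ.smooth hφ.ne he he'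
    (Y := repT g r γ f) (fun t _ => rfl) (fun k t _ => rfl) r
  have hp := hL.pair_self (h.tractor_isChain hγ) (fun i hi t ht => h.tractor_null hγ i hi ht) hε ht
  rw [alpha_eq, alpha_eq, h.derT_comp hγ hγφ hφ (r + 2) hτ]
  refine hp.trans ?_
  have hB := coeff_identity r
  have h0 := hφ.ne _ ht
  -- The leading coefficient is ±1/f; its square is the weight of α.
  have ha : (|f (φ τ)| ^ (r + 1) * (f (φ τ))⁻¹ ^ (r + 2)) ^ 2 = (f (φ τ) ^ 2)⁻¹ := by
    rw [mul_pow, ← pow_mul, mul_comm (r + 1) 2, pow_mul, sq_abs, ← pow_mul, inv_pow, inv_pow,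
      ← pow_mul]
    field_simp
    ring
  rw [← ha, ← hB]
  change _ * tpair g _ _ _ - _ + _ = _
  ring

end

end NullConditions

end ReparamNull

end ConfCurve
end

/-! ### Parameters, the Schwarzian equation and Möbius freedom -/

noncomputable section

namespace ConfCurve

section Parameters

variable {J : Set ℝ} {s : ℝ → ℝ}

/-- Solutions of smooth differential equations are smooth. -/
lemma contDiffOn_of_hasDerivAt {G : Type*} [NormedAddCommGroup G] [NormedSpace ℝ G] {K : Set ℝ}
    (hK : IsOpen K) {y : ℝ → G} {v : G → G} (hv : ∀ τ ∈ K, ContDiffAt ℝ ∞ v (y τ))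
    (hy : ∀ τ ∈ K, HasDerivAt y (v (y τ)) τ) : ContDiffOn ℝ ∞ y K := by
  have hd : DifferentiableOn ℝ y K := fun τ hτ =>
    (hy τ hτ).differentiableAt.differentiableWithinAt
  rw [contDiffOn_infty]
  intro m
  -- Bootstrapping: if y is C^m then y' = v ∘ y is C^m, so y is C^{m+1}.
  induction m with
  | zero => exact contDiffOn_zero.2 hd.continuousOn
  | succ m ih =>
    push_cast
    refine (contDiffOn_succ_iff_deriv_of_isOpen hK).2 ⟨hd, by simp, ?_⟩
    refine ContDiffOn.congr (f := v ∘ y) (fun τ hτ => ?_) fun _ hτ => (hy _ hτ).deriv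
    exact (((hv τ hτ).of_le (by exact_mod_cast le_top)).comp τ
      (ih.contDiffAt (hK.mem_nhds hτ))).contDiffWithinAt

namespace IsParameter

variable (hs : IsParameter J s) (hJ : IsOpen J)

include hs

/-- Rolle's theorem: equal values would produce a zero of s' between them. -/
lemma injOn (hJc : J.OrdConnected) : InjOn s J := by
  have key : ∀ a ∈ J, ∀ b ∈ J, a < b → s a ≠ s b := fun a ha b hb hab he => by
    have hsub := hJc.out ha hb
    obtain ⟨c, hc, h0⟩ := exists_deriv_eq_zero hab (hs.1.continuousOn.mono hsub) he
    exact hs.2 c (hsub (Ioo_subset_Icc_self hc)) h0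
  intro a ha b hb he
  rcases lt_trichotomy a b with h | h | h
  · exact (key a ha b hb h he).elim
  · exact h
  · exact (key b hb a ha h he.symm).elim

include hJ

lemma rsmooth : RSmooth J s := RSmooth.of_contDiffOn hJ hs.1

lemma hasStrictDerivAt {t : ℝ} (ht : t ∈ J) : HasStrictDerivAt s (deriv s t) t :=
  (hs.rsmooth hJ t ht).hasStrictDerivAt (by simp)

lemma isOpen_image : IsOpen (s '' J) := by
  rw [isOpen_iff_mem_nhds]
  rintro _ ⟨t, ht, rfl⟩
  rw [← (hs.hasStrictDerivAt hJ ht).map_nhds_eq (hs.2 t ht)]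
  exact Filter.image_mem_map (hJ.mem_nhds ht)

lemma paramChange (hJc : J.OrdConnected) :
    ParamChange J (s '' J) (deriv s) (Function.invFunOn s J) := by
  have hinv := (hs.injOn hJc).leftInvOn_invFunOn
  refine ⟨hs.isOpen_image hJ, ?_, (hs.rsmooth hJ).deriv, hs.2, ?_⟩
  · rintro _ ⟨t, ht, rfl⟩; rwa [hinv ht]
  · rintro _ ⟨t, ht, rfl⟩
    rw [hinv ht]
    exact ((hs.hasStrictDerivAt hJ ht).to_local_left_inverse (hs.2 t ht)
      (Filter.eventually_of_mem (hJ.mem_nhds ht) fun _ hu => hinv hu)).hasDerivAt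

end IsParameter

/-- φ solves the autonomous equation φ' = 1/f(φ) with smooth right-hand side. -/
lemma ParamChange.contDiffOn {K : Set ℝ} {f φ : ℝ → ℝ} (h : ParamChange J K f φ) :
    ContDiffOn ℝ ∞ φ K :=
  contDiffOn_of_hasDerivAt (v := f⁻¹) h.isOpen
    (fun _ hτ => (h.smooth.inv h.ne) _ (h.mapsTo hτ)) h.hasDerivAt

/-! ### The Schwarzian derivative -/

lemma schwarzian_eq_of_hasDerivAt (hJ : IsOpen J) {f w : ℝ → ℝ}
    (hs : ∀ t ∈ J, HasDerivAt s (f t) t) (hf : ∀ t ∈ J, HasDerivAt f (f t * w t) t)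
    (hf0 : ∀ t ∈ J, f t ≠ 0) {w' t : ℝ} (ht : t ∈ J) (hw : HasDerivAt w w' t) :
    schwarzian s t = w' - 1 / 2 * w t ^ 2 := by
  have e1 : EqOn (deriv s) f J := fun t ht => (hs t ht).deriv
  have e2 : EqOn (deriv (deriv s)) (f * w) J := fun t ht =>
    (e1.eventuallyEq_of_mem (hJ.mem_nhds ht)).deriv_eq.trans (hf t ht).deriv
  have e3 : deriv (deriv (deriv s)) t = f t * w t * w t + f t * w' :=
    (e2.eventuallyEq_of_mem (hJ.mem_nhds ht)).deriv_eq.trans ((hf t ht).mul hw).deriv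
  simp only [schwarzian, iteratedDeriv_succ, iteratedDeriv_zero]
  rw [e3, e2 ht, e1 ht]
  have := hf0 t ht
  simp only [Pi.mul_apply]
  field_simp
  ring

namespace IsParameter

variable (hs : IsParameter J s) (hJ : IsOpen J)

include hs hJ

/-- The logarithmic derivative of `s'`. -/
lemma hasDerivAt_log {t : ℝ} (ht : t ∈ J) :
    HasDerivAt (fun t => deriv (deriv s) t / deriv s t)
      (deriv (fun t => deriv (deriv s) t / deriv s t) t) t := by
  have h1 := (hs.rsmooth hJ).deriv
  have : RSmooth J fun t => deriv (deriv s) t / deriv s t := fun t ht =>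
    (h1.deriv t ht).div (h1 t ht) (hs.2 t ht)
  exact this.hasDerivAt ht

lemma schwarzian_eq {t : ℝ} (ht : t ∈ J) : schwarzian s t =
    deriv (fun t => deriv (deriv s) t / deriv s t) t
      - 1 / 2 * (deriv (deriv s) t / deriv s t) ^ 2 :=
  schwarzian_eq_of_hasDerivAt hJ (fun _ ht => (hs.rsmooth hJ).hasDerivAt ht)
    (fun t ht => ((hs.rsmooth hJ).deriv.hasDerivAt ht).congr_deriv
      (mul_div_cancel₀ _ (hs.2 t ht)).symm) hs.2 ht (hs.hasDerivAt_log hJ ht)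

end IsParameter

/-- There are local parameters with a given Schwarzian derivative. -/
lemma exists_isParameter {I : Set ℝ} (hI : IsOpen I) {Q : ℝ → ℝ} (hQ : RSmooth I Q) {t₀ : ℝ}
    (ht₀ : t₀ ∈ I) : ∃ J ⊆ I, IsOpen J ∧ J.OrdConnected ∧ t₀ ∈ J ∧
      ∃ s, IsParameter J s ∧ ∀ t ∈ J, schwarzian s t = Q t := by
  -- The system for (t, w, s', s) with w = s''/s': the Schwarzian equation is w' = w²/2 + Q(t), and
  -- adjoining time makes it autonomous. The initial value (t₀, 0, 1, 0) gives s' = 1 at t₀, so s'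
  -- stays nonzero nearby.
  let v : ℝ × ℝ × ℝ × ℝ → ℝ × ℝ × ℝ × ℝ := fun x =>
    (1, x.2.1 ^ 2 / 2 + Q x.1, x.2.2.1 * x.2.1, x.2.2.1)
  have hv : ∀ x : ℝ × ℝ × ℝ × ℝ, x.1 ∈ I → ContDiffAt ℝ ∞ v x := fun x hx => by
    have h1 : ContDiffAt ℝ ∞ (fun x : ℝ × ℝ × ℝ × ℝ => Q x.1) x := (hQ _ hx).comp x contDiffAt_fst
    have h2 : ContDiffAt ℝ ∞ (fun x : ℝ × ℝ × ℝ × ℝ => x.2.1) x := by fun_prop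
    have h3 : ContDiffAt ℝ ∞ (fun x : ℝ × ℝ × ℝ × ℝ => x.2.2.1) x := by fun_prop
    exact contDiffAt_const.prodMk ((((h2.pow 2).div_const 2).add h1).prodMk ((h3.mul h2).prodMk h3))
  obtain ⟨α, hα0, δ, hδ, hα⟩ :=
    ContDiffAt.exists_forall_mem_closedBall_exists_eq_forall_mem_Ioo_hasDerivAt₀
      ((hv (t₀, 0, 1, 0) ht₀).of_le (by simp)) t₀
  have c1 : ∀ t ∈ Ioo (t₀ - δ) (t₀ + δ), HasDerivAt (fun t => (α t).1) 1 t := fun t ht =>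
    (hα t ht).fst
  have hO : IsOpen (Ioo (t₀ - δ) (t₀ + δ)) := isOpen_Ioo
  have hmem : t₀ ∈ Ioo (t₀ - δ) (t₀ + δ) := by constructor <;> linarith
  have h1 : ∀ t ∈ Ioo (t₀ - δ) (t₀ + δ), (α t).1 = t := fun t ht => by
    have := hO.is_const_of_deriv_eq_zero isPreconnected_Ioo (f := fun t => (α t).1 - t)
      (fun t ht => ((c1 t ht).sub (hasDerivAt_id t)).differentiableAt.differentiableWithinAt)
      (fun t ht => ((c1 t ht).sub (hasDerivAt_id t)).deriv.trans (sub_self 1)) ht hmem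
    simp only [hα0] at this
    linarith
  have hcont : ContinuousAt (fun t => (α t).2.2.1) t₀ :=
    ((hα t₀ hmem).continuousAt.snd.snd.fst)
  have hne : ∀ᶠ t in nhds t₀, (α t).2.2.1 ≠ 0 := hcont.eventually_ne (by simp [hα0])
  obtain ⟨η, hη, hball⟩ := Metric.eventually_nhds_iff_ball.1
    ((hne.and (hI.eventually_mem ht₀)).and (hO.eventually_mem hmem))
  refine ⟨Metric.ball t₀ η, fun t ht => (hball t ht).1.2, Metric.isOpen_ball, ?_,
    Metric.mem_ball_self hη, fun t => (α t).2.2.2, ⟨?_, ?_⟩, ?_⟩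
  · rw [Real.ball_eq_Ioo]; exact ordConnected_Ioo
  · have : ContDiffOn ℝ ∞ α (Metric.ball t₀ η) :=
      contDiffOn_of_hasDerivAt Metric.isOpen_ball (v := v)
        (fun t ht => hv _ (by rw [h1 t (hball t ht).2]; exact (hball t ht).1.2))
        fun t ht => hα t (hball t ht).2
    exact this.snd.snd.snd
  · intro t ht
    have h : HasDerivAt (fun t => (α t).2.2.2) (α t).2.2.1 t :=
      (hα t (hball t ht).2).snd.snd.snd
    rw [h.deriv]; exact (hball t ht).1.1
  · intro t ht
    have hw := (hα t (hball t ht).2).snd.fst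
    rw [schwarzian_eq_of_hasDerivAt Metric.isOpen_ball (f := fun t => (α t).2.2.1)
      (w := fun t => (α t).2.1) (fun t ht => (hα t (hball t ht).2).snd.snd.snd)
      (fun t ht => (hα t (hball t ht).2).snd.snd.fst) (fun t ht => (hball t ht).1.1) ht hw]
    simp only [v, h1 t (hball t ht).2]
    ring

/-! ### The freedom of the parameters with a given Schwarzian derivative -/

/-- Solutions `y` of `y'' = -Q y / 2` with derivative `y'`. -/
def IsSol (J : Set ℝ) (Q y y' : ℝ → ℝ) : Prop :=
  ∀ t ∈ J, HasDerivAt y (y' t) t ∧ HasDerivAt y' (-(Q t / 2) * y t) t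

lemma eq_const_of_hasDerivAt_zero (hJ : IsOpen J) (hJc : J.OrdConnected) {f : ℝ → ℝ}
    (hf : ∀ t ∈ J, HasDerivAt f 0 t) : ∃ c, ∀ t ∈ J, f t = c :=
  hJ.exists_is_const_of_deriv_eq_zero hJc.isPreconnected
    (fun t ht => (hf t ht).differentiableAt.differentiableWithinAt) fun t ht => (hf t ht).deriv

lemma IsSol.wronskian {Q y y' z z' : ℝ → ℝ} (hJ : IsOpen J) (hJc : J.OrdConnected)
    (hy : IsSol J Q y y') (hz : IsSol J Q z z') : ∃ c, ∀ t ∈ J, y t * z' t - y' t * z t = c :=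
  eq_const_of_hasDerivAt_zero hJ hJc fun t ht =>
    (((hy t ht).1.mul (hz t ht).2).sub ((hy t ht).2.mul (hz t ht).1)).congr_deriv (by ring)

/-- The solutions that belong to a parameter `s`. -/
lemma IsParameter.exists_isSol (hs : IsParameter J s) (hJ : IsOpen J) (hJc : J.OrdConnected) :
    ∃ y y' z' : ℝ → ℝ, (∀ t ∈ J, y t ≠ 0) ∧ IsSol J (schwarzian s) y y' ∧
      IsSol J (schwarzian s) (s * y) z' ∧
      (J.Nonempty → ∃ κ ≠ 0, ∀ t ∈ J, y t * z' t - y' t * (s * y) t = κ) := by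
  set w : ℝ → ℝ := fun t => deriv (deriv s) t / deriv s t with hw
  -- This is |s'|^{-1/2} on J, because `Real.log` is the logarithm of the absolute value; both signs
  -- of s' are covered.
  set y : ℝ → ℝ := fun t => Real.exp (-(1 / 2) * Real.log (deriv s t)) with hy
  have hy0 : ∀ t, y t ≠ 0 := fun t => (Real.exp_pos _).ne'
  have d0 : ∀ t ∈ J, HasDerivAt s (deriv s t) t := fun t ht => (hs.rsmooth hJ).hasDerivAt ht
  have d1 : ∀ t ∈ J, HasDerivAt (deriv s) (deriv s t * w t) t := fun t ht =>
    ((hs.rsmooth hJ).deriv.hasDerivAt ht).congr_deriv (mul_div_cancel₀ _ (hs.2 t ht)).symm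
  have dw : ∀ t ∈ J, HasDerivAt w (schwarzian s t + 1 / 2 * w t ^ 2) t := fun t ht =>
    (hs.hasDerivAt_log hJ ht).congr_deriv (by rw [hs.schwarzian_eq hJ ht]; ring)
  have dy : ∀ t ∈ J, HasDerivAt y (-(1 / 2) * w t * y t) t := fun t ht =>
    ((((d1 t ht).log (hs.2 t ht)).const_mul (-(1 / 2))).exp).congr_deriv (by
      have := hs.2 t ht
      simp only [hy]; field_simp)
  have dy' : ∀ t ∈ J, HasDerivAt (fun t => -(1 / 2) * w t * y t)
      (-(schwarzian s t / 2) * y t) t := fun t ht =>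
    (((dw t ht).const_mul (-(1 / 2))).mul (dy t ht)).congr_deriv (by ring)
  refine ⟨y, fun t => -(1 / 2) * w t * y t,
    fun t => deriv s t * y t + s t * (-(1 / 2) * w t * y t), fun t _ => hy0 t,
    fun t ht => ⟨dy t ht, dy' t ht⟩, fun t ht => ⟨(d0 t ht).mul (dy t ht), ?_⟩, fun ⟨t₀, ht₀⟩ => ?_⟩
  · exact (((d1 t ht).mul (dy t ht)).add ((d0 t ht).mul (dy' t ht))).congr_deriv (by
      simp only [Pi.mul_apply]; ring)
  -- The Wronskian of y and s y is s'y², a nonzero constant.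
  · obtain ⟨κ, hκ⟩ := eq_const_of_hasDerivAt_zero hJ hJc (f := fun t => deriv s t * (y t * y t))
      fun t ht => ((d1 t ht).mul ((dy t ht).mul (dy t ht))).congr_deriv (by
        simp only [Pi.mul_apply]; ring)
    refine ⟨κ, ?_, fun t ht => ?_⟩
    · rw [← hκ t₀ ht₀]
      exact mul_ne_zero (hs.2 t₀ ht₀) (mul_ne_zero (hy0 t₀) (hy0 t₀))
    · rw [← hκ t ht]; simp only [Pi.mul_apply]; ring

/-- Both parameters are quotients of solutions of one linear equation y'' = -Qy/2. Expressing the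
basis (z, s'z) through (y, sy) has constant Wronskians as coefficients, and dividing the two
relations gives the Möbius map. -/
lemma IsParameter.exists_moebius {s' : ℝ → ℝ} (hs : IsParameter J s) (hs' : IsParameter J s')
    (hJ : IsOpen J) (hJc : J.OrdConnected) (he : EqOn (schwarzian s') (schwarzian s) J) :
    ∃ a b d e : ℝ, a * e - b * d ≠ 0 ∧
      ∀ t ∈ J, d * s t + e ≠ 0 ∧ s' t = (a * s t + b) / (d * s t + e) := by
  rcases J.eq_empty_or_nonempty with rfl | hne
  · exact ⟨1, 0, 0, 1, by norm_num, by simp⟩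
  obtain ⟨y, y', x', hy0, hy, hx, hκ⟩ := hs.exists_isSol hJ hJc
  obtain ⟨κ, hκ0, hκ⟩ := hκ hne
  obtain ⟨z, z', u', hz0, hz, hu, hl⟩ := hs'.exists_isSol hJ hJc
  obtain ⟨l, hl0, hl⟩ := hl hne
  have hz : IsSol J (schwarzian s) z z' := fun t ht => by rw [← he ht]; exact hz t ht
  have hu : IsSol J (schwarzian s) (s' * z) u' := fun t ht => by rw [← he ht]; exact hu t ht
  obtain ⟨a, ha⟩ := hy.wronskian hJ hJc hu
  obtain ⟨b, hb⟩ := hu.wronskian hJ hJc hx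
  obtain ⟨d, hd⟩ := hy.wronskian hJ hJc hz
  obtain ⟨e, he⟩ := hz.wronskian hJ hJc hx
  refine ⟨a, b, d, e, ?_, fun t ht => ?_⟩
  · obtain ⟨t, ht⟩ := hne
    -- The quadratic identity between the Wronskians of four functions; κ and l belong to the two
    -- bases.
    have : a * e - b * d = κ * l := by
      rw [← ha t ht, ← hb t ht, ← hd t ht, ← he t ht, ← hκ t ht, ← hl t ht]; ring
    rw [this]; exact mul_ne_zero hκ0 hl0
  · have h1 : κ * z t = (d * s t + e) * y t := by
      rw [← hκ t ht, ← hd t ht, ← he t ht]; simp only [Pi.mul_apply]; ring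
    have h2 : κ * (s' t * z t) = (a * s t + b) * y t := by
      rw [← hκ t ht, ← ha t ht, ← hb t ht]; simp only [Pi.mul_apply]; ring
    have h3 : d * s t + e ≠ 0 := fun h0 => by
      rw [h0, zero_mul] at h1; exact mul_ne_zero hκ0 (hz0 t ht) h1
    refine ⟨h3, ?_⟩
    rw [eq_div_iff h3]
    refine mul_right_cancel₀ (hy0 t ht) ?_
    rw [mul_assoc, ← h1, ← h2]; ring

lemma IsParameter.moebius {s' : ℝ → ℝ} (hs : IsParameter J s) (hJ : IsOpen J) {a b d e : ℝ}
    (hdet : a * e - b * d ≠ 0)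
    (h : ∀ t ∈ J, d * s t + e ≠ 0 ∧ s' t = (a * s t + b) / (d * s t + e)) :
    IsParameter J s' ∧ EqOn (schwarzian s') (schwarzian s) J := by
  set D : ℝ → ℝ := fun t => d * s t + e with hD
  set w : ℝ → ℝ := fun t => deriv (deriv s) t / deriv s t with hw
  have h0 : ∀ t ∈ J, D t ≠ 0 := fun t ht => (h t ht).1
  have d0 : ∀ t ∈ J, HasDerivAt s (deriv s t) t := fun t ht => (hs.rsmooth hJ).hasDerivAt ht
  have d1 : ∀ t ∈ J, HasDerivAt (deriv s) (deriv s t * w t) t := fun t ht =>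
    ((hs.rsmooth hJ).deriv.hasDerivAt ht).congr_deriv (mul_div_cancel₀ _ (hs.2 t ht)).symm
  have dD : ∀ t ∈ J, HasDerivAt D (d * deriv s t) t := fun t ht =>
    ((d0 t ht).const_mul d).add_const e
  have ds' : ∀ t ∈ J, HasDerivAt s' ((a * e - b * d) * deriv s t / D t ^ 2) t := fun t ht => by
    have h1 := (((d0 t ht).const_mul a).add_const b).div (dD t ht) (h0 t ht)
    refine (h1.congr_of_eventuallyEq ?_).congr_deriv ?_
    · filter_upwards [hJ.mem_nhds ht] with u hu using (h u hu).2
    · simp only [hD]; ring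
  -- The logarithmic derivative of the new s' is w - 2d s'/D; substituted into w' - w²/2, the extra
  -- terms cancel.
  have ds'' : ∀ t ∈ J, HasDerivAt (fun t => (a * e - b * d) * deriv s t / D t ^ 2)
      ((a * e - b * d) * deriv s t / D t ^ 2 * (w t - 2 * d * deriv s t / D t)) t := fun t ht => by
    have := h0 t ht
    refine (((d1 t ht).const_mul (a * e - b * d)).div ((dD t ht).pow 2)
      (pow_ne_zero 2 this)).congr_deriv ?_
    simp only [Pi.pow_apply]
    field_simp
    ring
  have hne : ∀ t ∈ J, (a * e - b * d) * deriv s t / D t ^ 2 ≠ 0 := fun t ht =>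
    div_ne_zero (mul_ne_zero hdet (hs.2 t ht)) (pow_ne_zero 2 (h0 t ht))
  refine ⟨⟨?_, fun t ht => by rw [(ds' t ht).deriv]; exact hne t ht⟩, fun t ht => ?_⟩
  · refine ContDiffOn.congr (f := fun t => (a * s t + b) / D t) ?_ fun t ht => (h t ht).2
    exact ((contDiffOn_const.mul hs.1).add contDiffOn_const).div
      ((contDiffOn_const.mul hs.1).add contDiffOn_const) h0
  · have dw := (hs.hasDerivAt_log hJ ht).sub ((((d1 t ht).const_mul (2 * d)).div (dD t ht) (h0 t ht)))
    rw [hs.schwarzian_eq hJ ht, schwarzian_eq_of_hasDerivAt hJ ds' ds'' hne ht dw]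
    have := h0 t ht
    field_simp
    ring

end Parameters

end ConfCurve
end

/-! ### Assembly -/

noncomputable section

namespace ConfCurve

section Main

set_option maxSynthPendingDepth 3
set_option linter.unusedSectionVars false

variable {n p q r : ℕ} {M : Type*} [TopologicalSpace M] [ChartedSpace (E n) M]
  [IsManifold (𝓡 n) 1 M] [IsManifold (𝓡 n) ∞ M] {γ : ℝ → M} {I J : Set ℝ} {s : ℝ → ℝ}

lemma SmoothCurve.mono (hγ : SmoothCurve n γ I) (hJ : IsOpen J) (hJI : J ⊆ I) :
    SmoothCurve n γ J := ⟨hJ, hγ.smooth.mono hJI⟩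

lemma SmoothCurve.reparam (hγ : SmoothCurve n γ J) (hJc : J.OrdConnected)
    (hs : IsParameter J s) : SmoothCurve n (reparam γ J s) (s '' J) := by
  have hφ := hs.paramChange hγ.isOpen hJc
  exact ⟨hφ.isOpen, hγ.smooth.comp hφ.contDiffOn.contMDiffOn hφ.mapsTo⟩

namespace NullConditions

variable {g : PseudoMetric n p q M} (h : NullConditions g r γ J)

include h

lemma mono {J' : Set ℝ} (hJ : J' ⊆ J) : NullConditions g r γ J' :=
  ⟨fun i hi t ht => h.null i hi t (hJ ht), fun t ht => h.ne t (hJ ht)⟩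

variable (hγ : SmoothCurve n γ J) (hJc : J.OrdConnected) (hs : IsParameter J s)

include hγ hJc hs

lemma reparam : NullConditions g r (reparam γ J s) (s '' J) :=
  h.comp hγ (hγ.reparam hJc hs) (hs.paramChange hγ.isOpen hJc)

lemma alpha_reparam {ε : ℝ}
    (hε : ∀ t ∈ J, tpair g (γ t) (derT g r γ (r + 1) t) (derT g r γ (r + 1) t) = ε)
    {t : ℝ} (ht : t ∈ J) : alpha g r (ConfCurve.reparam γ J s) (s t) =
      (deriv s t ^ 2)⁻¹ * (alpha g r γ t - 2 * ε * coeffB r (r + 1) * schwarzian s t) := by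
  have := h.alpha_comp hγ (hγ.reparam hJc hs) (hs.paramChange hγ.isOpen hJc) hε
    (mem_image_of_mem s ht)
  rw [(hs.injOn hJc).leftInvOn_invFunOn ht] at this
  rw [hs.schwarzian_eq hγ.isOpen ht]
  exact this

end NullConditions

lemma derivedT_rescale (hn : 3 ≤ n) {g g' : PseudoMetric n p q M} {Ω : M → ℝ}
    (R : IsRescaling g g' Ω) (h : NullConditions g r γ I) (hγ : SmoothCurve n γ I) (k : ℕ) {t : ℝ}
    (ht : t ∈ I) : derivedT g' r γ k t = rescaleTractor g Ω (γ t) (derivedT g r γ k t) := by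
  have e : derT g' r γ k t = _ := h.derT_rescale hγ R hn k ht
  refine Tractor.ext (congrArg Prod.fst e) (congrArg (fun S => S.2.1) e)
    ((congrArg (fun S => S.2.2) e).trans ?_)
  simp only [resc, form_upsField]
  rfl

lemma tpair_derT_rescale (hn : 3 ≤ n) {g g' : PseudoMetric n p q M} {Ω : M → ℝ}
    (R : IsRescaling g g' Ω) (h : NullConditions g r γ I) (hγ : SmoothCurve n γ I) (k : ℕ) {t : ℝ}
    (ht : t ∈ I) : tpair g' (γ t) (derT g' r γ k t) (derT g' r γ k t) =
      tpair g (γ t) (derT g r γ k t) (derT g r γ k t) := by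
  rw [h.derT_rescale hγ R hn k ht, tpair_resc R]

end Main

end ConfCurve
end

theorem mainTheorem10 {n p q r : ℕ} (hn : 3 ≤ n) (hpq : p + q = n) (hr : r ≤ min p q)
    {M : Type*} [TopologicalSpace M] [ChartedSpace (ConfCurve.E n) M] [IsManifold (𝓡 n) ∞ M]
    (c : ConfCurve.ConformalStructure n p q M)
    (I : Set ℝ) (hI : IsOpen I) (hI' : I.OrdConnected)
    (γ : ℝ → M) (hγ : ConfCurve.IsRNullCurve c r γ I) :
    -- the notions involved do not depend on the scale
    (∀ g ∈ c.metrics, ConfCurve.IsRNullIn g r γ I) ∧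
    (∀ k, ∀ t ∈ I,
      ConfCurve.IsStandardTractor c (γ t) (fun g => ConfCurve.derivedT g r γ k t)) ∧
    (∀ g ∈ c.metrics, ∀ g' ∈ c.metrics, ∀ t ∈ I,
      ConfCurve.alpha g' r γ t = ConfCurve.alpha g r γ t) ∧
    -- the transformation law of `α`
    (∃ ε : ℝ, (ε = 1 ∨ ε = -1) ∧
      (∀ g ∈ c.metrics, ∀ t ∈ I, ConfCurve.pairing g (γ t) (ConfCurve.derivedU g r γ r t)
        (ConfCurve.derivedU g r γ r t) = ε) ∧
      ConfCurve.coeffB r (r + 1) = ((r : ℝ) + 1) * (r + 2) * (2 * r + 3) / 6 ∧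
      ∀ J ⊆ I, IsOpen J → J.OrdConnected → ∀ s : ℝ → ℝ, ConfCurve.IsParameter J s →
        ConfCurve.IsRNullCurve c r (ConfCurve.reparam γ J s) (s '' J) ∧
        ∀ g ∈ c.metrics, ∀ t ∈ J,
          ConfCurve.alpha g r (ConfCurve.reparam γ J s) (s t) =
            ((deriv s t) ^ 2)⁻¹ * (ConfCurve.alpha g r γ t -
              2 * ε * ConfCurve.coeffB r (r + 1) * ConfCurve.schwarzian s t)) ∧
    -- around every point of the curve there are projective parameters
    (∀ t₀ ∈ I, ∃ J ⊆ I, IsOpen J ∧ J.OrdConnected ∧ t₀ ∈ J ∧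
      ∃ s : ℝ → ℝ, ConfCurve.IsProjectiveParameter c r γ J s) ∧
    -- their freedom is the projective group of the line
    (∀ J ⊆ I, IsOpen J → J.OrdConnected → ∀ s : ℝ → ℝ,
      ConfCurve.IsProjectiveParameter c r γ J s → ∀ s' : ℝ → ℝ,
        (ConfCurve.IsProjectiveParameter c r γ J s' ↔
          ∃ a b d e : ℝ, a * e - b * d ≠ 0 ∧
            ∀ t ∈ J, d * s t + e ≠ 0 ∧ s' t = (a * s t + b) / (d * s t + e))) := by
  have hγs : ConfCurve.SmoothCurve n γ I := ⟨hI, hγ.1⟩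
  obtain ⟨g₀, hg₀, h₀⟩ := hγ.2
  have hN : ∀ g ∈ c.metrics, ConfCurve.NullConditions g r γ I := fun g hg => by
    obtain ⟨Ω, R⟩ := (c.mem_iff g₀ hg₀ g).1 hg
    exact h₀.nullConditions.rescale hγs R
  obtain ⟨ε, hε, hεc⟩ := (hN g₀ hg₀).exists_sign hγs hI'
  have hεg : ∀ g ∈ c.metrics, ∀ t ∈ I, ConfCurve.tpair g (γ t) (ConfCurve.derT g r γ (r + 1) t)
      (ConfCurve.derT g r γ (r + 1) t) = ε := fun g hg t ht => by
    obtain ⟨Ω, R⟩ := (c.mem_iff g₀ hg₀ g).1 hg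
    rw [ConfCurve.tpair_derT_rescale hn R (hN g₀ hg₀) hγs _ ht, hεc t ht]
  have hα : ∀ g ∈ c.metrics, ∀ g' ∈ c.metrics, ∀ t ∈ I,
      ConfCurve.alpha g' r γ t = ConfCurve.alpha g r γ t := fun g hg g' hg' t ht => by
    obtain ⟨Ω, R⟩ := (c.mem_iff g hg g').1 hg'
    exact ConfCurve.tpair_derT_rescale hn R (hN g hg) hγs (r + 2) ht
  have hlaw : ∀ J ⊆ I, IsOpen J → J.OrdConnected → ∀ s : ℝ → ℝ, ConfCurve.IsParameter J s →
      ∀ g ∈ c.metrics, ∀ t ∈ J, ConfCurve.alpha g r (ConfCurve.reparam γ J s) (s t) =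
        ((deriv s t) ^ 2)⁻¹ * (ConfCurve.alpha g r γ t -
          2 * ε * ConfCurve.coeffB r (r + 1) * ConfCurve.schwarzian s t) :=
    fun J hJI hJ hJc s hs g hg t ht => ((hN g hg).mono hJI).alpha_reparam (hγs.mono hJ hJI) hJc hs
      (fun u hu => hεg g hg u (hJI hu)) ht
  -- Positivity of B allows α̃ = 0 to be solved for the Schwarzian.
  have hB : 2 * ε * ConfCurve.coeffB r (r + 1) ≠ 0 := by
    have := (ConfCurve.coeffB_last_pos r).ne'
    rcases hε with rfl | rfl <;> simpa using this
  -- projective parameters in terms of the Schwarzian derivative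
  have hproj : ∀ J ⊆ I, IsOpen J → J.OrdConnected → ∀ s : ℝ → ℝ,
      (ConfCurve.IsProjectiveParameter c r γ J s ↔ ConfCurve.IsParameter J s ∧
        ∀ t ∈ J, ConfCurve.schwarzian s t =
          ConfCurve.alpha g₀ r γ t / (2 * ε * ConfCurve.coeffB r (r + 1))) := by
    intro J hJI hJ hJc s
    refine and_congr_right fun hs => ⟨fun h t ht => ?_, ?_⟩
    · have h1 := h g₀ hg₀ _ (mem_image_of_mem s ht)
      rw [hlaw J hJI hJ hJc s hs g₀ hg₀ t ht, mul_eq_zero] at h1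
      have h2 := h1.resolve_left (inv_ne_zero (pow_ne_zero 2 (hs.2 t ht)))
      rw [eq_div_iff hB]; linarith
    · rintro h g hg _ ⟨t, ht, rfl⟩
      rw [hlaw J hJI hJ hJc s hs g hg t ht, hα g₀ hg₀ g hg t (hJI ht), h t ht, mul_div_cancel₀ _ hB,
        sub_self, mul_zero]
  refine ⟨fun g hg => (hN g hg).isRNullIn hγs,
    fun k t ht g hg g' _ Ω R => ConfCurve.derivedT_rescale hn R (hN g hg) hγs k ht, hα,
    ⟨ε, hε, hεg, ConfCurve.coeffB_last r, fun J hJI hJ hJc s hs => ⟨?_, hlaw J hJI hJ hJc s hs⟩⟩,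
    fun t₀ ht₀ => ?_, fun J hJI hJ hJc s hs s' => ?_⟩
  · have hγJ := hγs.mono hJ hJI
    exact ⟨(hγJ.reparam hJc hs).smooth, g₀, hg₀,
      (((hN g₀ hg₀).mono hJI).reparam hγJ hJc hs).isRNullIn (hγJ.reparam hJc hs)⟩
  -- α is smooth, being the square of a smooth tractor field, so the prescribed Schwarzian is an
  -- admissible right-hand side.
  · have hQ : ConfCurve.RSmooth I fun t =>
        ConfCurve.alpha g₀ r γ t / (2 * ε * ConfCurve.coeffB r (r + 1)) := fun t ht => by
      have := ((hN g₀ hg₀).tractor_isChain hγs).sm (r + 2)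
      have h2 := (hγs.form_smooth g₀ this.2.1 this.2.1 ht).add ((this.1 t ht).mul (this.2.2 t ht))
      exact (h2.add ((this.2.2 t ht).mul (this.1 t ht))).div_const _
    obtain ⟨J, hJI, hJ, hJc, hm, s, hs, hS⟩ := ConfCurve.exists_isParameter hI hQ ht₀
    exact ⟨J, hJI, hJ, hJc, hm, s, (hproj J hJI hJ hJc s).2 ⟨hs, hS⟩⟩
  · obtain ⟨hs, hS⟩ := (hproj J hJI hJ hJc s).1 hs
    rw [hproj J hJI hJ hJc s']
    constructor
    · rintro ⟨hs', hS'⟩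
      exact hs.exists_moebius hs' hJ hJc fun t ht => (hS' t ht).trans (hS t ht).symm
    · rintro ⟨a, b, d, e, hdet, h⟩
      obtain ⟨hs', he⟩ := hs.moebius hJ hdet h
      exact ⟨hs', fun t ht => (he ht).trans (hS t ht)⟩
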